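/- **Setting.** Work in $\mathbb R^3$ with coordinates $x,y,z$. An *analytic surface* is an embedded two-dimensional real-analytic submanifold of $\mathbb R^3$, possibly with boundary and possibly non-compact. *General isotropic similarities* are the invertible affine maps $$(x,y,z)\mapsto(h_1x-h_2y+b_1,\ h_2x+h_1y+b_2,\ c_1x+c_2y+c_3z+b_3);$$ *isotropic congruences* are those with $h_1=\cos\phi$, $h_2=\sin\phi$, $c_3=1$. If a surface is represented near a point as a graph $z=f(x,y)$, its *isotropic principal curvatures* $\kappa_1,\kappa_2$ at that point are the eigenvalues of the Hessian $\nabla^2 f$; moreover $H=(\kappa_1+\kappa_2)/2$ and $K=\kappa_1\kappa_2$. The surface is *Weingarten* if $F(H,K)=0$ at each of its points for a fixed function $F$ of two variables whose zero set is an analytic curve (possibly with singular points). It has a *constant ratio $a\neq0$ of isotropic principal curvatures* if at each point $\kappa_1/\kappa_2=a$ or $\kappa_2/\kappa_1=a$. A *parabolic isotropic sphere* of radius $1/A$ is a paraboloid $2z=A(x^2+y^2)+Bx+Cy+D$ with $A\ne0$. An *analytic isotropic channel surface* is an analytic surface $M$ that is the envelope of a family of parabolic isotropic spheres $$S(t):\quad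 2z=A(t)(x^2+y^2)+B(t)x+C(t)y+D(t),\qquad t\in J,$$ where $J\subset\mathbb R$ is an interval and $A,B,C,D$ are real-analytic on $J$. Here being the envelope means that for each $t\in J$ the set $c(t)$ of all points at which $M$ and $S(t)$ touch (i.e. common points with the same tangent plane) is a single curve without endpoints (a nonempty, connected, closed subset of $\mathbb R^3$ that is an embedded one-dimensional $C^1$ submanifold without boundary), and the curves $c(t)$ cover $M$. If the radii $1/A(t)$ are constant, then $M$ is an *isotropic pipe surface*. An *isotropic rotational surface* is an analytic surface that is the image under an isotropic congruence of a set invariant under all rotations about the $z$-axis. A *parabolic rotational surface* is an analytic surface that is the image under a general isotropic similarity of a set which is invariant, for some fixed $b\in\mathbb R$ and for all $t\in\mathbb R$, under the maps $(x,y,z)\mapsto(x+t,\ y,\ z+(x+by)t+t^2/2)$. **Theorem.** An analytic isotropic channel Weingarten surface is an isotropic rotational surface or an isotropic pipe surface. Moreover, an analytic isotropic channel surface with a constant nonzero ratio of isotropic principal curvatures is a subset of an isotropic rotational surface or of a parabolic rotational surface. -/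

import Mathlib

open Filter Topology

/-- Three-dimensional space with the coordinates `x`, `y`, `z`. -/
abbrev Space : Type := ℝ × ℝ × ℝ

/-- The top view: the projection along the `z`-axis. -/
def topView (p : Space) : ℝ × ℝ := (p.1, p.2.1)

/-! ### Surfaces and curves -/

/-- `M` is an analytic surface: an embedded two-dimensional real analytic submanifold of space,
possibly with boundary and possibly non-compact. Near each of its points, `M` is given by one
regular analytic equation `G = 0` (interior point), or by such an equation together with an
inequality `h ≥ 0`, where `h` vanishes at the point and the differentials of `G` and `h` are
linearly independent (boundary point). -/
def IsAnalyticSurface (M : Set Space) : Prop :=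
  ∀ p ∈ M, ∃ G : Space → ℝ, AnalyticAt ℝ G p ∧ fderiv ℝ G p ≠ 0 ∧
    ((∀ᶠ q in 𝓝 p, q ∈ M ↔ G q = 0) ∨
      ∃ h : Space → ℝ, AnalyticAt ℝ h p ∧ h p = 0 ∧
        LinearIndependent ℝ ![fderiv ℝ G p, fderiv ℝ h p] ∧
        ∀ᶠ q in 𝓝 p, q ∈ M ↔ (G q = 0 ∧ 0 ≤ h q))

/-- `c` is a single regular curve without endpoints: a nonempty connected closed subset of space
which is an embedded one-dimensional `C¹` submanifold without boundary. -/
def IsCurveWithoutEndpoints (c : Set Space) : Prop :=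
  IsClosed c ∧ IsConnected c ∧
    ∀ p ∈ c, ∃ G h : Space → ℝ, ContDiffAt ℝ 1 G p ∧ ContDiffAt ℝ 1 h p ∧
      LinearIndependent ℝ ![fderiv ℝ G p, fderiv ℝ h p] ∧
      ∀ᶠ q in 𝓝 p, q ∈ c ↔ (G q = 0 ∧ h q = 0)

/-- The (direction of the) tangent plane of `M` at `p`. The span is needed at boundary points. -/
def tangentPlane (M : Set Space) (p : Space) : Submodule ℝ Space :=
  Submodule.span ℝ (tangentConeAt ℝ M p)

/-- `M` and `N` touch at `p`. -/
def TouchesAt (M N : Set Space) (p : Space) : Prop :=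
  p ∈ M ∧ p ∈ N ∧ tangentPlane M p = tangentPlane N p

/-! ### Isotropic curvatures -/

/-- Near the point `p`, the surface `M` is represented as (a part of) the graph `z = f(x,y)` of an
analytic function `f`. -/
def IsLocalGraph (M : Set Space) (p : Space) (f : ℝ × ℝ → ℝ) : Prop :=
  AnalyticAt ℝ f (topView p) ∧ ∀ᶠ q in 𝓝[M] p, q.2.2 = f (topView q)

/-- The isotropic shape operator: the Hessian matrix of `f` at `u`. -/
noncomputable def hessianMatrix (f : ℝ × ℝ → ℝ) (u : ℝ × ℝ) : Matrix (Fin 2) (Fin 2) ℝ :=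
  !![fderiv ℝ (fderiv ℝ f) u (1, 0) (1, 0), fderiv ℝ (fderiv ℝ f) u (1, 0) (0, 1);
     fderiv ℝ (fderiv ℝ f) u (0, 1) (1, 0), fderiv ℝ (fderiv ℝ f) u (0, 1) (0, 1)]

/-- The isotropic mean curvature of the graph of `f`. -/
noncomputable def isotropicMeanCurvature (f : ℝ × ℝ → ℝ) (u : ℝ × ℝ) : ℝ :=
  (hessianMatrix f u).trace / 2

/-- The isotropic Gaussian curvature of the graph of `f`. -/
noncomputable def isotropicGaussianCurvature (f : ℝ × ℝ → ℝ) (u : ℝ × ℝ) : ℝ :=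
  (hessianMatrix f u).det

/-- `κ₁`, `κ₂` are the isotropic principal curvatures of the graph of `f`: the eigenvalues,
counted with multiplicity, of the isotropic shape operator. -/
def ArePrincipalCurvatures (f : ℝ × ℝ → ℝ) (u : ℝ × ℝ) (κ₁ κ₂ : ℝ) : Prop :=
  (hessianMatrix f u).charpoly.roots = {κ₁, κ₂}

/-- `Z` is an analytic curve in the plane: a one-dimensional real analytic set
(singular points are allowed). -/
def IsAnalyticPlaneCurve (Z : Set (ℝ × ℝ)) : Prop :=
  ∀ w ∈ Z, (∃ᶠ v in 𝓝[≠] w, v ∈ Z) ∧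
    ∃ g : ℝ × ℝ → ℝ, AnalyticAt ℝ g w ∧ (∃ᶠ v in 𝓝 w, g v ≠ 0) ∧
      ∀ᶠ v in 𝓝 w, v ∈ Z ↔ g v = 0

/-- `M` is an (admissible) isotropic Weingarten surface: a fixed relation `F(H, K) = 0` holds
at each point, where the zero set of `F` is an analytic curve. -/
def IsIsotropicWeingarten (M : Set Space) : Prop :=
  ∃ F : ℝ × ℝ → ℝ, IsAnalyticPlaneCurve {w | F w = 0} ∧
    ∀ p ∈ M, ∃ f : ℝ × ℝ → ℝ, IsLocalGraph M p f ∧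
      F (isotropicMeanCurvature f (topView p), isotropicGaussianCurvature f (topView p)) = 0

/-- `M` is an (admissible) surface with the constant ratio `a` of isotropic principal
curvatures. -/
def HasConstantCurvatureRatio (M : Set Space) (a : ℝ) : Prop :=
  ∀ p ∈ M, ∃ f : ℝ × ℝ → ℝ, IsLocalGraph M p f ∧
    ∃ κ₁ κ₂ : ℝ, ArePrincipalCurvatures f (topView p) κ₁ κ₂ ∧
      ((κ₂ ≠ 0 ∧ κ₁ / κ₂ = a) ∨ (κ₁ ≠ 0 ∧ κ₂ / κ₁ = a))

/-! ### Isotropic channel and pipe surfaces -/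

/-- The set `2z = A(x² + y²) + Bx + Cy + D`. For `A ≠ 0` it is a parabolic isotropic sphere, and
its radius is `1/A`. -/
def parabolicSphere (A B C D : ℝ) : Set Space :=
  {p | 2 * p.2.2 = A * (p.1 ^ 2 + p.2.1 ^ 2) + B * p.1 + C * p.2.1 + D}

/-- `M` is an analytic surface which is the envelope of the analytic family
`S(t) : 2z = A(t)(x² + y²) + B(t)x + C(t)y + D(t)`, `t ∈ J`, of parabolic isotropic spheres,
where `J` is an interval: `M` touches each `S(t)` along a single curve without endpoints (the set
of all points where `M` and `S(t)` touch), and these curves cover `M`. -/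
def IsAnalyticEnvelope (M : Set Space) (J : Set ℝ) (A B C D : ℝ → ℝ) : Prop :=
  IsAnalyticSurface M ∧ J.OrdConnected ∧
  AnalyticOnNhd ℝ A J ∧ AnalyticOnNhd ℝ B J ∧ AnalyticOnNhd ℝ C J ∧ AnalyticOnNhd ℝ D J ∧
  (∀ t ∈ J, A t ≠ 0) ∧
  (∀ t ∈ J, IsCurveWithoutEndpoints
    {p | TouchesAt M (parabolicSphere (A t) (B t) (C t) (D t)) p}) ∧
  ∀ p ∈ M, ∃ t ∈ J, TouchesAt M (parabolicSphere (A t) (B t) (C t) (D t)) p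

/-- Analytic isotropic channel surfaces. -/
def IsAnalyticIsotropicChannel (M : Set Space) : Prop :=
  ∃ (J : Set ℝ) (A B C D : ℝ → ℝ), IsAnalyticEnvelope M J A B C D

/-- (Analytic) isotropic pipe surfaces: the radii `1/A(t)` are constant. -/
def IsAnalyticIsotropicPipe (M : Set Space) : Prop :=
  ∃ (J : Set ℝ) (A B C D : ℝ → ℝ), IsAnalyticEnvelope M J A B C D ∧
    ∃ r : ℝ, ∀ t ∈ J, 1 / A t = r

/-! ### Isotropic transformations and rotational surfaces -/

/-- General isotropic similarities. -/
def IsIsotropicSimilarity (T : Space → Space) : Prop :=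
  ∃ h₁ h₂ c₁ c₂ c₃ b₁ b₂ b₃ : ℝ, (h₁ ≠ 0 ∨ h₂ ≠ 0) ∧ c₃ ≠ 0 ∧ ∀ x y z : ℝ,
    T (x, y, z) =
      (h₁ * x - h₂ * y + b₁, h₂ * x + h₁ * y + b₂, c₁ * x + c₂ * y + c₃ * z + b₃)

/-- Isotropic congruences. -/
def IsIsotropicCongruence (T : Space → Space) : Prop :=
  ∃ φ c₁ c₂ b₁ b₂ b₃ : ℝ, ∀ x y z : ℝ,
    T (x, y, z) =
      (Real.cos φ * x - Real.sin φ * y + b₁, Real.sin φ * x + Real.cos φ * y + b₂,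
        c₁ * x + c₂ * y + z + b₃)

/-- The rotation about the `z`-axis through the angle `φ`. -/
noncomputable def zRotation (φ : ℝ) (p : Space) : Space :=
  (Real.cos φ * p.1 - Real.sin φ * p.2.1, Real.sin φ * p.1 + Real.cos φ * p.2.1, p.2.2)

/-- The parabolic rotation with the parameters `b`, `t`. -/
noncomputable def parabolicRotation (b t : ℝ) (p : Space) : Space :=
  (p.1 + t, p.2.1, t ^ 2 / 2 + (p.1 + b * p.2.1) * t + p.2.2)

/-- `M` is an (analytic) isotropic rotational surface: the image under an isotropic congruence of
a surface invariant under all rotations about the `z`-axis. -/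
def IsIsotropicRotational (M : Set Space) : Prop :=
  IsAnalyticSurface M ∧ ∃ (T : Space → Space) (N : Set Space), IsIsotropicCongruence T ∧
    (∀ φ : ℝ, zRotation φ '' N = N) ∧ M = T '' N

/-- `M` is an (analytic) parabolic rotational surface: the image under a general isotropic
similarity of a surface invariant under all parabolic rotations with a fixed parameter `b`. -/
def IsParabolicRotational (M : Set Space) : Prop :=
  IsAnalyticSurface M ∧ ∃ (T : Space → Space) (N : Set Space) (b : ℝ), IsIsotropicSimilarity T ∧
    (∀ t : ℝ, parabolicRotation b t '' N = N) ∧ M = T '' N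

/-!
The envelope `M` of the paraboloids `S(t)` is studied over open sets of the `xy`-plane on which it
is the graph of an analytic function `f`; such sets exist near the top view of every point of `M`
(`exists_isGraphPatch`), and each of their points lies below a point of contact with some `S(t)`.
The gradients of `f` and of the function describing `S(t)` agree along a whole curve, so that the
curvature `A(t)` of `S(t)` is a principal curvature of `M`: `A² - 2HA + K = 0`
(`IsGraphPatch.curvature_eq`).

*Non-constant `A`.* Over a suitable open set, the parameter of the touching paraboloid is a
differentiable function `τ`; this is where Baire's theorem enters
(`IsAnalyticEnvelope.exists_local_parameter`). The characteristic equation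
`A'(x² + y²) + B'x + C'y + D' = 0` holds at `t = τ(x, y)`, so the contact curves project to arcs of
circles with the centers `-(B', C') / (2A')`. The Weingarten relation makes `H` and `K`
functionally dependent. As `A ∘ τ` is one principal curvature, the other one is constant along
these circles as well, and this is possible only if the center does not depend on `t`. So `B` and
`C` are affine functions of `A` (`IsAnalyticEnvelope.exists_center`). Then the difference of `f`
and any member of the family is rotationally symmetric about the common center, up to the domain of
definition, and a contact curve has to stay at a constant distance from the axis, as otherwise the
contact would spread over an open set. Being closed and without endpoints, the curve is a full
circle in the top view. Hence `M`, the union of these curves, is invariant under rotations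
(`IsAnalyticEnvelope.isIsotropicRotational`). A constant ratio of the principal curvatures is a
Weingarten relation, so this covers both parts of the theorem.

*Constant `A = α`.* Now `M` is a pipe surface by definition. If moreover the ratio of the principal
curvatures is constant, then both of them are constant, one of them being `α`, and the Hessian of
`f` is constant (`exists_eq_translationHeight`). So `M` lies locally on a quadric
`2z = α(x² + y²) + δ(w₁x + w₂y)² + …`, where `δ ≠ 0`, because otherwise a member of the family would
touch `M` along an open set. Three members of the family determine this quadric
(`translationHeight_eq_of_three`), so it is the same near all points of `M`. The quadric is the image
of `z = x²/2 + αy²/(2(α + δ))` under an isotropic similarity, and the latter surface is invariant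
under parabolic rotations (`isParabolicRotational_graph_translationHeight`).
-/

/-! ### Curves given by two equations -/

theorem exists_apply_eq_of_linearIndependent_pair {E : Type*} [AddCommGroup E] [Module ℝ E]
    [TopologicalSpace E] {α β : E →L[ℝ] ℝ} (h : LinearIndependent ℝ ![α, β]) (x y : ℝ) :
    ∃ v, α v = x ∧ β v = y := by
  rw [LinearIndependent.pair_iff] at h
  have key : ∀ α β : E →L[ℝ] ℝ, (∀ s t : ℝ, s • α + t • β = 0 → s = 0 ∧ t = 0) →
      ∃ w, α w = 0 ∧ β w = 1 := by
    intro α β h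
    obtain ⟨v, hv⟩ : ∃ v, α v ≠ 0 := by
      by_contra! hc
      have := h 1 0 (by ext z; simp [hc z])
      simp at this
    obtain ⟨w, hw, hw'⟩ : ∃ w, α w = 0 ∧ β w ≠ 0 := by
      by_contra! hc
      have := h (β v) (-(α v)) (by
        ext z
        have := hc (α v • z - α z • v) (by simp [mul_comm])
        simp at this ⊢
        linarith)
      exact hv (by simpa using this.2)
    exact ⟨(β w)⁻¹ • w, by simp [hw], by simp [hw']⟩
  obtain ⟨w, hw, hw'⟩ := key α β h
  obtain ⟨v, hv, hv'⟩ := key β α (fun s t hst => (h t s (by rw [add_comm]; exact hst)).symm)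
  exact ⟨x • v + y • w, by simp [hv', hw], by simp [hv, hw']⟩

theorem exists_equiv_of_linearIndependent_pair {α β : Space →L[ℝ] ℝ}
    (h : LinearIndependent ℝ ![α, β]) :
    ∃ e : Space ≃L[ℝ] Space, ∀ q, (e q).1 = α q ∧ (e q).2.1 = β q := by
  obtain ⟨v, hv, hv'⟩ := exists_apply_eq_of_linearIndependent_pair h 1 0
  obtain ⟨w, hw, hw'⟩ := exists_apply_eq_of_linearIndependent_pair h 0 1
  obtain ⟨k, hk, hk0⟩ : ∃ k : Space, (α k = 0 ∧ β k = 0) ∧ k ≠ 0 := by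
    have := LinearMap.ker_ne_bot_of_finrank_lt (f := (α.prod β).toLinearMap) (by simp)
    obtain ⟨k, hk, hk0⟩ := Submodule.exists_mem_ne_zero_of_ne_bot this
    exact ⟨k, by simpa using hk, hk0⟩
  let T : Space →ₗ[ℝ] Space :=
    { toFun := fun q => q.1 • v + q.2.1 • w + q.2.2 • k
      map_add' := by intros; simp only [Prod.fst_add, Prod.snd_add]; module
      map_smul' := by intros; simp only [Prod.smul_fst, Prod.smul_snd, RingHom.id_apply]; module }
  have hTα : ∀ q, α (T q) = q.1 := fun q => by simp [T, hv, hw, hk.1]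
  have hTβ : ∀ q, β (T q) = q.2.1 := fun q => by simp [T, hv', hw', hk.2]
  have hT : Function.Injective T := by
    rw [← LinearMap.ker_eq_bot, LinearMap.ker_eq_bot']
    intro q hq
    have h1 := hTα q
    have h2 := hTβ q
    rw [hq, map_zero] at h1 h2
    have h3 : q.2.2 • k = 0 := by
      have : T q = q.1 • v + q.2.1 • w + q.2.2 • k := rfl
      rw [hq, ← h1, ← h2] at this
      simpa using this.symm
    have h4 := (smul_eq_zero.mp h3).resolve_right hk0
    exact Prod.ext h1.symm (Prod.ext h2.symm h4)
  let e := (LinearEquiv.ofInjectiveEndo T hT).toContinuousLinearEquiv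
  have he : ∀ q, T (e.symm q) = q := fun q => (LinearEquiv.ofInjectiveEndo T hT).apply_symm_apply q
  refine ⟨e.symm, fun q => ⟨?_, ?_⟩⟩
  · rw [← hTα, he]
  · rw [← hTβ, he]

/-- Local parametrization of a curve given by two independent equations: the two equations are
completed by a linear coordinate to a local diffeomorphism. -/
theorem IsCurveWithoutEndpoints.exists_param {c : Set Space} (hc : IsCurveWithoutEndpoints c)
    {p : Space} (hp : p ∈ c) {N : Set Space} (hN : N ∈ 𝓝 p) :
    ∃ (γ : ℝ → Space) (ε : ℝ), 0 < ε ∧ ContinuousOn γ (Set.Ioo (-ε) ε) ∧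
      Set.InjOn γ (Set.Ioo (-ε) ε) ∧ γ 0 = p ∧ (∀ s ∈ Set.Ioo (-ε) ε, γ s ∈ c ∩ N) ∧
      γ '' Set.Ioo (-ε) ε ∈ 𝓝[c] p := by
  obtain ⟨G, h, hG, hh, hli, hmem⟩ := hc.2.2 p hp
  obtain ⟨e, he⟩ := exists_equiv_of_linearIndependent_pair hli
  let ℓ : Space →L[ℝ] ℝ := (ContinuousLinearMap.snd ℝ ℝ ℝ).comp
    ((ContinuousLinearMap.snd ℝ ℝ (ℝ × ℝ)).comp (e : Space →L[ℝ] Space))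
  have hF : HasStrictFDerivAt (fun q => (G q, h q, ℓ q)) (e : Space →L[ℝ] Space) p := by
    have h1 := (hG.hasStrictFDerivAt one_ne_zero).prodMk
      ((hh.hasStrictFDerivAt one_ne_zero).prodMk ℓ.hasStrictFDerivAt)
    convert! h1 using 1
    ext <;> simp [he, ℓ]
  set Φ := hF.toOpenPartialHomeomorph _ with hΦ
  have hΦc : ∀ q, Φ q = (G q, h q, ℓ q) := fun q => rfl
  have hps : p ∈ Φ.source := hF.mem_toOpenPartialHomeomorph_source
  have hp0 : G p = 0 ∧ h p = 0 := (hmem.self_of_nhds).1 hp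
  have hΦp : Φ p = (0, 0, ℓ p) := by rw [hΦc, hp0.1, hp0.2]
  have hN' : {q | (q ∈ c ↔ G q = 0 ∧ h q = 0)} ∩ N ∈ 𝓝 p := inter_mem hmem hN
  have hpt : Φ p ∈ Φ.target := Φ.map_source hps
  have hpre : Φ.target ∩ Φ.symm ⁻¹' ({q | (q ∈ c ↔ G q = 0 ∧ h q = 0)} ∩ N) ∈ 𝓝 (Φ p) :=
    inter_mem (Φ.open_target.mem_nhds hpt)
      ((Φ.continuousAt_symm hpt).preimage_mem_nhds (by rwa [Φ.left_inv hps]))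
  have hcont : Continuous fun s : ℝ => ((0, 0, ℓ p + s) : Space) := by fun_prop
  have h0 := hcont.continuousAt.preimage_mem_nhds
    (show _ ∈ 𝓝 ((0, 0, ℓ p + 0) : Space) by rw [add_zero, ← hΦp]; exact hpre)
  obtain ⟨ε, hε, hball⟩ := Metric.mem_nhds_iff.1 h0
  rw [Real.ball_eq_Ioo, zero_sub, zero_add] at hball
  refine ⟨fun s => Φ.symm (0, 0, ℓ p + s), ε, hε, ?_, ?_, ?_, ?_, ?_⟩
  · exact Φ.continuousOn_symm.comp hcont.continuousOn fun s hs => (hball hs).1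
  · intro s hs s' hs' hss
    have := Φ.symm.injOn (hball hs).1 (hball hs').1 hss
    simpa using this
  · change Φ.symm _ = p
    rw [add_zero, ← hΦp, Φ.left_inv hps]
  · intro s hs
    have h1 := hball hs
    have h2 := Φ.right_inv h1.1
    rw [hΦc, Prod.mk.injEq, Prod.mk.injEq] at h2
    exact ⟨h1.2.1.2 ⟨h2.1, h2.2.1⟩, h1.2.2⟩
  · have hℓ : ∀ᶠ q in 𝓝 p, ℓ q - ℓ p ∈ Set.Ioo (-ε) ε := by
      have : Continuous fun q => ℓ q - ℓ p := by fun_prop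
      exact this.continuousAt.preimage_mem_nhds (Ioo_mem_nhds (by simpa) (by simpa))
    filter_upwards [self_mem_nhdsWithin, mem_nhdsWithin_of_mem_nhds hmem,
      mem_nhdsWithin_of_mem_nhds hℓ, mem_nhdsWithin_of_mem_nhds (Φ.open_source.mem_nhds hps)]
      with q hq hq1 hq2 hq3
    refine ⟨_, hq2, ?_⟩
    have h2 := hq1.1 hq
    change Φ.symm _ = q
    have h3 := Φ.left_inv hq3
    rw [hΦc, h2.1, h2.2] at h3
    rw [add_sub_cancel, h3]

theorem IsCurveWithoutEndpoints.frequently_mem {c : Set Space} (hc : IsCurveWithoutEndpoints c)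
    {p : Space} (hp : p ∈ c) : ∃ᶠ q in 𝓝[≠] p, q ∈ c := by
  obtain ⟨γ, ε, hε, hcont, hinj, h0, hmem, -⟩ := hc.exists_param hp univ_mem
  have h00 : (0 : ℝ) ∈ Set.Ioo (-ε) ε := by simpa
  have hca : ContinuousAt γ 0 := hcont.continuousAt (Ioo_mem_nhds h00.1 h00.2)
  have htend : Tendsto γ (𝓝[≠] 0) (𝓝[≠] p) := by
    refine tendsto_nhdsWithin_iff.2 ⟨?_, ?_⟩
    · rw [← h0]; exact hca.tendsto.mono_left nhdsWithin_le_nhds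
    · filter_upwards [self_mem_nhdsWithin,
        mem_nhdsWithin_of_mem_nhds (Ioo_mem_nhds h00.1 h00.2)] with s hs hs' h
      rw [Set.mem_singleton_iff, ← h0] at h
      exact hs (hinj hs' h00 h)
  refine htend.frequently (Eventually.frequently ?_)
  filter_upwards [mem_nhdsWithin_of_mem_nhds (Ioo_mem_nhds h00.1 h00.2)] with s hs
  exact (hmem s hs).1

/-- A curve contains no graph over an open set, since the differentials of both of its equations
would vanish on the tangent plane of that graph. -/
theorem IsCurveWithoutEndpoints.not_graph_subset {c : Set Space} (hc : IsCurveWithoutEndpoints c)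
    {f : ℝ × ℝ → ℝ} {W : Set (ℝ × ℝ)} (hW : IsOpen W) {u : ℝ × ℝ} (hu : u ∈ W)
    (hf : DifferentiableAt ℝ f u) (hsub : ∀ v ∈ W, (v.1, v.2, f v) ∈ c) : False := by
  obtain ⟨G, h, hG, hh, hli, hmem⟩ := hc.2.2 _ (hsub u hu)
  have hg : HasFDerivAt (fun v : ℝ × ℝ => ((v.1, v.2, f v) : Space))
      ((ContinuousLinearMap.fst ℝ ℝ ℝ).prod ((ContinuousLinearMap.snd ℝ ℝ ℝ).prod (fderiv ℝ f u)))
      u := hasFDerivAt_fst.prodMk (hasFDerivAt_snd.prodMk hf.hasFDerivAt)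
  have hev : ∀ᶠ v in 𝓝 u, G (v.1, v.2, f v) = 0 ∧ h (v.1, v.2, f v) = 0 := by
    filter_upwards [hg.continuousAt.eventually hmem, hW.mem_nhds hu] with v hv hvW
    exact hv.1 (hsub v hvW)
  have key : ∀ F : Space → ℝ, ContDiffAt ℝ 1 F (u.1, u.2, f u) →
      (∀ᶠ v in 𝓝 u, F (v.1, v.2, f v) = 0) → ∀ e : ℝ × ℝ,
      fderiv ℝ F (u.1, u.2, f u) (e.1, e.2, fderiv ℝ f u e) = 0 := by
    intro F hF hF0 e
    have h1 := (hF.differentiableAt one_ne_zero).hasFDerivAt.comp u hg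
    have h2 := h1.unique ((hasFDerivAt_const (0 : ℝ) u).congr_of_eventuallyEq hF0)
    simpa using DFunLike.congr_fun h2 e
  have hG0 := key G hG (hev.mono fun _ h => h.1)
  have hh0 := key h hh (hev.mono fun _ h => h.2)
  set α := fderiv ℝ G (u.1, u.2, f u)
  set β := fderiv ℝ h (u.1, u.2, f u)
  have hdec : ∀ q : Space, q = (q.1, q.2.1, fderiv ℝ f u (q.1, q.2.1)) +
      (q.2.2 - fderiv ℝ f u (q.1, q.2.1)) • ((0, 0, 1) : Space) := fun q => by
    ext <;> simp
  obtain ⟨v, hv, hv'⟩ := exists_apply_eq_of_linearIndependent_pair hli 1 0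
  obtain ⟨w, hw, hw'⟩ := exists_apply_eq_of_linearIndependent_pair hli 0 1
  rw [hdec v, map_add, map_smul, hG0 (v.1, v.2.1)] at hv
  rw [hdec v, map_add, map_smul, hh0 (v.1, v.2.1)] at hv'
  rw [hdec w, map_add, map_smul, hh0 (w.1, w.2.1)] at hw'
  simp only [zero_add, smul_eq_mul, mul_eq_zero] at hv hv' hw'
  rcases hv' with h | h
  · simp [h] at hv
  · simp [h] at hw'

/-! ### Graph patches and contact with paraboloids -/

/-- The function whose graph is `parabolicSphere A B C D`. -/
noncomputable def sphereHeight (A B C D : ℝ) (u : ℝ × ℝ) : ℝ :=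
  (A * (u.1 ^ 2 + u.2 ^ 2) + B * u.1 + C * u.2 + D) / 2

theorem mem_parabolicSphere_iff {A B C D : ℝ} {p : Space} :
    p ∈ parabolicSphere A B C D ↔ p.2.2 = sphereHeight A B C D (topView p) := by
  simp only [parabolicSphere, sphereHeight, topView, Set.mem_ofPred_eq]
  constructor <;> intro h <;> linarith

theorem hasFDerivAt_sphereHeight (A B C D : ℝ) (u : ℝ × ℝ) :
    HasFDerivAt (sphereHeight A B C D)
      ((A * u.1 + B / 2) • ContinuousLinearMap.fst ℝ ℝ ℝ +
        (A * u.2 + C / 2) • ContinuousLinearMap.snd ℝ ℝ ℝ) u := by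
  have h1 : HasFDerivAt (fun v : ℝ × ℝ => v.1) (ContinuousLinearMap.fst ℝ ℝ ℝ) u := hasFDerivAt_fst
  have h2 : HasFDerivAt (fun v : ℝ × ℝ => v.2) (ContinuousLinearMap.snd ℝ ℝ ℝ) u := hasFDerivAt_snd
  convert! ((((((h1.pow 2).add (h2.pow 2)).const_mul A).add (h1.const_mul B)).add
    (h2.const_mul C)).add_const D).mul_const (2⁻¹ : ℝ) using 1
  · ext <;> simp <;> ring

theorem analyticOnNhd_sphereHeight (A B C D : ℝ) (s : Set (ℝ × ℝ)) :
    AnalyticOnNhd ℝ (sphereHeight A B C D) s := by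
  intro u _
  have h1 : AnalyticAt ℝ (fun v : ℝ × ℝ => v.1) u := analyticAt_fst
  have h2 : AnalyticAt ℝ (fun v : ℝ × ℝ => v.2) u := analyticAt_snd
  unfold sphereHeight
  fun_prop

/-- Over the open set `U`, the surface `M` coincides locally with the graph of the analytic
function `f`. -/
structure IsGraphPatch (M : Set Space) (f : ℝ × ℝ → ℝ) (U : Set (ℝ × ℝ)) : Prop where
  isOpen : IsOpen U
  analytic : AnalyticOnNhd ℝ f U
  mem_iff : ∀ u ∈ U, ∀ᶠ q in 𝓝 ((u.1, u.2, f u) : Space), q ∈ M ↔ q.2.2 = f (topView q)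

theorem IsGraphPatch.mono {M : Set Space} {f : ℝ × ℝ → ℝ} {U V : Set (ℝ × ℝ)}
    (h : IsGraphPatch M f U) (hV : IsOpen V) (hVU : V ⊆ U) : IsGraphPatch M f V :=
  ⟨hV, h.analytic.mono hVU, fun u hu => h.mem_iff u (hVU hu)⟩

theorem IsGraphPatch.mem {M : Set Space} {f : ℝ × ℝ → ℝ} {U : Set (ℝ × ℝ)}
    (h : IsGraphPatch M f U) {u : ℝ × ℝ} (hu : u ∈ U) : ((u.1, u.2, f u) : Space) ∈ M :=
  (h.mem_iff u hu).self_of_nhds.2 rfl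

theorem tangentPlane_of_eventually_graph {M : Set Space} {f : ℝ × ℝ → ℝ} {u : ℝ × ℝ}
    (hf : DifferentiableAt ℝ f u)
    (hM : ∀ᶠ q in 𝓝 ((u.1, u.2, f u) : Space), q ∈ M ↔ q.2.2 = f (topView q)) (q : Space) :
    q ∈ tangentPlane M (u.1, u.2, f u) ↔ q.2.2 = fderiv ℝ f u (topView q) := by
  set p : Space := (u.1, u.2, f u) with hp
  have hg : HasFDerivAt (fun v : ℝ × ℝ => ((v.1, v.2, f v) : Space))
      ((ContinuousLinearMap.fst ℝ ℝ ℝ).prod ((ContinuousLinearMap.snd ℝ ℝ ℝ).prod (fderiv ℝ f u)))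
      u := hasFDerivAt_fst.prodMk (hasFDerivAt_snd.prodMk hf.hasFDerivAt)
  constructor
  · intro hq
    let tv : Space →L[ℝ] ℝ × ℝ := (ContinuousLinearMap.fst ℝ ℝ (ℝ × ℝ)).prod
      ((ContinuousLinearMap.fst ℝ ℝ ℝ).comp (ContinuousLinearMap.snd ℝ ℝ (ℝ × ℝ)))
    let zc : Space →L[ℝ] ℝ := (ContinuousLinearMap.snd ℝ ℝ ℝ).comp
      (ContinuousLinearMap.snd ℝ ℝ (ℝ × ℝ))
    have hF : HasFDerivAt (fun q : Space => q.2.2 - f (topView q))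
        (zc - (fderiv ℝ f u).comp tv) p := by
      have h1 : HasFDerivAt f (fderiv ℝ f u) (tv p) := hf.hasFDerivAt
      exact zc.hasFDerivAt.sub (h1.comp p tv.hasFDerivAt)
    have hF0 : HasFDerivWithinAt (fun q : Space => q.2.2 - f (topView q)) (0 : Space →L[ℝ] ℝ) M p := by
      refine (hasFDerivWithinAt_const (0 : ℝ) p M).congr_of_eventuallyEq ?_ ?_
      · filter_upwards [self_mem_nhdsWithin, mem_nhdsWithin_of_mem_nhds hM] with q hq hq'
        rw [hq'.1 hq, sub_self]
      · simp [hp, topView]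
    have hle : tangentPlane M p ≤ LinearMap.ker (zc - (fderiv ℝ f u).comp tv).toLinearMap := by
      refine Submodule.span_le.2 fun y hy => ?_
      have := HasFDerivWithinAt.unique_on hF.hasFDerivWithinAt hF0 hy
      simpa using this
    have := hle hq
    simp only [LinearMap.mem_ker, ContinuousLinearMap.coe_coe, sub_apply,
      sub_eq_zero] at this
    exact this
  · intro hq
    have h1 := (hg.hasFDerivWithinAt (s := Set.univ)).mapsTo_tangent_cone
      (show topView q ∈ _ by rw [tangentConeAt_univ]; trivial)
    have h2 : tangentConeAt ℝ ((fun v : ℝ × ℝ => ((v.1, v.2, f v) : Space)) '' Set.univ) p ⊆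
        tangentConeAt ℝ M p := by
      refine tangentConeAt_mono_nhds (nhdsWithin_le_iff.2 ?_)
      filter_upwards [self_mem_nhdsWithin, mem_nhdsWithin_of_mem_nhds hM] with r hr hr'
      obtain ⟨v, -, rfl⟩ := hr
      exact hr'.2 rfl
    have h3 := h2 h1
    refine Submodule.subset_span ?_
    convert h3 using 1
    ext <;> simp [topView, hq]

theorem clm_ext_basis {L L' : ℝ × ℝ →L[ℝ] ℝ} (h1 : L (1, 0) = L' (1, 0))
    (h2 : L (0, 1) = L' (0, 1)) : L = L' := by
  ext <;> simpa

/-- The graph of `f` has first-order contact over `u` with the paraboloid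
`2z = A(x² + y²) + Bx + Cy + D`. -/
def IsContact (f : ℝ × ℝ → ℝ) (A B C D : ℝ) (u : ℝ × ℝ) : Prop :=
  f u = sphereHeight A B C D u ∧ fderiv ℝ f u (1, 0) = A * u.1 + B / 2 ∧
    fderiv ℝ f u (0, 1) = A * u.2 + C / 2

theorem IsGraphPatch.touchesAt_iff {M : Set Space} {f : ℝ × ℝ → ℝ} {U : Set (ℝ × ℝ)}
    (h : IsGraphPatch M f U) {u : ℝ × ℝ} (hu : u ∈ U) {A B C D : ℝ} :
    TouchesAt M (parabolicSphere A B C D) (u.1, u.2, f u) ↔ IsContact f A B C D u := by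
  have hf := (h.analytic u hu).differentiableAt
  have hM := tangentPlane_of_eventually_graph hf (h.mem_iff u hu)
  have hφ := hasFDerivAt_sphereHeight A B C D u
  have hS := tangentPlane_of_eventually_graph (M := parabolicSphere A B C D)
    hφ.differentiableAt (Eventually.of_forall fun q => mem_parabolicSphere_iff)
  rw [hφ.fderiv] at hS
  unfold TouchesAt IsContact
  rw [mem_parabolicSphere_iff, and_iff_right (h.mem hu)]
  refine and_congr_right fun hz => ?_
  replace hz : f u = sphereHeight A B C D u := hz
  rw [← hz] at hS
  constructor
  · intro heq
    have key : ∀ e : ℝ × ℝ, fderiv ℝ f u e = ((A * u.1 + B / 2) • ContinuousLinearMap.fst ℝ ℝ ℝ +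
        (A * u.2 + C / 2) • ContinuousLinearMap.snd ℝ ℝ ℝ) e := fun e => by
      have := (hM (e.1, e.2, fderiv ℝ f u e)).2 rfl
      rw [heq] at this
      exact (hS _).1 this
    constructor <;> simp [key]
  · rintro ⟨h1, h2⟩
    have key : fderiv ℝ f u = (A * u.1 + B / 2) • ContinuousLinearMap.fst ℝ ℝ ℝ +
        (A * u.2 + C / 2) • ContinuousLinearMap.snd ℝ ℝ ℝ :=
      clm_ext_basis (by simp [h1]) (by simp [h2])
    ext q
    rw [hM, hS, key]

theorem exists_mem_open_of_fderiv_linearIndependent {G h : Space → ℝ} {p : Space}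
    (hG : AnalyticAt ℝ G p) (hh : AnalyticAt ℝ h p)
    (hli : LinearIndependent ℝ ![fderiv ℝ G p, fderiv ℝ h p]) {N : Set Space} (hN : N ∈ 𝓝 p)
    (hG0 : G p = 0) (hh0 : h p = 0) : ∃ q ∈ N, G q = 0 ∧ 0 < h q := by
  have hF := hG.hasStrictFDerivAt.prodMk hh.hasStrictFDerivAt
  have hmap := hF.map_nhds_eq_of_surj (by
    rw [LinearMap.range_eq_top]
    rintro ⟨x, y⟩
    obtain ⟨v, hv, hv'⟩ := exists_apply_eq_of_linearIndependent_pair hli x y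
    exact ⟨v, by simp [hv, hv']⟩)
  have h1 : (fun q => (G q, h q)) '' N ∈ 𝓝 ((0, 0) : ℝ × ℝ) := by
    rw [show ((0, 0) : ℝ × ℝ) = (G p, h p) by rw [hG0, hh0], ← hmap]
    exact image_mem_map hN
  have hc : Tendsto (fun ε : ℝ => ((0, ε) : ℝ × ℝ)) (𝓝[>] 0) (𝓝 (0, 0)) := by
    have : Continuous fun ε : ℝ => ((0, ε) : ℝ × ℝ) := by fun_prop
    exact this.continuousAt.tendsto.mono_left nhdsWithin_le_nhds
  obtain ⟨ε, ⟨q, hq, hqe⟩, hε⟩ := ((hc.eventually h1).and self_mem_nhdsWithin).exists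
  rw [Prod.mk.injEq] at hqe
  exact ⟨q, hq, hqe.1, by rw [hqe.2]; exact hε⟩

/-- A regular surface `G = 0` contained in the graph of `f` near `p` fills that graph near `p`.
The differentials of `G` and `z - f(x, y)` are proportional, as otherwise `(G, z - f(x, y))` would
be an open map; hence `G` and `(x, y)` form a local coordinate system. -/
theorem eventually_mem_of_subset_graph {M : Set Space} {f : ℝ × ℝ → ℝ} {G : Space → ℝ} {p : Space}
    (hG : AnalyticAt ℝ G p) (hG' : fderiv ℝ G p ≠ 0) (hM : ∀ᶠ q in 𝓝 p, q ∈ M ↔ G q = 0)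
    (hp : p ∈ M) (hf : IsLocalGraph M p f) :
    ∀ᶠ q in 𝓝 p, q ∈ M ↔ q.2.2 = f (topView q) := by
  let tv : Space →L[ℝ] ℝ × ℝ := (ContinuousLinearMap.fst ℝ ℝ (ℝ × ℝ)).prod
    ((ContinuousLinearMap.fst ℝ ℝ ℝ).comp (ContinuousLinearMap.snd ℝ ℝ (ℝ × ℝ)))
  let zc : Space →L[ℝ] ℝ := (ContinuousLinearMap.snd ℝ ℝ ℝ).comp
    (ContinuousLinearMap.snd ℝ ℝ (ℝ × ℝ))
  have hfM := eventually_nhdsWithin_iff.1 hf.2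
  have hza : AnalyticAt ℝ (fun q : Space => q.2.2 - f (topView q)) p :=
    (zc.analyticAt p).sub (AnalyticAt.comp (g := f) (f := tv) hf.1 (tv.analyticAt p))
  have hz' : fderiv ℝ (fun q : Space => q.2.2 - f (topView q)) p =
      zc - (fderiv ℝ f (topView p)).comp tv := by
    have h1 : HasFDerivAt f (fderiv ℝ f (topView p)) (tv p) := hf.1.differentiableAt.hasFDerivAt
    exact (zc.hasFDerivAt.sub (h1.comp p tv.hasFDerivAt)).fderiv
  have hG0 : G p = 0 := hM.self_of_nhds.1 hp
  have hz0 : p.2.2 - f (topView p) = 0 := sub_eq_zero.2 (hfM.self_of_nhds hp)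
  have hdep : fderiv ℝ G p (0, 0, 1) ≠ 0 := by
    intro h0
    by_cases hli : LinearIndependent ℝ
        ![fderiv ℝ G p, fderiv ℝ (fun q : Space => q.2.2 - f (topView q)) p]
    · obtain ⟨q, ⟨hq1, hq2⟩, hq, hq'⟩ := exists_mem_open_of_fderiv_linearIndependent hG hza hli
        (inter_mem hM hfM) hG0 hz0
      have := hq2 (hq1.2 hq)
      linarith
    · rw [hz', LinearIndependent.pair_iff] at hli
      push Not at hli
      obtain ⟨s, t, hst, hne⟩ := hli
      have h1 := DFunLike.congr_fun hst (0, 0, 1)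
      have h2 : t = 0 := by
        have e1 : tv (0, 0, 1) = 0 := rfl
        have e2 : zc (0, 0, 1) = 1 := rfl
        simpa [h0, e1, e2] using h1
      have h3 : s ≠ 0 := fun hs => hne hs h2
      rw [h2, zero_smul, add_zero, smul_eq_zero] at hst
      exact hG' (hst.resolve_left h3)
  have hF := hG.hasStrictFDerivAt.prodMk tv.hasStrictFDerivAt (x := p)
  have hmap := hF.map_nhds_eq_of_surj (by
    rw [LinearMap.range_eq_top]
    rintro ⟨x, y⟩
    set k := (x - fderiv ℝ G p (y.1, y.2, 0)) / fderiv ℝ G p (0, 0, 1) with hk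
    have e1 : tv ((y.1, y.2, 0) + k • ((0, 0, 1) : Space)) = y := by
      rw [map_add, map_smul, show tv (0, 0, 1) = 0 from rfl, smul_zero, add_zero]; rfl
    have e2 : fderiv ℝ G p ((y.1, y.2, 0) + k • ((0, 0, 1) : Space)) = x := by
      rw [map_add, map_smul, smul_eq_mul, hk, div_mul_cancel₀ _ hdep, add_sub_cancel]
    exact ⟨_, Prod.ext e2 e1⟩)
  have h1 : (fun q => (G q, tv q)) '' ({q | q ∈ M ↔ G q = 0} ∩
      {q | q ∈ M → q.2.2 = f (topView q)}) ∈ 𝓝 ((0, tv p) : ℝ × ℝ × ℝ) := by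
    have := image_mem_map (m := fun q => (G q, tv q)) (inter_mem hM hfM)
    rwa [hmap, hG0] at this
  have hc : Continuous fun q : Space => ((0, tv q) : ℝ × ℝ × ℝ) := by fun_prop
  filter_upwards [hfM, hc.continuousAt.eventually h1] with q hq hq'
  refine ⟨hq, fun hqz => ?_⟩
  obtain ⟨r, ⟨hr1, hr2⟩, hr⟩ := hq'
  rw [Prod.mk.injEq] at hr
  have hrM := hr1.2 hr.1
  have hrz := hr2 hrM
  have htv : topView r = topView q := hr.2
  rw [htv, ← hqz] at hrz
  have : r = q := by
    have e := Prod.ext_iff.1 htv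
    exact Prod.ext e.1 (Prod.ext e.2 hrz)
  rwa [← this]

theorem exists_isGraphPatch {M : Set Space} (hM : IsAnalyticSurface M) {p : Space} (hp : p ∈ M)
    {f : ℝ × ℝ → ℝ} (hf : IsLocalGraph M p f) {N : Set (ℝ × ℝ)} (hN : N ∈ 𝓝 (topView p)) :
    ∃ U ⊆ N, U.Nonempty ∧ IsGraphPatch M f U := by
  have htv : Continuous topView := by unfold topView; fun_prop
  -- a point near `p` at which `M` is a surface without boundary
  obtain ⟨q, G, hqM, hqN, hqf, hGa, hG', hGM⟩ : ∃ (q : Space) (G : Space → ℝ), q ∈ M ∧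
      N ∈ 𝓝 (topView q) ∧ IsLocalGraph M q f ∧ AnalyticAt ℝ G q ∧ fderiv ℝ G q ≠ 0 ∧
      ∀ᶠ r in 𝓝 q, r ∈ M ↔ G r = 0 := by
    obtain ⟨G, hG, hG', hint | ⟨h, hh, hh0, hli, hbd⟩⟩ := hM p hp
    · exact ⟨p, G, hp, hN, hf, hG, hG', hint⟩
    · have e1 : ∀ᶠ q in 𝓝 p, N ∈ 𝓝 (topView q) :=
        htv.continuousAt.eventually (eventually_mem_nhds_iff.2 hN)
      have e2 : ∀ᶠ q in 𝓝 p, AnalyticAt ℝ f (topView q) :=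
        htv.continuousAt.eventually hf.1.eventually_analyticAt
      have e3 : ∀ᶠ q in 𝓝 p, ∀ᶠ r in 𝓝 q, r ∈ M → r.2.2 = f (topView r) :=
        eventually_eventually_nhds.2 (eventually_nhdsWithin_iff.1 hf.2)
      have e4 := hG.eventually_analyticAt
      have e5 := hh.eventually_analyticAt
      have e6 : ∀ᶠ q in 𝓝 p, fderiv ℝ G q ≠ 0 :=
        hG.fderiv.continuousAt.eventually_ne hG'
      have e7 := eventually_eventually_nhds.2 hbd
      have hG0 : G p = 0 := (hbd.self_of_nhds.1 hp).1
      obtain ⟨q, ⟨h1, h2, h3, h4, h5, h6, h7⟩, hq, hq'⟩ :=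
        exists_mem_open_of_fderiv_linearIndependent hG hh hli
        (e1.and (e2.and (e3.and (e4.and (e5.and (e6.and e7)))))) hG0 hh0
      refine ⟨q, G, h7.self_of_nhds.2 ⟨hq, hq'.le⟩, h1, ⟨h2, eventually_nhdsWithin_iff.2 h3⟩,
        h4, h6, ?_⟩
      filter_upwards [h7, h5.continuousAt.eventually (lt_mem_nhds hq')] with r hr hr'
      rw [hr]
      exact and_iff_left hr'.le
  have hgr := eventually_mem_of_subset_graph hGa hG' hGM hqM hqf
  have hqz : q = ((topView q).1, (topView q).2, f (topView q)) :=
    Prod.ext rfl (Prod.ext rfl (hgr.self_of_nhds.1 hqM))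
  have hcont : ContinuousAt (fun v : ℝ × ℝ => ((v.1, v.2, f v) : Space)) (topView q) := by
    have := hqf.1.continuousAt
    fun_prop
  have hgr' := eventually_eventually_nhds.2 hgr
  rw [hqz] at hgr'
  have hall := (hcont.eventually hgr').and (hqf.1.eventually_analyticAt.and hqN)
  obtain ⟨U, hU, hUo, hqU⟩ := eventually_nhds_iff.1 hall
  exact ⟨U, fun u hu => (hU u hu).2.2, ⟨_, hqU⟩, hUo, fun u hu => (hU u hu).2.1,
    fun u hu => (hU u hu).1⟩

/-! ### Curvatures along the curves of contact -/

theorem hasFDerivAt_fderiv_apply {f : ℝ × ℝ → ℝ} {u : ℝ × ℝ} (hf : AnalyticAt ℝ f u) (e : ℝ × ℝ) :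
    HasFDerivAt (fun v => fderiv ℝ f v e)
      ((ContinuousLinearMap.apply ℝ ℝ e).comp (fderiv ℝ (fderiv ℝ f) u)) u :=
  ((ContinuousLinearMap.apply ℝ ℝ e).hasFDerivAt (x := fderiv ℝ f u)).comp u
    hf.fderiv.differentiableAt.hasFDerivAt

theorem hessian_symm {f : ℝ × ℝ → ℝ} {u : ℝ × ℝ} (hf : AnalyticAt ℝ f u) :
    fderiv ℝ (fderiv ℝ f) u (0, 1) (1, 0) = fderiv ℝ (fderiv ℝ f) u (1, 0) (0, 1) :=
  (hf.contDiffAt (n := 2)).isSymmSndFDerivAt (by simp) _ _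

theorem two_mul_meanCurvature (f : ℝ × ℝ → ℝ) (u : ℝ × ℝ) :
    2 * isotropicMeanCurvature f u = fderiv ℝ (fderiv ℝ f) u (1, 0) (1, 0) +
      fderiv ℝ (fderiv ℝ f) u (0, 1) (0, 1) := by
  simp [isotropicMeanCurvature, hessianMatrix, Matrix.trace_fin_two]
  ring

theorem gaussianCurvature_eq {f : ℝ × ℝ → ℝ} {u : ℝ × ℝ} (hf : AnalyticAt ℝ f u) :
    isotropicGaussianCurvature f u = fderiv ℝ (fderiv ℝ f) u (1, 0) (1, 0) *
      fderiv ℝ (fderiv ℝ f) u (0, 1) (0, 1) - fderiv ℝ (fderiv ℝ f) u (1, 0) (0, 1) ^ 2 := by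
  simp [isotropicGaussianCurvature, hessianMatrix, Matrix.det_fin_two, hessian_symm hf]
  ring

theorem analyticAt_hessian {f : ℝ × ℝ → ℝ} {u : ℝ × ℝ} (hf : AnalyticAt ℝ f u) (d e : ℝ × ℝ) :
    AnalyticAt ℝ (fun v => fderiv ℝ (fderiv ℝ f) v d e) u := by
  let L : (ℝ × ℝ →L[ℝ] ℝ × ℝ →L[ℝ] ℝ) →L[ℝ] ℝ :=
    (ContinuousLinearMap.apply ℝ ℝ e).comp (ContinuousLinearMap.apply ℝ (ℝ × ℝ →L[ℝ] ℝ) d)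
  exact (L.analyticAt _).comp hf.fderiv.fderiv

theorem analyticAt_meanCurvature {f : ℝ × ℝ → ℝ} {u : ℝ × ℝ} (hf : AnalyticAt ℝ f u) :
    AnalyticAt ℝ (isotropicMeanCurvature f) u := by
  have : isotropicMeanCurvature f = fun v => (2 : ℝ)⁻¹ * (fderiv ℝ (fderiv ℝ f) v (1, 0) (1, 0) +
      fderiv ℝ (fderiv ℝ f) v (0, 1) (0, 1)) := by
    ext v
    rw [← two_mul_meanCurvature]
    ring
  rw [this]
  exact analyticAt_const.mul ((analyticAt_hessian hf _ _).add (analyticAt_hessian hf _ _))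

theorem analyticAt_gaussianCurvature {f : ℝ × ℝ → ℝ} {u : ℝ × ℝ} (hf : AnalyticAt ℝ f u) :
    AnalyticAt ℝ (isotropicGaussianCurvature f) u := by
  have h := (((analyticAt_hessian hf (1, 0) (1, 0)).mul (analyticAt_hessian hf (0, 1) (0, 1))).sub
    ((analyticAt_hessian hf (1, 0) (0, 1)).pow 2))
  refine h.congr ?_
  filter_upwards [hf.eventually_analyticAt] with v hv
  exact (gaussianCurvature_eq hv).symm

theorem gaussianCurvature_le {f : ℝ × ℝ → ℝ} {u : ℝ × ℝ} (hf : AnalyticAt ℝ f u) :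
    isotropicGaussianCurvature f u ≤ isotropicMeanCurvature f u ^ 2 := by
  have h1 := two_mul_meanCurvature f u
  have h2 := gaussianCurvature_eq hf
  have h3 : isotropicMeanCurvature f u = (fderiv ℝ (fderiv ℝ f) u (1, 0) (1, 0) +
      fderiv ℝ (fderiv ℝ f) u (0, 1) (0, 1)) / 2 := by linarith
  rw [h2, h3]
  nlinarith [sq_nonneg (fderiv ℝ (fderiv ℝ f) u (1, 0) (1, 0) -
      fderiv ℝ (fderiv ℝ f) u (0, 1) (0, 1)), sq_nonneg (fderiv ℝ (fderiv ℝ f) u (1, 0) (0, 1))]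

theorem hessianMatrix_congr {f g : ℝ × ℝ → ℝ} {u : ℝ × ℝ} (h : f =ᶠ[𝓝 u] g) :
    hessianMatrix f u = hessianMatrix g u := by
  unfold hessianMatrix
  rw [h.fderiv.fderiv_eq]

theorem IsGraphPatch.eventuallyEq {M : Set Space} {f g : ℝ × ℝ → ℝ} {U : Set (ℝ × ℝ)}
    (h : IsGraphPatch M f U) {u : ℝ × ℝ} (hu : u ∈ U) (hg : IsLocalGraph M (u.1, u.2, f u) g) :
    g =ᶠ[𝓝 u] f := by
  have hcont : ContinuousAt (fun v : ℝ × ℝ => ((v.1, v.2, f v) : Space)) u := by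
    have := (h.analytic u hu).continuousAt
    fun_prop
  filter_upwards [hcont.eventually (eventually_nhdsWithin_iff.1 hg.2), h.isOpen.mem_nhds hu]
    with v hv hvU
  exact (hv (h.mem hvU)).symm

/-- Along its curve of contact with `M`, a paraboloid has a common normal curvature with `M` in the
direction of the curve. So its curvature `A` is a principal curvature of `M`: otherwise the
gradients of the two graphs would agree at isolated points only. -/
theorem IsGraphPatch.curvature_eq {M : Set Space} {f : ℝ × ℝ → ℝ} {U : Set (ℝ × ℝ)}
    (h : IsGraphPatch M f U) {u : ℝ × ℝ} (hu : u ∈ U) {A B C D : ℝ}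
    (hc : IsCurveWithoutEndpoints {p | TouchesAt M (parabolicSphere A B C D) p})
    (ht : IsContact f A B C D u) :
    A ^ 2 - 2 * isotropicMeanCurvature f u * A + isotropicGaussianCurvature f u = 0 := by
  have hfa := h.analytic u hu
  rw [two_mul_meanCurvature, gaussianCurvature_eq hfa]
  by_contra hdet
  set D2 := fderiv ℝ (fderiv ℝ f) u with hD2
  have hsym : D2 (0, 1) (1, 0) = D2 (1, 0) (0, 1) := hessian_symm hfa
  have h1 := (hasFDerivAt_fderiv_apply hfa (1, 0)).sub
    ((hasFDerivAt_fst (𝕜 := ℝ) (p := u)).const_mul A)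
  have h2 := (hasFDerivAt_fderiv_apply hfa (0, 1)).sub
    ((hasFDerivAt_snd (𝕜 := ℝ) (p := u)).const_mul A)
  have h12 := h1.prodMk h2
  set L := ContinuousLinearMap.prod
    ((ContinuousLinearMap.apply ℝ ℝ ((1, 0) : ℝ × ℝ)).comp D2 -
      A • ContinuousLinearMap.fst ℝ ℝ ℝ)
    ((ContinuousLinearMap.apply ℝ ℝ ((0, 1) : ℝ × ℝ)).comp D2 -
      A • ContinuousLinearMap.snd ℝ ℝ ℝ) with hL
  have hinj : Function.Injective L := by
    refine (injective_iff_map_eq_zero L).2 fun e he => ?_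
    have hdec : D2 e = e.1 • D2 (1, 0) + e.2 • D2 (0, 1) := by
      rw [← map_smul, ← map_smul, ← map_add]
      congr 1
      ext <;> simp
    simp only [hL, ContinuousLinearMap.prod_apply, Prod.mk_eq_zero, sub_apply,
      ContinuousLinearMap.comp_apply, ContinuousLinearMap.apply_apply, hdec, add_apply,
      smul_apply, ContinuousLinearMap.coe_fst', ContinuousLinearMap.coe_snd', smul_eq_mul,
      hsym] at he
    obtain ⟨e1, e2⟩ := he
    ext
    · refine (mul_eq_zero.1 (?_ : _ * e.1 = 0)).resolve_left hdet
      linear_combination (D2 (0, 1) (0, 1) - A) * e1 - D2 (1, 0) (0, 1) * e2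
    · refine (mul_eq_zero.1 (?_ : _ * e.2 = 0)).resolve_left hdet
      linear_combination (D2 (1, 0) (1, 0) - A) * e2 - D2 (1, 0) (0, 1) * e1
  have hanti : ∃ C, AntilipschitzWith C L := by
    obtain ⟨K, -, hK⟩ := LinearMap.exists_antilipschitzWith L.toLinearMap
      (LinearMap.ker_eq_bot.2 hinj)
    exact ⟨K, hK⟩
  have hne := eventually_nhdsWithin_iff.1 (h12.eventually_ne hanti (c := (B / 2, C / 2)))
  have htv : Continuous topView := by unfold topView; fun_prop
  have hmem : ((u.1, u.2, f u) : Space) ∈ {p | TouchesAt M (parabolicSphere A B C D) p} :=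
    (h.touchesAt_iff hu).2 ht
  have hfr := hc.frequently_mem hmem
  have hev : ∀ᶠ q in 𝓝[≠] ((u.1, u.2, f u) : Space), ¬ TouchesAt M (parabolicSphere A B C D) q := by
    have hcv : ContinuousAt topView ((u.1, u.2, f u) : Space) := htv.continuousAt
    filter_upwards [mem_nhdsWithin_of_mem_nhds (hcv.eventually hne),
      mem_nhdsWithin_of_mem_nhds (hcv.eventually (h.isOpen.mem_nhds hu)),
      mem_nhdsWithin_of_mem_nhds (h.mem_iff u hu), self_mem_nhdsWithin] with q h1 h2 h3 h4 h5
    have hq : q = ((topView q).1, (topView q).2, f (topView q)) :=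
      Prod.ext rfl (Prod.ext rfl (h3.1 h5.1))
    have hqu : topView q ≠ u := fun hqu => h4 (by rw [Set.mem_singleton_iff, hq, hqu])
    have h6 := h1 hqu
    rw [hq, h.touchesAt_iff h2] at h5
    apply h6
    ext
    · simp [h5.2.1]
    · simp [h5.2.2]
  exact hfr hev

/-! ### Zeros of analytic functions on an interval -/

theorem exists_frequently_of_not_countable {T : Set ℝ} (hT : ¬ T.Countable) :
    ∃ t ∈ T, ∃ᶠ s in 𝓝[≠] t, s ∈ T := by
  by_contra! h
  apply hT
  have : IsDiscrete T := by
    refine isDiscrete_iff_nhdsNE.2 fun t ht => ?_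
    have := h t ht
    exact inf_principal_eq_bot.2 this
  exact (HereditarilyLindelofSpace.isLindelof T).countable_of_isDiscrete this

theorem AnalyticOnNhd.eqOn_zero_of_not_countable {g : ℝ → ℝ} {J : Set ℝ} (hJ : J.OrdConnected)
    (hg : AnalyticOnNhd ℝ g J) (h : ¬ {t ∈ J | g t = 0}.Countable) : ∀ t ∈ J, g t = 0 := by
  obtain ⟨t, ht, hfr⟩ := exists_frequently_of_not_countable h
  exact hg.eqOn_zero_of_preconnected_of_frequently_eq_zero hJ.isPreconnected ht.1
    (hfr.mono fun s hs => hs.2)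

theorem Set.OrdConnected.countable_diff_interior {J : Set ℝ} (hJ : J.OrdConnected) :
    (J \ interior J).Countable := by
  have hsub : J \ interior J ⊆ {t | IsLeast J t} ∪ {t | IsGreatest J t} := by
    rintro t ⟨ht, hti⟩
    by_contra hc
    simp only [Set.mem_union, Set.mem_ofPred_eq, not_or, IsLeast, IsGreatest, ht, true_and,
      mem_lowerBounds, mem_upperBounds] at hc
    push Not at hc
    obtain ⟨⟨a, ha, hat⟩, b, hb, htb⟩ := hc
    exact hti (mem_interior.2 ⟨Set.Ioo a b,
      fun s hs => hJ.out ha hb ⟨hs.1.le, hs.2.le⟩, isOpen_Ioo, hat, htb⟩)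
  refine Set.Countable.mono hsub (Set.Countable.union ?_ ?_)
  · exact Set.Subsingleton.countable fun s hs t ht => hs.unique ht
  · exact Set.Subsingleton.countable fun s hs t ht => hs.unique ht

/-! ### The family parameter as a local function on the surface -/

theorem IsAnalyticEnvelope.exists_contact {M : Set Space} {J : Set ℝ} {A B C D : ℝ → ℝ}
    (hE : IsAnalyticEnvelope M J A B C D) {f : ℝ × ℝ → ℝ} {U : Set (ℝ × ℝ)}
    (h : IsGraphPatch M f U) {u : ℝ × ℝ} (hu : u ∈ U) :
    ∃ t ∈ J, IsContact f (A t) (B t) (C t) (D t) u := by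
  obtain ⟨t, ht, htt⟩ := hE.2.2.2.2.2.2.2.2 _ (h.mem hu)
  exact ⟨t, ht, (h.touchesAt_iff hu).1 htt⟩

theorem IsAnalyticEnvelope.isCurve {M : Set Space} {J : Set ℝ} {A B C D : ℝ → ℝ}
    (hE : IsAnalyticEnvelope M J A B C D) {t : ℝ} (ht : t ∈ J) :
    IsCurveWithoutEndpoints {p | TouchesAt M (parabolicSphere (A t) (B t) (C t) (D t)) p} :=
  hE.2.2.2.2.2.2.2.1 t ht

/-- No member of the family touches the envelope along an open piece of surface. -/
theorem IsAnalyticEnvelope.not_contact_on_open {M : Set Space} {J : Set ℝ} {A B C D : ℝ → ℝ}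
    (hE : IsAnalyticEnvelope M J A B C D) {f : ℝ × ℝ → ℝ} {U : Set (ℝ × ℝ)}
    (h : IsGraphPatch M f U) {W : Set (ℝ × ℝ)} (hW : IsOpen W) (hWU : W ⊆ U) (hne : W.Nonempty)
    {t : ℝ} (ht : t ∈ J) (hc : ∀ u ∈ W, IsContact f (A t) (B t) (C t) (D t) u) : False := by
  obtain ⟨u, hu⟩ := hne
  exact (hE.isCurve ht).not_graph_subset hW hu (h.analytic u (hWU hu)).differentiableAt
    fun v hv => (h.touchesAt_iff (hWU hv)).2 (hc v hv)

theorem isClosed_setOf_exists_contact {f κ : ℝ × ℝ → ℝ} {K : Set (ℝ × ℝ)} {I : Set ℝ}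
    {A B C D : ℝ → ℝ} (hK : IsCompact K) (hI : IsCompact I) (hf : AnalyticOnNhd ℝ f K)
    (hκ : ContinuousOn κ K) (hA : ContinuousOn A I) (hB : ContinuousOn B I)
    (hC : ContinuousOn C I) (hD : ContinuousOn D I) :
    IsClosed {u ∈ K | ∃ t ∈ I, IsContact f (A t) (B t) (C t) (D t) u ∧ A t = κ u} := by
  have h1 : Set.MapsTo Prod.fst (K ×ˢ I) K := fun x hx => hx.1
  have h2 : Set.MapsTo Prod.snd (K ×ˢ I) I := fun x hx => hx.2
  have hf' : ∀ e : ℝ × ℝ, ContinuousOn (fun x : (ℝ × ℝ) × ℝ => fderiv ℝ f x.1 e) (K ×ˢ I) :=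
    fun e => (show ContinuousOn (fun u => fderiv ℝ f u e) K from
      (hf.fderiv.continuousOn).clm_apply continuousOn_const).comp continuousOn_fst h1
  have kf := hf.continuousOn.comp continuousOn_fst h1
  have kκ := hκ.comp continuousOn_fst h1
  have kA := hA.comp continuousOn_snd h2
  have kB := hB.comp continuousOn_snd h2
  have kC := hC.comp continuousOn_snd h2
  have kD := hD.comp continuousOn_snd h2
  have kx : ContinuousOn (fun x : (ℝ × ℝ) × ℝ => x.1.1) (K ×ˢ I) := by fun_prop
  have ky : ContinuousOn (fun x : (ℝ × ℝ) × ℝ => x.1.2) (K ×ˢ I) := by fun_prop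
  have hg := ((kf.sub ((((kA.mul ((kx.pow 2).add (ky.pow 2))).add (kB.mul kx)).add
    (kC.mul ky)).add kD |>.div_const 2)).prodMk ((hf' (1, 0)).sub ((kA.mul kx).add
    (kB.div_const 2)))).prodMk (((hf' (0, 1)).sub ((kA.mul ky).add (kC.div_const 2))).prodMk
    (kA.sub kκ))
  have hcl := hg.preimage_isClosed_of_isClosed (hK.isClosed.prod hI.isClosed)
    (isClosed_singleton (x := 0))
  have hcomp := ((hK.prod hI).of_isClosed_subset hcl Set.inter_subset_left).image continuous_fst
  convert! hcomp.isClosed using 1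
  ext u
  simp only [Set.mem_ofPred_eq, Set.mem_image, Set.mem_inter_iff, Set.mem_prod, Set.mem_preimage,
    Set.mem_singleton_iff, Prod.mk_eq_zero, Prod.exists, exists_and_right, exists_eq_right,
    sub_eq_zero, IsContact, sphereHeight, Function.comp, Pi.sub_apply, Pi.add_apply, Pi.mul_apply,
    Pi.pow_apply]
  constructor
  · rintro ⟨hu, t, ht, ⟨a, b, c⟩, d⟩
    exact ⟨t, ⟨hu, ht⟩, ⟨a, b⟩, c, d⟩
  · rintro ⟨t, ⟨hu, ht⟩, ⟨a, b⟩, c, d⟩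
    exact ⟨hu, t, ht, ⟨a, b, c⟩, d⟩

theorem eq_of_deriv_eq_zero_of_ordConnected {g : ℝ → ℝ} {J : Set ℝ} (hJ : J.OrdConnected)
    (hg : AnalyticOnNhd ℝ g J) (h : ∀ t ∈ J, deriv g t = 0) {s t : ℝ} (hs : s ∈ J) (ht : t ∈ J) :
    g s = g t := by
  have := hJ.convex.norm_image_sub_le_of_norm_hasDerivWithin_le (f := g) (f' := fun _ => 0) (C := 0)
    (fun x hx => by
      have := (hg x hx).differentiableAt.hasDerivAt
      rw [h x hx] at this
      exact this.hasDerivWithinAt) (by simp) hs ht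
  simp only [zero_mul, norm_le_zero_iff, sub_eq_zero] at this
  exact this.symm

/-- The interval `[a, b]` has a neighbourhood contained in `J` on which `A` is a regular
coordinate. -/
def IsRegularInterval (A : ℝ → ℝ) (J : Set ℝ) (a b : ℝ) : Prop :=
  ∃ O : Set ℝ, IsOpen O ∧ Set.Icc a b ⊆ O ∧ O ⊆ J ∧ Set.InjOn A O ∧ ∀ t ∈ O, deriv A t ≠ 0

theorem exists_isRegularInterval {A : ℝ → ℝ} {J : Set ℝ} {t : ℝ} (ht : J ∈ 𝓝 t)
    (hA : AnalyticAt ℝ A t) (hA' : deriv A t ≠ 0) :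
    ∃ a b : ℚ, t ∈ Set.Icc (a : ℝ) b ∧ IsRegularInterval A J a b := by
  have hs := (hA.hasStrictDerivAt).hasStrictFDerivAt_equiv hA'
  set Φ := hs.toOpenPartialHomeomorph A
  have h1 : ∀ᶠ s in 𝓝 t, s ∈ Φ.source ∧ s ∈ J ∧ deriv A s ≠ 0 :=
    (Filter.Eventually.and (Φ.open_source.mem_nhds hs.mem_toOpenPartialHomeomorph_source)
      (Filter.Eventually.and ht (hA.deriv.continuousAt.eventually_ne hA')))
  obtain ⟨ε, hε, hball⟩ := Metric.eventually_nhds_iff_ball.1 h1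
  rw [Real.ball_eq_Ioo] at hball
  obtain ⟨a, ha, ha'⟩ := exists_rat_btwn (show t - ε < t by linarith)
  obtain ⟨b, hb, hb'⟩ := exists_rat_btwn (show t < t + ε by linarith)
  refine ⟨a, b, ⟨ha'.le, hb.le⟩, Set.Ioo (t - ε) (t + ε), isOpen_Ioo,
    fun s hs => ⟨ha.trans_le hs.1, hs.2.trans_lt hb'⟩, fun s hs => (hball s hs).2.1,
    fun s hs s' hs' h => ?_, fun s hs => (hball s hs).2.2⟩
  exact Φ.injOn (hball s hs).1 (hball s' hs').1 h

theorem countable_setOf_not_regular {A : ℝ → ℝ} {J : Set ℝ} (hJ : J.OrdConnected)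
    (hA : AnalyticOnNhd ℝ A J) (hne : ∃ s ∈ J, ∃ t ∈ J, A s ≠ A t) :
    {t ∈ J | ¬ ∃ a b : ℚ, t ∈ Set.Icc (a : ℝ) b ∧ IsRegularInterval A J a b}.Countable := by
  have h1 : {t ∈ J | deriv A t = 0}.Countable := by
    by_contra hc
    obtain ⟨s, hs, t, ht, hst⟩ := hne
    exact hst (eq_of_deriv_eq_zero_of_ordConnected hJ hA
      (AnalyticOnNhd.eqOn_zero_of_not_countable hJ hA.deriv hc) hs ht)
  refine (h1.union hJ.countable_diff_interior).mono ?_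
  rintro t ⟨ht, hnot⟩
  by_contra hc
  simp only [Set.mem_union, Set.mem_ofPred_eq, Set.mem_sdiff, ht, true_and, not_or, not_not] at hc
  exact hnot (exists_isRegularInterval (mem_interior_iff_mem_nhds.1 hc.2) (hA t ht) hc.1)

theorem differentiableAt_of_comp_eq {A : ℝ → ℝ} {O : Set ℝ} (hO : IsOpen O) (hinj : Set.InjOn A O)
    {τ κ : ℝ × ℝ → ℝ} {u : ℝ × ℝ} (hA : AnalyticAt ℝ A (τ u)) (hA' : deriv A (τ u) ≠ 0)
    (hκ : DifferentiableAt ℝ κ u) (h : ∀ᶠ v in 𝓝 u, τ v ∈ O ∧ A (τ v) = κ v) :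
    DifferentiableAt ℝ τ u := by
  have hs := hA.hasStrictDerivAt
  have hu := h.self_of_nhds
  have hinv := (hs.to_localInverse hA').hasDerivAt
  have hτ : hs.localInverse A _ _ hA' (A (τ u)) = τ u :=
    (hs.eventually_left_inverse hA').self_of_nhds
  have hcont := hκ.continuousAt
  rw [ContinuousAt, ← hu.2] at hcont
  have hev1 := hcont.eventually (hs.eventually_right_inverse hA')
  have hev2 := hcont.eventually (hinv.continuousAt.eventually
    (show ∀ᶠ s in 𝓝 (hs.localInverse A _ _ hA' (A (τ u))), s ∈ O by
      rw [hτ]; exact hO.mem_nhds hu.1))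
  have heq : τ =ᶠ[𝓝 u] fun v => hs.localInverse A _ _ hA' (κ v) := by
    filter_upwards [h, hev1, hev2] with v hv hv1 hv2
    exact hinj hv.1 hv2 (hv.2.trans hv1.symm)
  refine DifferentiableAt.congr_of_eventuallyEq ?_ heq
  rw [hu.2] at hinv
  exact hinv.differentiableAt.comp u hκ

/-- The two roots of `x² - 2Hx + K`, as functions on the top view. -/
noncomputable def principalCurvature (f : ℝ × ℝ → ℝ) (b : Bool) (u : ℝ × ℝ) : ℝ :=
  isotropicMeanCurvature f u + (if b then 1 else -1) *
    √(isotropicMeanCurvature f u ^ 2 - isotropicGaussianCurvature f u)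

theorem eq_principalCurvature {f : ℝ × ℝ → ℝ} {u : ℝ × ℝ} (hf : AnalyticAt ℝ f u) {x : ℝ}
    (hx : x ^ 2 - 2 * isotropicMeanCurvature f u * x + isotropicGaussianCurvature f u = 0) :
    ∃ b, x = principalCurvature f b u := by
  have h := Real.sq_sqrt (sub_nonneg.2 (gaussianCurvature_le hf))
  set r := √(isotropicMeanCurvature f u ^ 2 - isotropicGaussianCurvature f u) with hr
  have : (x - isotropicMeanCurvature f u - r) * (x - isotropicMeanCurvature f u + r) = 0 := by
    linear_combination hx - h
  rcases mul_eq_zero.1 this with h | h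
  · exact ⟨true, by simp [principalCurvature, ← hr]; linarith⟩
  · exact ⟨false, by simp [principalCurvature, ← hr]; linarith⟩

/-- The principal curvatures are differentiable where the discriminant `H² - K` is positive, and
also where it vanishes identically. -/
theorem exists_differentiableOn_principalCurvature {f : ℝ × ℝ → ℝ} {U : Set (ℝ × ℝ)}
    (hU : IsOpen U) (hne : U.Nonempty) (hf : AnalyticOnNhd ℝ f U) :
    ∃ O ⊆ U, IsOpen O ∧ O.Nonempty ∧
      ∀ b, ∀ u ∈ O, DifferentiableAt ℝ (principalCurvature f b) u := by
  have hd : ∀ u ∈ U, AnalyticAt ℝ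
      (fun u => isotropicMeanCurvature f u ^ 2 - isotropicGaussianCurvature f u) u := fun u hu =>
    ((analyticAt_meanCurvature (hf u hu)).pow 2).sub (analyticAt_gaussianCurvature (hf u hu))
  by_cases h : ∃ u ∈ U, isotropicMeanCurvature f u ^ 2 - isotropicGaussianCurvature f u ≠ 0
  · obtain ⟨u, hu, hu0⟩ := h
    obtain ⟨O, hO, hOo, huO⟩ := eventually_nhds_iff.1
      (((hd u hu).continuousAt.eventually_ne hu0).and (hU.mem_nhds hu))
    refine ⟨O, fun v hv => (hO v hv).2, hOo, ⟨u, huO⟩, fun b v hv => ?_⟩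
    exact (analyticAt_meanCurvature (hf v (hO v hv).2)).differentiableAt.add
      (((hd v (hO v hv).2).differentiableAt.sqrt (hO v hv).1).const_mul _)
  · push Not at h
    refine ⟨U, subset_rfl, hU, hne, fun b u hu => ?_⟩
    refine (analyticAt_meanCurvature (hf u hu)).differentiableAt.congr_of_eventuallyEq ?_
    filter_upwards [hU.mem_nhds hu] with v hv
    simp [principalCurvature, h v hv]

/-- Over some open set, the parameter of a touching paraboloid can be chosen differentiably. Indeed
`A` at this parameter is a principal curvature, so that the parameter is determined by one of
countably many continuous branches, and Baire's theorem applies to them. -/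
theorem IsAnalyticEnvelope.exists_local_parameter {M : Set Space} {J : Set ℝ} {A B C D : ℝ → ℝ}
    (hE : IsAnalyticEnvelope M J A B C D) (hne : ∃ s ∈ J, ∃ t ∈ J, A s ≠ A t)
    {f : ℝ × ℝ → ℝ} {U : Set (ℝ × ℝ)} (h : IsGraphPatch M f U) (hU : U.Nonempty) :
    ∃ W ⊆ U, IsOpen W ∧ W.Nonempty ∧ ∃ τ : ℝ × ℝ → ℝ, ∀ u ∈ W, J ∈ 𝓝 (τ u) ∧
      deriv A (τ u) ≠ 0 ∧ DifferentiableAt ℝ τ u ∧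
      IsContact f (A (τ u)) (B (τ u)) (C (τ u)) (D (τ u)) u := by
  obtain ⟨-, hJ, hA, hB, hC, hD, -⟩ := id hE
  obtain ⟨O, hOU, hO, ⟨u₀, hu₀⟩, hκ⟩ :=
    exists_differentiableOn_principalCurvature h.isOpen hU h.analytic
  obtain ⟨r, hr, hK⟩ := Metric.nhds_basis_closedBall.mem_iff.1 (hO.mem_nhds hu₀)
  set K := Metric.closedBall u₀ r with hKdef
  set X := {t ∈ J | ¬ ∃ a b : ℚ, t ∈ Set.Icc (a : ℝ) b ∧ IsRegularInterval A J a b} with hX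
  have hXc : Countable X := (countable_setOf_not_regular hJ hA hne).to_subtype
  have hfK : AnalyticOnNhd ℝ f K := h.analytic.mono (hK.trans hOU)
  have hκK : ∀ b, ContinuousOn (principalCurvature f b) K := fun b u hu =>
    (hκ b u (hK hu)).continuousAt.continuousWithinAt
  -- a countable closed cover of the plane: the points outside the ball, the contacts with one
  -- exceptional paraboloid, and the contacts with parameters in one regular interval along one
  -- branch of the principal curvature
  let F : Option (X ⊕ ℚ × ℚ × Bool) → Set (ℝ × ℝ) := fun i =>
    match i with
    | none => (Metric.ball u₀ r)ᶜ
    | some (.inl t) => {u ∈ K | ∃ s ∈ ({(t : ℝ)} : Set ℝ), IsContact f (A s) (B s) (C s) (D s) u ∧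
        A s = A t}
    | some (.inr (a, b, i)) => {u ∈ K | IsRegularInterval A J a b ∧
        ∃ t ∈ Set.Icc (a : ℝ) b, IsContact f (A t) (B t) (C t) (D t) u ∧
          A t = principalCurvature f i u}
  have hFc : ∀ i, IsClosed (F i) := by
    rintro (_ | t | ⟨a, b, i⟩)
    · exact Metric.isOpen_ball.isClosed_compl
    · exact isClosed_setOf_exists_contact (isCompact_closedBall _ _) isCompact_singleton hfK
        continuousOn_const (continuousOn_singleton _ _) (continuousOn_singleton _ _)
        (continuousOn_singleton _ _) (continuousOn_singleton _ _)
    · by_cases hg : IsRegularInterval A J a b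
      · have hI : Set.Icc (a : ℝ) b ⊆ J := by
          obtain ⟨O, -, h1, h2, -⟩ := hg
          exact h1.trans h2
        have := isClosed_setOf_exists_contact (isCompact_closedBall u₀ r)
          (isCompact_Icc (a := (a : ℝ)) (b := b)) hfK (hκK i) (hA.continuousOn.mono hI)
          (hB.continuousOn.mono hI) (hC.continuousOn.mono hI) (hD.continuousOn.mono hI)
        simpa only [F, hg, true_and] using this
      · simp only [F, hg, false_and, and_false, Set.ofPred_false, isClosed_empty]
  have hFU : ⋃ i, F i = Set.univ := by
    refine Set.eq_univ_of_forall fun u => Set.mem_iUnion.2 ?_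
    by_cases hu : u ∈ Metric.ball u₀ r
    · have huK : u ∈ K := Metric.ball_subset_closedBall hu
      have huU := hOU (hK huK)
      obtain ⟨t, ht, htu⟩ := hE.exists_contact h huU
      by_cases htX : t ∈ X
      · exact ⟨some (.inl ⟨t, htX⟩), huK, t, rfl, htu, rfl⟩
      · have : ∃ a b : ℚ, t ∈ Set.Icc (a : ℝ) b ∧ IsRegularInterval A J a b := by
          by_contra hc
          exact htX ⟨ht, hc⟩
        obtain ⟨a, b, htab, hg⟩ := this
        obtain ⟨i, hi⟩ := eq_principalCurvature (h.analytic u huU)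
          (h.curvature_eq huU (hE.isCurve ht) htu)
        exact ⟨some (.inr (a, b, i)), huK, hg, t, htab, htu, hi⟩
    · exact ⟨none, hu⟩
  obtain ⟨v, hvb, hv⟩ := (dense_iUnion_interior_of_closed hFc hFU).inter_open_nonempty _
    Metric.isOpen_ball ⟨u₀, Metric.mem_ball_self hr⟩
  obtain ⟨i, hi⟩ := Set.mem_iUnion.1 hv
  have hsub := interior_subset (s := F i)
  rcases i with _ | t | ⟨a, b, i⟩
  · exact absurd hvb (hsub hi)
  · -- a single paraboloid does not touch the envelope along an open piece
    refine (hE.not_contact_on_open h isOpen_interior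
      (fun u hu => hOU (hK (hsub hu).1)) ⟨v, hi⟩ t.2.1 fun u hu => ?_).elim
    obtain ⟨-, s, hs, hsu, -⟩ := hsub hu
    rw [Set.mem_singleton_iff] at hs
    rwa [hs] at hsu
  · obtain ⟨-, ⟨O', hO', hIccO, hOJ, hinj, hreg⟩, -⟩ := hsub hi
    have hex : ∀ u, ∃ t, u ∈ interior (F (some (.inr (a, b, i)))) → t ∈ Set.Icc (a : ℝ) b ∧
        IsContact f (A t) (B t) (C t) (D t) u ∧ A t = principalCurvature f i u := fun u => by
      by_cases hu : u ∈ interior (F (some (.inr (a, b, i))))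
      · obtain ⟨-, -, t, ht⟩ := hsub hu
        exact ⟨t, fun _ => ht⟩
      · exact ⟨0, fun h => absurd h hu⟩
    choose τ hτ using hex
    refine ⟨_, fun u hu => hOU (hK (hsub hu).1), isOpen_interior, ⟨v, hi⟩, τ, fun u hu => ?_⟩
    obtain ⟨h1, h2, h3⟩ := hτ u hu
    refine ⟨mem_of_superset (hO'.mem_nhds (hIccO h1)) hOJ, hreg _ (hIccO h1), ?_, h2⟩
    refine differentiableAt_of_comp_eq hO' hinj (hA _ (hOJ (hIccO h1))) (hreg _ (hIccO h1))
      (hκ i u (hK (hsub hu).1)) ?_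
    filter_upwards [isOpen_interior.mem_nhds hu] with w hw
    exact ⟨hIccO (hτ w hw).1, (hτ w hw).2.2⟩

/-! ### Weingarten envelopes with varying radii have concentric characteristics -/

theorem fderiv_wedge_eq_zero {H K : ℝ × ℝ → ℝ} {u : ℝ × ℝ} {Z : Set (ℝ × ℝ)}
    (hZ : ∀ w, Z ∉ 𝓝 w) (hH : AnalyticAt ℝ H u) (hK : AnalyticAt ℝ K u)
    (h : ∀ᶠ v in 𝓝 u, (H v, K v) ∈ Z) :
    fderiv ℝ H u (1, 0) * fderiv ℝ K u (0, 1) - fderiv ℝ H u (0, 1) * fderiv ℝ K u (1, 0) = 0 := by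
  by_contra hdet
  have hF := hH.hasStrictFDerivAt.prodMk hK.hasStrictFDerivAt
  refine hZ (H u, K u) ?_
  rw [← hF.map_nhds_eq_of_surj]
  · exact h
  · rw [LinearMap.range_eq_top]
    rintro ⟨x, y⟩
    set d := fderiv ℝ H u (1, 0) * fderiv ℝ K u (0, 1) - fderiv ℝ H u (0, 1) * fderiv ℝ K u (1, 0)
    refine ⟨((x * fderiv ℝ K u (0, 1) - y * fderiv ℝ H u (0, 1)) / d) • ((1, 0) : ℝ × ℝ) +
      ((y * fderiv ℝ H u (1, 0) - x * fderiv ℝ K u (1, 0)) / d) • ((0, 1) : ℝ × ℝ), ?_⟩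
    simp only [ContinuousLinearMap.coe_coe, map_add, map_smul]
    ext
    · simp only [ContinuousLinearMap.prod_apply, Prod.fst_add, Prod.smul_fst, smul_eq_mul]
      field_simp
      simp only [d]
      ring
    · simp only [ContinuousLinearMap.prod_apply, Prod.snd_add, Prod.smul_snd, smul_eq_mul]
      field_simp
      simp only [d]
      ring

theorem HasFDerivAt.apply_eq_zero_of_forall_eq_zero {Φ : ℝ × ℝ → ℝ} {L : ℝ × ℝ →L[ℝ] ℝ}
    {W : Set (ℝ × ℝ)} (hW : IsOpen W) {u : ℝ × ℝ} (hu : u ∈ W) (hL : HasFDerivAt Φ L u)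
    (h : ∀ v ∈ W, Φ v = 0) (e : ℝ × ℝ) : L e = 0 := by
  have h0 : HasFDerivAt Φ (0 : ℝ × ℝ →L[ℝ] ℝ) u :=
    (hasFDerivAt_const (0 : ℝ) u).congr_of_eventuallyEq
      (by filter_upwards [hW.mem_nhds hu] with v hv using h v hv)
  rw [hL.unique h0]
  rfl

theorem AnalyticAt.hasFDerivAt_comp {a : ℝ → ℝ} {τ : ℝ × ℝ → ℝ} {u : ℝ × ℝ}
    (ha : AnalyticAt ℝ a (τ u)) (hτ : DifferentiableAt ℝ τ u) :
    HasFDerivAt (fun v => a (τ v)) (deriv a (τ u) • fderiv ℝ τ u) u :=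
  ha.differentiableAt.hasDerivAt.comp_hasFDerivAt u hτ.hasFDerivAt

theorem exists_affine_of_deriv_proportional {A B : ℝ → ℝ} {J : Set ℝ} (hJ : J.OrdConnected)
    (hA : AnalyticOnNhd ℝ A J) (hB : AnalyticOnNhd ℝ B J) {t₀ : ℝ} (ht₀ : J ∈ 𝓝 t₀)
    (hA0 : deriv A t₀ ≠ 0)
    (h : ∀ t ∈ J, deriv A t * deriv (deriv B) t - deriv (deriv A) t * deriv B t = 0) :
    ∃ m n : ℝ, ∀ t ∈ J, B t = m * A t + n := by
  have htJ := mem_of_mem_nhds ht₀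
  have hev : ∀ᶠ t in 𝓝 t₀, t ∈ J ∧ deriv A t ≠ 0 :=
    Filter.Eventually.and ht₀ ((hA t₀ htJ).deriv.continuousAt.eventually_ne hA0)
  obtain ⟨ε, hε, hball⟩ := Metric.eventually_nhds_iff_ball.1 hev
  have hord : (Metric.ball t₀ ε).OrdConnected := (convex_ball t₀ ε).ordConnected
  have ht₀b : t₀ ∈ Metric.ball t₀ ε := Metric.mem_ball_self hε
  have hq : AnalyticOnNhd ℝ (fun t => deriv B t / deriv A t) (Metric.ball t₀ ε) := fun t ht =>
    (hB t (hball t ht).1).deriv.div (hA t (hball t ht).1).deriv (hball t ht).2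
  have hm : ∀ t ∈ Metric.ball t₀ ε, deriv B t = deriv B t₀ / deriv A t₀ * deriv A t := by
    intro t ht
    have := eq_of_deriv_eq_zero_of_ordConnected hord hq (fun s hs => by
      have hs' := hball s hs
      have e := ((hB s hs'.1).deriv.differentiableAt.hasDerivAt.fun_div
        (hA s hs'.1).deriv.differentiableAt.hasDerivAt hs'.2).deriv
      rw [e, div_eq_zero_iff]
      left
      linear_combination h s hs'.1) ht₀b ht
    rw [this, div_mul_cancel₀ _ (hball t ht).2]
  set m := deriv B t₀ / deriv A t₀
  have hF : AnalyticOnNhd ℝ (fun t => B t - m * A t) J := fun t ht =>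
    (hB t ht).sub (analyticAt_const.mul (hA t ht))
  have hn : ∀ t ∈ Metric.ball t₀ ε, B t₀ - m * A t₀ = B t - m * A t := by
    intro t ht
    refine eq_of_deriv_eq_zero_of_ordConnected hord
      (hF.mono fun s hs => (hball s hs).1) (fun s hs => ?_) ht₀b ht
    have hs' := hball s hs
    have e := ((hB s hs'.1).differentiableAt.hasDerivAt.fun_sub
      ((hA s hs'.1).differentiableAt.hasDerivAt.const_mul m)).deriv
    rw [e, hm s hs, sub_self]
  refine ⟨m, B t₀ - m * A t₀, fun t ht => ?_⟩
  have := hF.eqOn_of_preconnected_of_eventuallyEq (g := fun _ => B t₀ - m * A t₀)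
    (fun _ _ => analyticAt_const) hJ.isPreconnected htJ
    (by filter_upwards [Metric.ball_mem_nhds t₀ hε] with s hs using (hn s hs).symm) ht
  simp only at this
  linarith

/-- Let the paraboloids with the parameter `τ u` touch the graph of `f` at the points `u` of an
open set. With `N = ∇φ_t` and `P = φ_tt` (where `φ_t` is the height function of the paraboloid
with the parameter `t`), differentiation of the contact conditions gives `φ_t = 0` and
`N + P ∇τ = 0`. -/
theorem IsAnalyticEnvelope.characteristic_eqs {M : Set Space} {J : Set ℝ} {A B C D : ℝ → ℝ}
    (hE : IsAnalyticEnvelope M J A B C D) {f : ℝ × ℝ → ℝ} {W : Set (ℝ × ℝ)}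
    (h : IsGraphPatch M f W) {τ : ℝ × ℝ → ℝ}
    (hτ : ∀ u ∈ W, τ u ∈ J ∧ DifferentiableAt ℝ τ u ∧
      IsContact f (A (τ u)) (B (τ u)) (C (τ u)) (D (τ u)) u) :
    ∀ u ∈ W, deriv A (τ u) * (u.1 ^ 2 + u.2 ^ 2) + deriv B (τ u) * u.1 + deriv C (τ u) * u.2 +
        deriv D (τ u) = 0 ∧
      (deriv A (τ u) * u.1 + deriv B (τ u) / 2) +
        (deriv (deriv A) (τ u) * (u.1 ^ 2 + u.2 ^ 2) + deriv (deriv B) (τ u) * u.1 +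
          deriv (deriv C) (τ u) * u.2 + deriv (deriv D) (τ u)) / 2 * fderiv ℝ τ u (1, 0) = 0 ∧
      (deriv A (τ u) * u.2 + deriv C (τ u) / 2) +
        (deriv (deriv A) (τ u) * (u.1 ^ 2 + u.2 ^ 2) + deriv (deriv B) (τ u) * u.1 +
          deriv (deriv C) (τ u) * u.2 + deriv (deriv D) (τ u)) / 2 * fderiv ℝ τ u (0, 1) = 0 := by
  obtain ⟨-, -, hA, hB, hC, hD, -⟩ := id hE
  have hW := h.isOpen
  have dx : ∀ u : ℝ × ℝ, HasFDerivAt (fun v : ℝ × ℝ => v.1) (ContinuousLinearMap.fst ℝ ℝ ℝ) u :=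
    fun u => hasFDerivAt_fst
  have dy : ∀ u : ℝ × ℝ, HasFDerivAt (fun v : ℝ × ℝ => v.2) (ContinuousLinearMap.snd ℝ ℝ ℝ) u :=
    fun u => hasFDerivAt_snd
  have hφ : ∀ u ∈ W, ∀ {a b c d : ℝ → ℝ}, AnalyticOnNhd ℝ a J → AnalyticOnNhd ℝ b J →
      AnalyticOnNhd ℝ c J → AnalyticOnNhd ℝ d J →
      HasFDerivAt (fun v : ℝ × ℝ => a (τ v) * (v.1 ^ 2 + v.2 ^ 2) + b (τ v) * v.1 + c (τ v) * v.2 +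
        d (τ v)) _ u := fun u hu a b c d ha hb hc hd =>
    (((((ha _ (hτ u hu).1).hasFDerivAt_comp (hτ u hu).2.1).mul
      (((dx u).pow 2).add ((dy u).pow 2))).add
      (((hb _ (hτ u hu).1).hasFDerivAt_comp (hτ u hu).2.1).mul (dx u))).add
      (((hc _ (hτ u hu).1).hasFDerivAt_comp (hτ u hu).2.1).mul (dy u))).add
      ((hd _ (hτ u hu).1).hasFDerivAt_comp (hτ u hu).2.1)
  have h1 : ∀ u ∈ W, ∀ e : ℝ × ℝ, (deriv A (τ u) * (u.1 ^ 2 + u.2 ^ 2) + deriv B (τ u) * u.1 +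
      deriv C (τ u) * u.2 + deriv D (τ u)) * fderiv ℝ τ u e = 0 := by
    intro u hu e
    have hd := (h.analytic u hu).differentiableAt.hasFDerivAt
    have hL := (hd.const_mul 2).sub (hφ u hu hA hB hC hD)
    have := HasFDerivAt.apply_eq_zero_of_forall_eq_zero hW hu hL (fun v hv => by
      have := (hτ v hv).2.2.1
      simp only [sphereHeight] at this
      simp only [Pi.sub_apply]
      linarith) e
    have hdec : fderiv ℝ f u e = e.1 * fderiv ℝ f u (1, 0) + e.2 * fderiv ℝ f u (0, 1) := by
      rw [← smul_eq_mul, ← smul_eq_mul, ← map_smul, ← map_smul, ← map_add]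
      congr 1
      ext <;> simp
    rw [(hτ u hu).2.2.2.1, (hτ u hu).2.2.2.2] at hdec
    simp [hdec] at this
    linear_combination -this
  have hg : ∀ u ∈ W, deriv A (τ u) * (u.1 ^ 2 + u.2 ^ 2) + deriv B (τ u) * u.1 +
      deriv C (τ u) * u.2 + deriv D (τ u) = 0 := by
    intro u hu
    -- otherwise `τ` would be constant on a ball, and one paraboloid would touch there everywhere
    by_contra hne
    have hcont := (hφ u hu hA.deriv hB.deriv hC.deriv hD.deriv).continuousAt
    obtain ⟨ε, hε, hball⟩ := Metric.eventually_nhds_iff_ball.1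
      ((hcont.eventually_ne hne).and (hW.mem_nhds hu))
    have hconst : ∀ v ∈ Metric.ball u ε, τ v = τ u := fun v hv => by
      refine (convex_ball u ε).is_const_of_fderivWithin_eq_zero (𝕜 := ℝ)
        (fun w hw => (hτ w (hball w hw).2).2.1.differentiableWithinAt) (fun w hw => ?_) hv
        (Metric.mem_ball_self hε)
      rw [fderivWithin_of_isOpen Metric.isOpen_ball hw]
      refine ContinuousLinearMap.ext fun e => ?_
      exact (mul_eq_zero.1 (h1 w (hball w hw).2 e)).resolve_left (hball w hw).1
    refine hE.not_contact_on_open h Metric.isOpen_ball (fun v hv => (hball v hv).2)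
      ⟨u, Metric.mem_ball_self hε⟩ (hτ u hu).1 fun v hv => ?_
    have := (hτ v (hball v hv).2).2.2
    rwa [hconst v hv] at this
  intro u hu
  have h2 := HasFDerivAt.apply_eq_zero_of_forall_eq_zero hW hu
    (hφ u hu hA.deriv hB.deriv hC.deriv hD.deriv) hg
  refine ⟨hg u hu, ?_, ?_⟩
  · have := h2 (1, 0)
    simp at this
    linear_combination this / 2
  · have := h2 (0, 1)
    simp at this
    linear_combination this / 2

/-- The first-order consequences of a Weingarten relation at a point of an envelope: the derivative
`(Q₁, Q₂)` of `(N₁, N₂)` along the family is parallel to `(N₁, N₂)`. Here `(h₁, h₂)`, `(k₁, k₂)` and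
`(T₁, T₂)` are the gradients of the mean curvature, of the Gaussian curvature and of the
parameter. -/
theorem wedge_eq_zero_of_weingarten {s a A₁ h₁ h₂ k₁ k₂ T₁ T₂ N₁ N₂ P Q₁ Q₂ : ℝ}
    (hjac : h₁ * k₂ - h₂ * k₁ = 0) (hk₁ : k₁ = 2 * a * h₁ + s * A₁ * T₁)
    (hk₂ : k₂ = 2 * a * h₂ + s * A₁ * T₂) (hn₁ : N₁ + P * T₁ = 0) (hn₂ : N₂ + P * T₂ = 0)
    (hs : s * P + (N₁ ^ 2 + N₂ ^ 2) = 0) (hN : ¬ (N₁ = 0 ∧ N₂ = 0)) (hA₁ : A₁ ≠ 0)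
    (hl : T₂ * (2 * h₁ * P + s * Q₁ + 2 * A₁ * N₁) - T₁ * (2 * h₂ * P + s * Q₂ + 2 * A₁ * N₂) = 0) :
    Q₁ * N₂ - Q₂ * N₁ = 0 := by
  have hs0 : s ≠ 0 := by
    rintro rfl
    exact hN ⟨by nlinarith [sq_nonneg N₁, sq_nonneg N₂], by nlinarith [sq_nonneg N₁, sq_nonneg N₂]⟩
  have h1 : (s * A₁) * (h₁ * T₂ - h₂ * T₁) = 0 := by
    linear_combination hjac - h₁ * hk₂ + h₂ * hk₁
  have h2 := (mul_eq_zero.1 h1).resolve_left (mul_ne_zero hs0 hA₁)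
  have h3 : s * (Q₁ * T₂ - Q₂ * T₁) = 0 := by
    linear_combination hl - 2 * P * h2 - 2 * A₁ * (T₂ * hn₁ - T₁ * hn₂)
  have h4 := (mul_eq_zero.1 h3).resolve_left hs0
  linear_combination Q₁ * hn₂ - Q₂ * hn₁ - P * h4

/-- If the paraboloids of the family have varying radii, then they are obtained from concentric
paraboloids of rotation by one isotropic congruence. The Weingarten relation forces the second
principal curvature `A - |N|² / P` to be constant along the characteristics, which are arcs of
circles with the normals `N`; in terms of the family this says that `(B, C)` is affine in `A`. -/
theorem IsAnalyticEnvelope.exists_center {M : Set Space} {J : Set ℝ} {A B C D : ℝ → ℝ}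
    (hE : IsAnalyticEnvelope M J A B C D) (hne : ∃ s ∈ J, ∃ t ∈ J, A s ≠ A t)
    {f : ℝ × ℝ → ℝ} {U : Set (ℝ × ℝ)} (hpatch : IsGraphPatch M f U) (hU : U.Nonempty)
    {Z : Set (ℝ × ℝ)} (hZ : ∀ w, Z ∉ 𝓝 w)
    (hW : ∀ u ∈ U, (isotropicMeanCurvature f u, isotropicGaussianCurvature f u) ∈ Z) :
    ∃ m₁ n₁ m₂ n₂ : ℝ, ∀ t ∈ J, B t = m₁ * A t + n₁ ∧ C t = m₂ * A t + n₂ := by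
  obtain ⟨-, hJ, hA, hB, hC, hD, -⟩ := id hE
  obtain ⟨W, hWU, hWo, ⟨u₁, hu₁⟩, τ, hτ⟩ := hE.exists_local_parameter hne hpatch hU
  have hτJ : ∀ u ∈ W, τ u ∈ J := fun u hu => mem_of_mem_nhds (hτ u hu).1
  have hch := hE.characteristic_eqs (hpatch.mono hWo hWU)
    fun u hu => ⟨hτJ u hu, (hτ u hu).2.2⟩
  have dx : ∀ u : ℝ × ℝ, HasFDerivAt (fun v : ℝ × ℝ => v.1) (ContinuousLinearMap.fst ℝ ℝ ℝ) u :=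
    fun u => hasFDerivAt_fst
  have dy : ∀ u : ℝ × ℝ, HasFDerivAt (fun v : ℝ × ℝ => v.2) (ContinuousLinearMap.snd ℝ ℝ ℝ) u :=
    fun u => hasFDerivAt_snd
  have dc : ∀ u ∈ W, ∀ {a : ℝ → ℝ}, AnalyticOnNhd ℝ a J →
      HasFDerivAt (fun v => a (τ v)) (deriv a (τ u) • fderiv ℝ τ u) u := fun u hu a ha =>
    (ha _ (hτJ u hu)).hasFDerivAt_comp (hτ u hu).2.2.1
  -- the components of `N` and of its derivative along the family
  have dN₁ := fun u hu => ((dc u hu hA.deriv).mul (dx u)).add ((dc u hu hB.deriv).mul_const 2⁻¹)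
  have dN₂ := fun u hu => ((dc u hu hA.deriv).mul (dy u)).add ((dc u hu hC.deriv).mul_const 2⁻¹)
  have dQ₁ := fun u hu => ((dc u hu hA.deriv.deriv).mul (dx u)).add
    ((dc u hu hB.deriv.deriv).mul_const 2⁻¹)
  have dQ₂ := fun u hu => ((dc u hu hA.deriv.deriv).mul (dy u)).add
    ((dc u hu hC.deriv.deriv).mul_const 2⁻¹)
  have dP := fun u hu => (((((dc u hu hA.deriv.deriv).mul (((dx u).pow 2).add ((dy u).pow 2))).add
      ((dc u hu hB.deriv.deriv).mul (dx u))).add ((dc u hu hC.deriv.deriv).mul (dy u))).add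
      (dc u hu hD.deriv.deriv)).mul_const (2⁻¹ : ℝ)
  -- `N` does not vanish identically: it vanishes at the centers of the characteristic circles only,
  -- and these centers form a one-parameter family
  obtain ⟨u₀, hu₀, hN₀⟩ : ∃ u ∈ W, ¬ (deriv A (τ u) * u.1 + deriv B (τ u) * 2⁻¹ = 0 ∧
      deriv A (τ u) * u.2 + deriv C (τ u) * 2⁻¹ = 0) := by
    by_contra! hc
    have h1 := HasFDerivAt.apply_eq_zero_of_forall_eq_zero hWo hu₁ (dN₁ u₁ hu₁)
      fun v hv => (hc v hv).1
    have h2 := HasFDerivAt.apply_eq_zero_of_forall_eq_zero hWo hu₁ (dN₂ u₁ hu₁)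
      fun v hv => (hc v hv).2
    have hA1 := (hτ u₁ hu₁).2.1
    have e1 := h1 (1, 0)
    have e2 := h1 (0, 1)
    have e3 := h2 (1, 0)
    have e4 := h2 (0, 1)
    simp at e1 e2 e3 e4
    set x := fderiv ℝ τ u₁ (1, 0)
    set y := fderiv ℝ τ u₁ (0, 1)
    have h5 : deriv A (τ u₁) * y = 0 := by linear_combination y * e1 - x * e2
    have h6 : y = 0 := (mul_eq_zero.1 h5).resolve_left hA1
    rw [h6] at e4
    simp at e4
    exact hA1 e4
  have hcont₁ := (dN₁ u₀ hu₀).continuousAt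
  have hcont₂ := (dN₂ u₀ hu₀).continuousAt
  have hev : ∀ᶠ u in 𝓝 u₀, ¬ (deriv A (τ u) * u.1 + deriv B (τ u) * 2⁻¹ = 0 ∧
      deriv A (τ u) * u.2 + deriv C (τ u) * 2⁻¹ = 0) := by
    rcases not_and_or.1 hN₀ with h | h
    · filter_upwards [hcont₁.eventually_ne h] with u hu hu' using hu hu'.1
    · filter_upwards [hcont₂.eventually_ne h] with u hu hu' using hu hu'.2
  obtain ⟨r, hr, hball⟩ := Metric.eventually_nhds_iff_ball.1
    (Filter.Eventually.and (hWo.mem_nhds hu₀) hev)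
  set V := Metric.ball u₀ r with hV
  have hVo : IsOpen V := Metric.isOpen_ball
  have hVW : ∀ u ∈ V, u ∈ W := fun u hu => (hball u hu).1
  have hu₀V : u₀ ∈ V := Metric.mem_ball_self hr
  -- the gradient of `τ` and the second derivative `P` do not vanish on `V`
  have hPT : ∀ u ∈ V, (deriv (deriv A) (τ u) * (u.1 ^ 2 + u.2 ^ 2) + deriv (deriv B) (τ u) * u.1 +
          deriv (deriv C) (τ u) * u.2 + deriv (deriv D) (τ u)) * 2⁻¹ ≠ 0 := by
    intro u hu h0
    obtain ⟨-, h1, h2⟩ := hch u (hVW u hu)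
    rw [div_eq_mul_inv, div_eq_mul_inv, h0] at h1 h2
    exact (hball u hu).2 ⟨by linarith, by linarith⟩
  -- the curvatures of the envelope in terms of the family
  have hHN : ∀ u ∈ V, (2 * isotropicMeanCurvature f u - 2 * A (τ u)) *
      ((deriv (deriv A) (τ u) * (u.1 ^ 2 + u.2 ^ 2) + deriv (deriv B) (τ u) * u.1 +
        deriv (deriv C) (τ u) * u.2 + deriv (deriv D) (τ u)) * 2⁻¹) +
      ((deriv A (τ u) * u.1 + deriv B (τ u) * 2⁻¹) ^ 2 +
        (deriv A (τ u) * u.2 + deriv C (τ u) * 2⁻¹) ^ 2) = 0 := by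
    intro u hu
    have huW := hVW u hu
    have hfa := hpatch.analytic u (hWU huW)
    have hx := (hasFDerivAt_fderiv_apply hfa (1, 0)).sub (((dc u huW hA).mul (dx u)).add
      ((dc u huW hB).mul_const 2⁻¹))
    have hy := (hasFDerivAt_fderiv_apply hfa (0, 1)).sub (((dc u huW hA).mul (dy u)).add
      ((dc u huW hC).mul_const 2⁻¹))
    have ex := HasFDerivAt.apply_eq_zero_of_forall_eq_zero hWo huW hx (fun v hv => by
      have := (hτ v hv).2.2.2.2.1
      simp only [Pi.sub_apply, Pi.add_apply, Pi.mul_apply]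
      rw [this]
      ring) (1, 0)
    have ey := HasFDerivAt.apply_eq_zero_of_forall_eq_zero hWo huW hy (fun v hv => by
      have := (hτ v hv).2.2.2.2.2
      simp only [Pi.sub_apply, Pi.add_apply, Pi.mul_apply]
      rw [this]
      ring) (0, 1)
    obtain ⟨-, h1, h2⟩ := hch u huW
    rw [two_mul_meanCurvature]
    simp at ex ey
    linear_combination
      (deriv (deriv A) (τ u) * (u.1 ^ 2 + u.2 ^ 2) + deriv (deriv B) (τ u) * u.1 +
        deriv (deriv C) (τ u) * u.2 + deriv (deriv D) (τ u)) * 2⁻¹ * (ex + ey) +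
      (deriv A (τ u) * u.1 + deriv B (τ u) * 2⁻¹) * h1 +
      (deriv A (τ u) * u.2 + deriv C (τ u) * 2⁻¹) * h2
  have hKA : ∀ u ∈ V, A (τ u) ^ 2 - 2 * isotropicMeanCurvature f u * A (τ u) +
      isotropicGaussianCurvature f u = 0 := fun u hu =>
    hpatch.curvature_eq (hWU (hVW u hu)) (hE.isCurve (hτJ u (hVW u hu))) (hτ u (hVW u hu)).2.2.2
  -- the derivative of `N` along the family is parallel to `N`
  have hQN : ∀ u ∈ V, (deriv (deriv A) (τ u) * u.1 + deriv (deriv B) (τ u) * 2⁻¹) *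
      (deriv A (τ u) * u.2 + deriv C (τ u) * 2⁻¹) -
      (deriv (deriv A) (τ u) * u.2 + deriv (deriv C) (τ u) * 2⁻¹) *
      (deriv A (τ u) * u.1 + deriv B (τ u) * 2⁻¹) = 0 := by
    intro u hu
    have huW := hVW u hu
    have hfa := hpatch.analytic u (hWU huW)
    have hHa := analyticAt_meanCurvature hfa
    have hKa := analyticAt_gaussianCurvature hfa
    have hjac := fderiv_wedge_eq_zero hZ hHa hKa (by
      filter_upwards [hVo.mem_nhds hu] with v hv using hW v (hWU (hVW v hv)))
    have dH := hHa.differentiableAt.hasFDerivAt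
    have dK := hKa.differentiableAt.hasFDerivAt
    have h1 := HasFDerivAt.apply_eq_zero_of_forall_eq_zero hVo hu
      ((((dc u huW hA).pow 2).sub ((dH.const_mul 2).mul (dc u huW hA))).add dK) hKA
    have h2 := HasFDerivAt.apply_eq_zero_of_forall_eq_zero hVo hu
      ((((dH.const_mul 2).sub ((dc u huW hA).const_mul 2)).mul (dP u huW)).add
        (((dN₁ u huW).pow 2).add ((dN₂ u huW).pow 2))) hHN
    have k1 := h1 (1, 0)
    have k2 := h1 (0, 1)
    have l1 := h2 (1, 0)
    have l2 := h2 (0, 1)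
    obtain ⟨-, n1, n2⟩ := hch u huW
    have hs := hHN u hu
    have hN := (hball u hu).2
    have hA1 := (hτ u huW).2.1
    simp at k1 k2 l1 l2
    refine wedge_eq_zero_of_weingarten (s := 2 * isotropicMeanCurvature f u - 2 * A (τ u))
      (a := A (τ u)) (A₁ := deriv A (τ u)) (T₁ := fderiv ℝ τ u (1, 0))
      (T₂ := fderiv ℝ τ u (0, 1))
      hjac ?_ ?_ ?_ ?_ hs hN hA1 ?_
    · linear_combination k1
    · linear_combination k2
    · linear_combination n1
    · linear_combination n2
    · linear_combination fderiv ℝ τ u (0, 1) * l1 - fderiv ℝ τ u (1, 0) * l2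
  -- the velocity of the center `-(B', C') / (2A')` of the characteristic circle is proportional to
  -- `(A'B'' - A''B', A'C'' - A''C')`; it is orthogonal to `N`, and differentiating this relation
  -- along the circle shows that it vanishes
  have hvN : ∀ u ∈ V, (deriv A (τ u) * deriv (deriv B) (τ u) -
      deriv (deriv A) (τ u) * deriv B (τ u)) * (deriv A (τ u) * u.1 + deriv B (τ u) * 2⁻¹) +
      (deriv A (τ u) * deriv (deriv C) (τ u) -
      deriv (deriv A) (τ u) * deriv C (τ u)) * (deriv A (τ u) * u.2 + deriv C (τ u) * 2⁻¹) = 0 := by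
    intro u hu
    have huW := hVW u hu
    have h1 := HasFDerivAt.apply_eq_zero_of_forall_eq_zero hVo hu
      (((dQ₁ u huW).mul (dN₂ u huW)).sub ((dQ₂ u huW).mul (dN₁ u huW))) hQN
    have k1 := h1 (1, 0)
    have k2 := h1 (0, 1)
    obtain ⟨-, n1, n2⟩ := hch u huW
    simp at k1 k2
    linear_combination (deriv A (τ u) * deriv (deriv B) (τ u) -
      deriv (deriv A) (τ u) * deriv B (τ u)) * n1 + (deriv A (τ u) * deriv (deriv C) (τ u) -
      deriv (deriv A) (τ u) * deriv C (τ u)) * n2 +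
      (deriv (deriv A) (τ u) * (u.1 ^ 2 + u.2 ^ 2) + deriv (deriv B) (τ u) * u.1 +
        deriv (deriv C) (τ u) * u.2 + deriv (deriv D) (τ u)) *
      (fderiv ℝ τ u (0, 1) * k1 - fderiv ℝ τ u (1, 0) * k2)
  have hv0 : ∀ u ∈ V, deriv A (τ u) * deriv (deriv B) (τ u) -
      deriv (deriv A) (τ u) * deriv B (τ u) = 0 ∧ deriv A (τ u) * deriv (deriv C) (τ u) -
      deriv (deriv A) (τ u) * deriv C (τ u) = 0 := by
    intro u hu
    have huW := hVW u hu
    have h1 := HasFDerivAt.apply_eq_zero_of_forall_eq_zero hVo hu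
      (((((dc u huW hA.deriv).mul (dc u huW hB.deriv.deriv)).sub
        ((dc u huW hA.deriv.deriv).mul (dc u huW hB.deriv))).mul (dN₁ u huW)).add
        ((((dc u huW hA.deriv).mul (dc u huW hC.deriv.deriv)).sub
        ((dc u huW hA.deriv.deriv).mul (dc u huW hC.deriv))).mul (dN₂ u huW))) hvN
    have k1 := h1 (1, 0)
    have k2 := h1 (0, 1)
    have hvNu := hvN u hu
    obtain ⟨-, n1, n2⟩ := hch u huW
    have hP := hPT u hu
    have hA1 := (hτ u huW).2.1
    simp at k1 k2
    have hN := (hball u hu).2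
    set T₁ := fderiv ℝ τ u (1, 0)
    set T₂ := fderiv ℝ τ u (0, 1)
    have hT : T₁ ^ 2 + T₂ ^ 2 ≠ 0 := by
      intro h0
      obtain ⟨e1, e2⟩ := (add_eq_zero_iff_of_nonneg (sq_nonneg _) (sq_nonneg _)).1 h0
      rw [pow_eq_zero_iff two_ne_zero] at e1 e2
      rw [e1] at n1
      rw [e2] at n2
      exact hN ⟨by linear_combination n1, by linear_combination n2⟩
    set V₁ := deriv A (τ u) * deriv (deriv B) (τ u) - deriv (deriv A) (τ u) * deriv B (τ u)
    set V₂ := deriv A (τ u) * deriv (deriv C) (τ u) - deriv (deriv A) (τ u) * deriv C (τ u)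
    have hX : deriv A (τ u) * (V₁ * T₂ - V₂ * T₁) = 0 := by
      linear_combination T₂ * k1 - T₁ * k2
    replace hX := (mul_eq_zero.1 hX).resolve_left hA1
    have hY := (mul_eq_zero.1 (show _ * (V₁ * T₁ + V₂ * T₂) = 0 by
      linear_combination V₁ * n1 + V₂ * n2 - hvNu)).resolve_left hP
    constructor
    · refine (mul_eq_zero.1 (?_ : (T₁ ^ 2 + T₂ ^ 2) * V₁ = 0)).resolve_left hT
      linear_combination T₁ * hY + T₂ * hX
    · refine (mul_eq_zero.1 (?_ : (T₁ ^ 2 + T₂ ^ 2) * V₂ = 0)).resolve_left hT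
      linear_combination T₂ * hY - T₁ * hX
  -- `τ` takes infinitely many values near `τ u₀`
  have hτc : ContinuousOn τ V := fun u hu =>
    (hτ u (hVW u hu)).2.2.1.continuousAt.continuousWithinAt
  have hpre : IsPreconnected (τ '' V) := (convex_ball u₀ r).isPreconnected.image τ hτc
  have hnt : (τ '' V).Nontrivial := by
    by_contra hc
    rw [Set.not_nontrivial_iff] at hc
    refine hE.not_contact_on_open hpatch hVo (fun u hu => hWU (hVW u hu)) ⟨u₀, hu₀V⟩
      (hτJ u₀ hu₀) fun u hu => ?_
    have := (hτ u (hVW u hu)).2.2.2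
    rwa [hc ⟨u, hu, rfl⟩ ⟨u₀, hu₀V, rfl⟩] at this
  have hacc := accPt_iff_frequently_nhdsNE.1
    (hpre.preperfect_of_nontrivial hnt (τ u₀) ⟨u₀, hu₀V, rfl⟩)
  have hB0 := (hA.deriv.mul hB.deriv.deriv).sub (hA.deriv.deriv.mul hB.deriv)
    |>.eqOn_zero_of_preconnected_of_frequently_eq_zero hJ.isPreconnected (hτJ u₀ hu₀)
    (hacc.mono (by rintro - ⟨u, hu, rfl⟩; exact (hv0 u hu).1))
  have hC0 := (hA.deriv.mul hC.deriv.deriv).sub (hA.deriv.deriv.mul hC.deriv)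
    |>.eqOn_zero_of_preconnected_of_frequently_eq_zero hJ.isPreconnected (hτJ u₀ hu₀)
    (hacc.mono (by rintro - ⟨u, hu, rfl⟩; exact (hv0 u hu).2))
  obtain ⟨m₁, n₁, h1⟩ := exists_affine_of_deriv_proportional hJ hA hB (hτ u₀ hu₀).1
    (hτ u₀ hu₀).2.1 hB0
  obtain ⟨m₂, n₂, h2⟩ := exists_affine_of_deriv_proportional hJ hA hC (hτ u₀ hu₀).1
    (hτ u₀ hu₀).2.1 hC0
  exact ⟨m₁, n₁, m₂, n₂, fun t ht => ⟨h1 t ht, h2 t ht⟩⟩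

/-! ### Envelopes of concentric families are invariant under rotations -/

theorem exists_cos_sin_of_sq_add_sq {x y r : ℝ} (hr : 0 ≤ r) (h : x ^ 2 + y ^ 2 = r ^ 2) :
    ∃ θ : ℝ, x = r * Real.cos θ ∧ y = r * Real.sin θ := by
  have hn : ‖(⟨x, y⟩ : ℂ)‖ = r := by
    rw [Complex.norm_def, Complex.normSq_mk, ← sq, ← sq, h, Real.sqrt_sq hr]
  refine ⟨Complex.arg ⟨x, y⟩, ?_, ?_⟩
  · rw [← hn, Complex.norm_mul_cos_arg]
  · rw [← hn, Complex.norm_mul_sin_arg]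

/-- A function whose derivative along the rotations about `(c₁, c₂)` vanishes depends locally only
on the distance to `(c₁, c₂)`. -/
theorem exists_nhds_eq_of_radial {ψ : ℝ × ℝ → ℝ} {c₁ c₂ : ℝ} {u₀ : ℝ × ℝ}
    (hu₀ : 0 < (u₀.1 - c₁) ^ 2 + (u₀.2 - c₂) ^ 2)
    (hψ : ∀ᶠ u in 𝓝 u₀, DifferentiableAt ℝ ψ u ∧
      -(u.2 - c₂) * fderiv ℝ ψ u (1, 0) + (u.1 - c₁) * fderiv ℝ ψ u (0, 1) = 0) :
    ∃ N : Set (ℝ × ℝ), IsOpen N ∧ u₀ ∈ N ∧ ∀ u ∈ N, ∀ v ∈ N,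
      (u.1 - c₁) ^ 2 + (u.2 - c₂) ^ 2 = (v.1 - c₁) ^ 2 + (v.2 - c₂) ^ 2 → ψ u = ψ v := by
  obtain ⟨θ₀, h1, h2⟩ := exists_cos_sin_of_sq_add_sq (Real.sqrt_nonneg _)
    (Real.sq_sqrt hu₀.le).symm
  set a₀ := Real.log √((u₀.1 - c₁) ^ 2 + (u₀.2 - c₂) ^ 2) with ha₀
  rw [← Real.exp_log (Real.sqrt_pos.2 hu₀), ← ha₀] at h1 h2
  -- polar coordinates around `(c₁, c₂)`, with the logarithm of the radius
  let P : ℝ × ℝ → ℝ × ℝ := fun w =>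
    (c₁ + Real.exp w.1 * Real.cos w.2, c₂ + Real.exp w.1 * Real.sin w.2)
  have hP₀ : P (a₀, θ₀) = u₀ := Prod.ext (by simp [P, ← h1]) (by simp [P, ← h2])
  have dfst : HasStrictFDerivAt (fun w : ℝ × ℝ => w.1) (ContinuousLinearMap.fst ℝ ℝ ℝ) (a₀, θ₀) :=
    hasStrictFDerivAt_fst
  have dsnd : HasStrictFDerivAt (fun w : ℝ × ℝ => w.2) (ContinuousLinearMap.snd ℝ ℝ ℝ) (a₀, θ₀) :=
    hasStrictFDerivAt_snd
  have hP : HasStrictFDerivAt P _ (a₀, θ₀) :=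
    ((dfst.exp.mul dsnd.cos).const_add c₁).prodMk ((dfst.exp.mul dsnd.sin).const_add c₂)
  have hmap := hP.map_nhds_eq_of_surj (by
    rw [LinearMap.range_eq_top]
    rintro ⟨x, y⟩
    have hcs := Real.sin_sq_add_cos_sq θ₀
    have he := Real.exp_ne_zero a₀
    refine ⟨((x * Real.cos θ₀ + y * Real.sin θ₀) / Real.exp a₀,
      (y * Real.cos θ₀ - x * Real.sin θ₀) / Real.exp a₀), ?_⟩
    ext
    · simp
      field_simp
      linear_combination x * hcs
    · simp
      field_simp
      linear_combination y * hcs)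
  rw [hP₀] at hmap
  have hψ' := hψ
  rw [← hmap, eventually_map] at hψ'
  obtain ⟨r, hr, hball⟩ := Metric.eventually_nhds_iff_ball.1 hψ'
  have hmem : P '' Metric.ball (a₀, θ₀) r ∈ 𝓝 u₀ := by
    rw [← hmap]
    exact image_mem_map (Metric.ball_mem_nhds _ hr)
  obtain ⟨N, hN, hNo, huN⟩ := mem_nhds_iff.1 hmem
  refine ⟨N, hNo, huN, fun u hu v hv huv => ?_⟩
  obtain ⟨⟨a, θ⟩, hw, rfl⟩ := hN hu
  obtain ⟨⟨a', θ'⟩, hw', rfl⟩ := hN hv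
  have haa : a = a' := by
    have e : ∀ a θ : ℝ, ((P (a, θ)).1 - c₁) ^ 2 + ((P (a, θ)).2 - c₂) ^ 2 = Real.exp a ^ 2 := by
      intro a θ
      simp only [P, add_sub_cancel_left]
      linear_combination Real.exp a ^ 2 * Real.sin_sq_add_cos_sq θ
    rw [e, e, sq_eq_sq₀ (Real.exp_pos _).le (Real.exp_pos _).le] at huv
    exact Real.exp_injective huv
  subst haa
  rw [← ball_prod_same] at hw hw'
  have hder : ∀ s ∈ Metric.ball θ₀ r,
      HasDerivWithinAt (fun s => ψ (P (a, s))) 0 (Metric.ball θ₀ r) s := by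
    intro s hs
    obtain ⟨hd, h0⟩ := hball (a, s) (by rw [← ball_prod_same]; exact ⟨hw.1, hs⟩)
    have hc : HasDerivAt (fun s => P (a, s)) (-(Real.exp a * Real.sin s),
        Real.exp a * Real.cos s) s := by
      have e1 := ((Real.hasDerivAt_cos s).const_mul (Real.exp a)).const_add c₁
      have e2 := ((Real.hasDerivAt_sin s).const_mul (Real.exp a)).const_add c₂
      rw [mul_neg] at e1
      exact e1.prodMk e2
    have := hd.hasFDerivAt.comp_hasDerivAt s hc
    convert! this.hasDerivWithinAt using 1
    have hdec : ((-(Real.exp a * Real.sin s), Real.exp a * Real.cos s) : ℝ × ℝ) =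
        (-(Real.exp a * Real.sin s)) • ((1, 0) : ℝ × ℝ) +
          (Real.exp a * Real.cos s) • ((0, 1) : ℝ × ℝ) := by ext <;> simp
    rw [hdec, map_add, map_smul, map_smul, smul_eq_mul, smul_eq_mul]
    refine h0.symm.trans ?_
    simp only [P, add_sub_cancel_left]
  have := (convex_ball θ₀ r).norm_image_sub_le_of_norm_hasDerivWithin_le (C := 0) hder (by simp)
    hw.2 hw'.2
  simp only [zero_mul, norm_le_zero_iff, sub_eq_zero] at this
  exact this.symm

/-- The squared distance of the top view of `p` to the point `(c₁, c₂)`. -/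
def topDistSq (c₁ c₂ : ℝ) (p : Space) : ℝ := (p.1 - c₁) ^ 2 + (p.2.1 - c₂) ^ 2

theorem continuous_topDistSq (c₁ c₂ : ℝ) : Continuous (topDistSq c₁ c₂) := by
  unfold topDistSq
  fun_prop

section Concentric

variable {M : Set Space} {J : Set ℝ} {A B C D : ℝ → ℝ} {c₁ c₂ n₁ n₂ : ℝ}

/-- If the curve of contact changed its distance to the common axis of the family, the contact would
propagate to an open piece of the surface, because both surfaces are locally invariant under the
rotations about that axis. -/
theorem IsAnalyticEnvelope.eventually_topDistSq_eq (hE : IsAnalyticEnvelope M J A B C D)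
    (hloc : ∀ p ∈ M, ∃ f, IsLocalGraph M p f)
    (hBC : ∀ t ∈ J, B t = -2 * c₁ * A t + n₁ ∧ C t = -2 * c₂ * A t + n₂) {t : ℝ} (ht : t ∈ J)
    {p : Space} (hp : TouchesAt M (parabolicSphere (A t) (B t) (C t) (D t)) p)
    (hp0 : 0 < topDistSq c₁ c₂ p) :
    ∀ᶠ q in 𝓝[{p | TouchesAt M (parabolicSphere (A t) (B t) (C t) (D t)) p}] p,
      topDistSq c₁ c₂ q = topDistSq c₁ c₂ p := by
  obtain ⟨f, hfa, hfM⟩ := hloc p hp.1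
  rw [eventually_nhdsWithin_iff] at hfM
  obtain ⟨r, hr, hball⟩ := Metric.eventually_nhds_iff_ball.1 hfa.eventually_analyticAt
  set V := Metric.ball (topView p) r
  have hVa : AnalyticOnNhd ℝ f V := hball
  have hVc : IsPreconnected V := (convex_ball (topView p) r).isPreconnected
  obtain ⟨U, hUV, hUne, hU⟩ := exists_isGraphPatch hE.1 hp.1 ⟨hfa, eventually_nhdsWithin_iff.2 hfM⟩
    (Metric.ball_mem_nhds (topView p) hr)
  obtain ⟨u₁, hu₁⟩ := id hUne
  have hfe : ∀ e, AnalyticOnNhd ℝ (fun u => fderiv ℝ f u e) V := fun e u hu =>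
    ((ContinuousLinearMap.apply ℝ ℝ e).analyticAt _).comp (hVa u hu).fderiv
  -- up to a linear function, `f` is invariant under rotations about `(c₁, c₂)`: this holds over `U`
  -- by the contact conditions, and on `V` by analyticity
  have hrad : ∀ u ∈ V, -(u.2 - c₂) * (fderiv ℝ f u (1, 0) - n₁ / 2) +
      (u.1 - c₁) * (fderiv ℝ f u (0, 1) - n₂ / 2) = 0 := by
    have han : AnalyticOnNhd ℝ (fun u => -(u.2 - c₂) * (fderiv ℝ f u (1, 0) - n₁ / 2) +
      (u.1 - c₁) * (fderiv ℝ f u (0, 1) - n₂ / 2)) V := fun u hu =>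
      ((analyticAt_snd.sub analyticAt_const).neg.mul ((hfe _ u hu).sub analyticAt_const)).add
      ((analyticAt_fst.sub analyticAt_const).mul ((hfe _ u hu).sub analyticAt_const))
    refine han.eqOn_zero_of_preconnected_of_eventuallyEq_zero hVc (hUV hu₁) ?_
    filter_upwards [hU.isOpen.mem_nhds hu₁] with u hu
    obtain ⟨s, hs, -, h1, h2⟩ := hE.exists_contact hU hu
    rw [h1, h2, (hBC s hs).1, (hBC s hs).2, Pi.zero_apply]
    ring
  set φ := sphereHeight (A t) (B t) (C t) (D t) with hφ
  have hφd := hasFDerivAt_sphereHeight (A t) (B t) (C t) (D t)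
  have hψa : AnalyticOnNhd ℝ (fun u => f u - φ u) V :=
    hVa.sub (analyticOnNhd_sphereHeight _ _ _ _ _)
  have hψd : ∀ u ∈ V, HasFDerivAt (fun u => f u - φ u) (fderiv ℝ f u - _) u := fun u hu =>
    (hVa u hu).differentiableAt.hasFDerivAt.sub (hφd u)
  obtain ⟨N, hNo, hpN, hN⟩ := exists_nhds_eq_of_radial (ψ := fun u => f u - φ u) (c₁ := c₁)
    (c₂ := c₂) (u₀ := topView p) hp0 (by
      filter_upwards [Metric.ball_mem_nhds (topView p) hr] with u hu
      refine ⟨(hψd u hu).differentiableAt, ?_⟩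
      rw [(hψd u hu).fderiv]
      simp [(hBC t ht).1, (hBC t ht).2]
      linear_combination hrad u hu)
  have htv : Continuous topView := by unfold topView; fun_prop
  obtain ⟨γ, ε, hε, hγc, -, hγ0, hγ, hγn⟩ := (hE.isCurve ht).exists_param hp
    (Filter.Eventually.and hfM (htv.continuousAt.eventually ((hNo.inter
      (Metric.isOpen_ball (x := topView p) (ε := r))).mem_nhds ⟨hpN, Metric.mem_ball_self hr⟩)))
  have hγψ : ∀ s ∈ Set.Ioo (-ε) ε, f (topView (γ s)) - φ (topView (γ s)) = 0 := by
    intro s hs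
    obtain ⟨hc, hfs, -⟩ := hγ s hs
    have e := mem_parabolicSphere_iff.1 hc.2.1
    rw [hfs hc.1] at e
    exact sub_eq_zero.2 e
  have h0 : (0 : ℝ) ∈ Set.Ioo (-ε) ε := by simpa
  suffices h : ∀ s ∈ Set.Ioo (-ε) ε, topDistSq c₁ c₂ (γ s) = topDistSq c₁ c₂ p by
    refine mem_of_superset hγn ?_
    rintro - ⟨s, hs, rfl⟩
    exact h s hs
  intro s₁ hs₁
  by_contra hne
  have hsub : Set.uIcc 0 s₁ ⊆ Set.Ioo (-ε) ε := Set.ordConnected_Ioo.uIcc_subset h0 hs₁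
  have hcont : ContinuousOn (fun s => topDistSq c₁ c₂ (γ s)) (Set.uIcc 0 s₁) :=
    (continuous_topDistSq c₁ c₂).comp_continuousOn (hγc.mono hsub)
  have hivt := intermediate_value_uIcc hcont
  simp only [hγ0] at hivt
  set x := topDistSq c₁ c₂ p
  set y := topDistSq c₁ c₂ (γ s₁)
  have hmid : (x + y) / 2 ∈ Set.Ioo (min x y) (max x y) := by
    rcases lt_or_gt_of_ne hne with h | h
    · rw [min_eq_right h.le, max_eq_left h.le]; constructor <;> linarith
    · rw [min_eq_left h.le, max_eq_right h.le]; constructor <;> linarith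
  obtain ⟨s', hs', hs'x⟩ := hivt (Set.Ioo_subset_Icc_self hmid)
  have hs'N := (hγ s' (hsub hs')).2.2
  -- the circles through the points near `γ s'` meet the curve `γ`, on which `f = φ`
  have hzero : ∀ᶠ u in 𝓝 (topView (γ s')), f u - φ u = 0 := by
    have hcu : Continuous fun u : ℝ × ℝ => (u.1 - c₁) ^ 2 + (u.2 - c₂) ^ 2 := by fun_prop
    filter_upwards [hNo.mem_nhds hs'N.1, hcu.continuousAt.eventually
      (Ioo_mem_nhds (hs'x.symm ▸ hmid.1) (hs'x.symm ▸ hmid.2))] with u hu hux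
    obtain ⟨s, hs, hsx⟩ := hivt (Set.Ioo_subset_Icc_self hux)
    rw [← hγψ s (hsub hs)]
    exact hN u hu _ (hγ s (hsub hs)).2.2.1 hsx.symm
  have hall := hψa.eqOn_zero_of_preconnected_of_eventuallyEq_zero hVc hs'N.2 hzero
  refine hE.not_contact_on_open hU hU.isOpen subset_rfl hUne ht fun u hu => ?_
  have h1 := sub_eq_zero.1 (hall (hUV hu))
  have h2 := (hφd u).fderiv
  rw [← hφ, ← Filter.EventuallyEq.fderiv_eq (f₁ := f)] at h2
  swap
  · filter_upwards [hU.isOpen.mem_nhds hu] with v hv using sub_eq_zero.1 (hall (hUV hv))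
  exact ⟨h1, by simp [h2], by simp [h2]⟩

theorem IsAnalyticEnvelope.exists_topDistSq_eq (hE : IsAnalyticEnvelope M J A B C D)
    (hloc : ∀ p ∈ M, ∃ f, IsLocalGraph M p f)
    (hBC : ∀ t ∈ J, B t = -2 * c₁ * A t + n₁ ∧ C t = -2 * c₂ * A t + n₂) {t : ℝ} (ht : t ∈ J) :
    ∃ R > 0, ∀ q, TouchesAt M (parabolicSphere (A t) (B t) (C t) (D t)) q →
      topDistSq c₁ c₂ q = R := by
  have hcurve := hE.isCurve ht
  set c := {p | TouchesAt M (parabolicSphere (A t) (B t) (C t) (D t)) p} with hc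
  -- the paraboloid has a single point over `(c₁, c₂)`, and the curve has no isolated points
  obtain ⟨p, hpc, hp0⟩ : ∃ p ∈ c, 0 < topDistSq c₁ c₂ p := by
    by_contra! hcon
    obtain ⟨p, hp⟩ := hcurve.2.1.nonempty
    have htop : ∀ q ∈ c, topView q = (c₁, c₂) := by
      intro q hq
      have h0 : (q.1 - c₁) ^ 2 + (q.2.1 - c₂) ^ 2 = 0 :=
        le_antisymm (hcon q hq) (by positivity)
      obtain ⟨e1, e2⟩ := (add_eq_zero_iff_of_nonneg (sq_nonneg _) (sq_nonneg _)).1 h0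
      rw [pow_eq_zero_iff two_ne_zero, sub_eq_zero] at e1 e2
      exact Prod.ext e1 e2
    obtain ⟨q, hq, hqp⟩ := ((hcurve.frequently_mem hp).and_eventually self_mem_nhdsWithin).exists
    refine hqp ?_
    have e1 := htop q hq
    have e2 := htop p hp
    have e3 := mem_parabolicSphere_iff.1 hq.2.1
    have e4 := mem_parabolicSphere_iff.1 hp.2.1
    rw [e1] at e3
    rw [e2] at e4
    have e5 := Prod.ext_iff.1 (e1.trans e2.symm)
    exact Prod.ext e5.1 (Prod.ext e5.2 (e3.trans e4.symm))
  refine ⟨_, hp0, fun q hq => ?_⟩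
  have : PreconnectedSpace c := Subtype.preconnectedSpace hcurve.2.1.isPreconnected
  have hclopen : IsClopen {q : c | topDistSq c₁ c₂ q = topDistSq c₁ c₂ p} := by
    refine ⟨isClosed_eq ((continuous_topDistSq c₁ c₂).comp continuous_subtype_val)
      continuous_const, isOpen_iff_mem_nhds.2 fun q hq => ?_⟩
    have hq' : topDistSq c₁ c₂ q = topDistSq c₁ c₂ p := hq
    have := hE.eventually_topDistSq_eq hloc hBC ht q.2 (by rw [hq']; exact hp0)
    rw [hq'] at this
    rw [nhds_subtype_eq_comap_nhdsWithin]
    exact preimage_mem_comap this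
  have huniv := hclopen.eq_univ ⟨⟨p, hpc⟩, rfl⟩
  exact (huniv ▸ Set.mem_univ (⟨q, hq⟩ : c) :)

/-- The curves of contact are full circles in the top view: a curve without endpoints contained in
a circle is open and closed in this circle. -/
theorem IsCurveWithoutEndpoints.mem_of_circle {c : Set Space} (hc : IsCurveWithoutEndpoints c)
    {φ : ℝ × ℝ → ℝ} (hφ : Continuous φ) {R : ℝ} (hR : 0 < R)
    (hsub : ∀ q ∈ c, q.2.2 = φ (topView q) ∧ topDistSq c₁ c₂ q = R) {q : Space}
    (hq : q.2.2 = φ (topView q)) (hqR : topDistSq c₁ c₂ q = R) : q ∈ c := by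
  set r := √R with hr
  have hr0 : 0 < r := Real.sqrt_pos.2 hR
  have hrR : r ^ 2 = R := Real.sq_sqrt hR.le
  let P : ℝ → Space := fun θ => (c₁ + r * Real.cos θ, c₂ + r * Real.sin θ,
    φ (c₁ + r * Real.cos θ, c₂ + r * Real.sin θ))
  have hPc : Continuous P := by
    have : Continuous fun θ : ℝ => (c₁ + r * Real.cos θ, c₂ + r * Real.sin θ) := by fun_prop
    have := hφ.comp this
    fun_prop
  have hP : ∀ q : Space, q.2.2 = φ (topView q) → topDistSq c₁ c₂ q = R → ∃ θ, P θ = q := by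
    intro q hq hqR
    obtain ⟨θ, h1, h2⟩ := exists_cos_sin_of_sq_add_sq hr0.le
      (show (q.1 - c₁) ^ 2 + (q.2.1 - c₂) ^ 2 = r ^ 2 by rw [hrR]; exact hqR)
    have e1 : c₁ + r * Real.cos θ = q.1 := by rw [← h1]; ring
    have e2 : c₂ + r * Real.sin θ = q.2.1 := by rw [← h2]; ring
    exact ⟨θ, by simp only [P, e1, e2]; exact Prod.ext rfl (Prod.ext rfl hq.symm)⟩
  have hclopen : IsClopen (P ⁻¹' c) := by
    refine ⟨hc.1.preimage hPc, isOpen_iff_mem_nhds.2 fun θ₀ hθ₀ => ?_⟩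
    let dt : Space → ℝ := fun q => (q.1 - c₁) * Real.cos θ₀ + (q.2.1 - c₂) * Real.sin θ₀
    let ℓ : Space → ℝ := fun q => -(q.1 - c₁) * Real.sin θ₀ + (q.2.1 - c₂) * Real.cos θ₀
    have hdt : Continuous dt := by fun_prop
    have hℓ : Continuous ℓ := by fun_prop
    have hsc := Real.sin_sq_add_cos_sq θ₀
    have hsq : ∀ q, dt q ^ 2 + ℓ q ^ 2 = topDistSq c₁ c₂ q := fun q => by
      simp only [dt, ℓ, topDistSq]
      linear_combination ((q.1 - c₁) ^ 2 + (q.2.1 - c₂) ^ 2) * hsc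
    -- on the half of the circle around `P θ₀`, the coordinate `ℓ` determines the point
    have hinj : ∀ q q' : Space, q.2.2 = φ (topView q) → topDistSq c₁ c₂ q = R → 0 < dt q →
        q'.2.2 = φ (topView q') → topDistSq c₁ c₂ q' = R → 0 < dt q' → ℓ q = ℓ q' → q = q' := by
      intro q q' h1 h2 h3 h1' h2' h3' h
      have e : dt q = dt q' := by
        have h4 := hsq q
        have h5 := hsq q'
        rw [h2, h] at h4
        rw [h2'] at h5
        exact (sq_eq_sq₀ h3.le h3'.le).1 (by linarith)
      have e1 : q.1 = q'.1 := by
        simp only [dt, ℓ] at e h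
        linear_combination Real.cos θ₀ * e - Real.sin θ₀ * h - (q.1 - q'.1) * hsc
      have e2 : q.2.1 = q'.2.1 := by
        simp only [dt, ℓ] at e h
        linear_combination Real.sin θ₀ * e + Real.cos θ₀ * h - (q.2.1 - q'.2.1) * hsc
      refine Prod.ext e1 (Prod.ext e2 ?_)
      rw [h1, h1', topView, topView, e1, e2]
    have hPdt : dt (P θ₀) = r := by
      simp only [dt, P]
      linear_combination r * hsc
    have hPℓ : ℓ (P θ₀) = 0 := by
      simp only [ℓ, P]
      ring
    have hdtP : ∀ᶠ q in 𝓝 (P θ₀), 0 < dt q :=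
      hdt.continuousAt.eventually (lt_mem_nhds (by rw [hPdt]; exact hr0))
    obtain ⟨γ, ε, hε, hγc, hγi, hγ0, hγ, -⟩ := hc.exists_param hθ₀ hdtP
    have hγℓ : Set.InjOn (fun s => ℓ (γ s)) (Set.Ioo (-ε) ε) := by
      intro s hs s' hs' h
      obtain ⟨h1, h2⟩ := hγ s hs
      obtain ⟨h1', h2'⟩ := hγ s' hs'
      exact hγi hs hs' (hinj _ _ (hsub _ h1).1 (hsub _ h1).2 h2 (hsub _ h1').1 (hsub _ h1').2 h2' h)
    have hγℓc : ContinuousOn (fun s => ℓ (γ s)) (Set.Ioo (-ε) ε) := hℓ.comp_continuousOn hγc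
    have h0 : (0 : ℝ) ∈ Set.Ioo (-ε) ε := by simpa
    have hm : -ε / 2 ∈ Set.Ioo (-ε) ε := by constructor <;> linarith
    have hp : ε / 2 ∈ Set.Ioo (-ε) ε := by constructor <;> linarith
    have hsub' : Set.uIcc (-ε / 2) (ε / 2) ⊆ Set.Ioo (-ε) ε :=
      Set.ordConnected_Ioo.uIcc_subset hm hp
    have hivt := intermediate_value_uIcc (hγℓc.mono hsub')
    have hnhds : Set.uIcc (ℓ (γ (-ε / 2))) (ℓ (γ (ε / 2))) ∈ 𝓝 (0 : ℝ) := by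
      rw [← hPℓ, ← hγ0]
      rcases hγℓc.strictMonoOn_of_injOn_Ioo (by linarith) hγℓ with h | h
      · rw [Set.uIcc_of_le (h.monotoneOn hm hp (by linarith))]
        exact Icc_mem_nhds (h hm h0 (by linarith)) (h h0 hp (by linarith))
      · rw [Set.uIcc_of_ge (h.antitoneOn hm hp (by linarith))]
        exact Icc_mem_nhds (h h0 hp (by linarith)) (h hm h0 (by linarith))
    rw [← hPℓ] at hnhds
    filter_upwards [(hℓ.comp hPc).continuousAt.eventually hnhds,
      hPc.continuousAt.eventually hdtP] with θ hθ hθ'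
    obtain ⟨s, hs, hsθ⟩ := hivt hθ
    obtain ⟨h1, h2⟩ := hγ s (hsub' hs)
    have hPR : topDistSq c₁ c₂ (P θ) = R := by
      simp only [topDistSq, P]
      linear_combination r ^ 2 * Real.sin_sq_add_cos_sq θ + hrR
    have := hinj (γ s) (P θ) (hsub _ h1).1 (hsub _ h1).2 h2 rfl hPR hθ' hsθ
    rw [Set.mem_preimage, ← this]
    exact h1
  obtain ⟨p, hp⟩ := hc.2.1.nonempty
  obtain ⟨θ₁, h₁⟩ := hP p (hsub p hp).1 (hsub p hp).2
  have huniv := hclopen.eq_univ ⟨θ₁, by rw [Set.mem_preimage, h₁]; exact hp⟩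
  obtain ⟨θ, rfl⟩ := hP q hq hqR
  exact (huniv ▸ Set.mem_univ θ : θ ∈ P ⁻¹' c)

theorem IsAnalyticEnvelope.isIsotropicRotational (hE : IsAnalyticEnvelope M J A B C D)
    (hloc : ∀ p ∈ M, ∃ f, IsLocalGraph M p f)
    (hBC : ∀ t ∈ J, B t = -2 * c₁ * A t + n₁ ∧ C t = -2 * c₂ * A t + n₂) :
    IsIsotropicRotational M := by
  let T : Space → Space := fun p => (p.1 + c₁, p.2.1 + c₂, n₁ / 2 * p.1 + n₂ / 2 * p.2.1 + p.2.2)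
  have hrot : ∀ (φ : ℝ) (p : Space), T p ∈ M → T (zRotation φ p) ∈ M := by
    intro φ p hp
    obtain ⟨t, ht, hpt⟩ := hE.2.2.2.2.2.2.2.2 _ hp
    obtain ⟨R, hR, hRq⟩ := hE.exists_topDistSq_eq hloc hBC ht
    have hcs := Real.sin_sq_add_cos_sq φ
    have hrad : (zRotation φ p).1 ^ 2 + (zRotation φ p).2.1 ^ 2 = p.1 ^ 2 + p.2.1 ^ 2 := by
      simp only [zRotation]
      linear_combination (p.1 ^ 2 + p.2.1 ^ 2) * hcs
    have hz := mem_parabolicSphere_iff.1 hpt.2.1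
    have hRp := hRq _ hpt
    simp only [T, topView, sphereHeight, topDistSq, (hBC t ht).1, (hBC t ht).2] at hz hRp
    refine (IsCurveWithoutEndpoints.mem_of_circle (c₁ := c₁) (c₂ := c₂)
      (φ := sphereHeight (A t) (B t) (C t) (D t)) (hE.isCurve ht)
      (by unfold sphereHeight; fun_prop) hR
      (fun q hq => ⟨mem_parabolicSphere_iff.1 hq.2.1, hRq q hq⟩)
      (q := T (zRotation φ p)) ?_ ?_).1
    · simp only [T, topView, sphereHeight, (hBC t ht).1, (hBC t ht).2]
      have hzz : (zRotation φ p).2.2 = p.2.2 := rfl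
      rw [hzz]
      linear_combination hz - A t / 2 * hrad
    · simp only [T, topDistSq]
      linear_combination hRp + hrad
  refine ⟨hE.1, T, T ⁻¹' M, ⟨0, n₁ / 2, n₂ / 2, c₁, c₂, 0, fun x y z => ?_⟩, fun φ => ?_, ?_⟩
  · simp [T]
  · refine Set.Subset.antisymm ?_ fun p hp => ?_
    · rintro - ⟨p, hp, rfl⟩
      exact hrot φ p hp
    · refine ⟨zRotation (-φ) p, hrot _ _ hp, ?_⟩
      have hcs := Real.sin_sq_add_cos_sq φ
      ext
      · simp only [zRotation, Real.cos_neg, Real.sin_neg]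
        linear_combination p.1 * hcs
      · simp only [zRotation, Real.cos_neg, Real.sin_neg]
        linear_combination p.2.1 * hcs
      · rfl
  · rw [Set.image_preimage_eq]
    intro q
    refine ⟨(q.1 - c₁, q.2.1 - c₂, q.2.2 - n₁ / 2 * (q.1 - c₁) - n₂ / 2 * (q.2.1 - c₂)), ?_⟩
    ext
    · simp [T]
    · simp [T]
    · simp only [T]; ring

end Concentric

/-! ### Channel surfaces of non-constant radius -/

theorem IsGraphPatch.hessianMatrix_eq {M : Set Space} {f g : ℝ × ℝ → ℝ} {U : Set (ℝ × ℝ)}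
    (h : IsGraphPatch M f U) {u : ℝ × ℝ} (hu : u ∈ U) (hg : IsLocalGraph M (u.1, u.2, f u) g) :
    hessianMatrix g u = hessianMatrix f u :=
  hessianMatrix_congr (h.eventuallyEq hu hg)

theorem IsAnalyticEnvelope.isIsotropicRotational_of_curvatures {M : Set Space} {J : Set ℝ}
    {A B C D : ℝ → ℝ} (hE : IsAnalyticEnvelope M J A B C D) (hne : ∃ s ∈ J, ∃ t ∈ J, A s ≠ A t)
    {Z : Set (ℝ × ℝ)} (hZ : ∀ w, Z ∉ 𝓝 w)
    (hW : ∀ p ∈ M, ∃ f, IsLocalGraph M p f ∧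
      (isotropicMeanCurvature f (topView p), isotropicGaussianCurvature f (topView p)) ∈ Z) :
    IsIsotropicRotational M := by
  obtain ⟨s, hs, -⟩ := id hne
  obtain ⟨p, hp⟩ := (hE.isCurve hs).2.1.nonempty
  obtain ⟨f, hf, -⟩ := hW p hp.1
  obtain ⟨U, -, hU, hpatch⟩ := exists_isGraphPatch hE.1 hp.1 hf univ_mem
  have hWU : ∀ u ∈ U, (isotropicMeanCurvature f u, isotropicGaussianCurvature f u) ∈ Z := by
    intro u hu
    obtain ⟨g, hg, hgZ⟩ := hW _ (hpatch.mem hu)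
    have hH := hpatch.hessianMatrix_eq hu hg
    unfold isotropicMeanCurvature isotropicGaussianCurvature at hgZ ⊢
    rwa [← hH]
  obtain ⟨m₁, n₁, m₂, n₂, h⟩ := hE.exists_center hne hpatch hU hZ hWU
  refine hE.isIsotropicRotational (c₁ := -m₁ / 2) (c₂ := -m₂ / 2) (n₁ := n₁) (n₂ := n₂)
    (fun p hp => (hW p hp).imp fun f hf => hf.1) fun t ht => ?_
  obtain ⟨h1, h2⟩ := h t ht
  exact ⟨by rw [h1]; ring, by rw [h2]; ring⟩

theorem IsAnalyticPlaneCurve.notMem_nhds {Z : Set (ℝ × ℝ)} (hZ : IsAnalyticPlaneCurve Z)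
    (w : ℝ × ℝ) : Z ∉ 𝓝 w := by
  intro h
  obtain ⟨-, g, -, hfr, hg⟩ := hZ w (mem_of_mem_nhds h)
  refine hfr ?_
  filter_upwards [h, hg] with v hv hv' hne
  exact hne (hv'.1 hv)

/-! ### Surfaces with a constant ratio of principal curvatures -/

theorem ArePrincipalCurvatures.eq_curvatures {f : ℝ × ℝ → ℝ} {u : ℝ × ℝ} {κ₁ κ₂ : ℝ}
    (h : ArePrincipalCurvatures f u κ₁ κ₂) :
    2 * isotropicMeanCurvature f u = κ₁ + κ₂ ∧ isotropicGaussianCurvature f u = κ₁ * κ₂ := by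
  unfold ArePrincipalCurvatures at h
  have hs : (hessianMatrix f u).charpoly.Splits := by
    rw [Polynomial.splits_iff_card_roots, h, Matrix.charpoly_natDegree_eq_dim]
    simp
  unfold isotropicMeanCurvature isotropicGaussianCurvature
  rw [Matrix.trace_eq_sum_roots_charpoly_of_splits hs,
    Matrix.det_eq_prod_roots_charpoly_of_splits hs, h]
  simp
  ring

theorem HasConstantCurvatureRatio.exists_curvature {M : Set Space} {a : ℝ}
    (h : HasConstantCurvatureRatio M a) {p : Space} (hp : p ∈ M) :
    ∃ f, IsLocalGraph M p f ∧ ∃ κ : ℝ, κ ≠ 0 ∧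
      2 * isotropicMeanCurvature f (topView p) = (1 + a) * κ ∧
      isotropicGaussianCurvature f (topView p) = a * κ ^ 2 := by
  obtain ⟨f, hf, κ₁, κ₂, hκ, ⟨hne, h⟩ | ⟨hne, h⟩⟩ := h p hp
  · obtain ⟨h1, h2⟩ := hκ.eq_curvatures
    rw [div_eq_iff hne] at h
    exact ⟨f, hf, κ₂, hne, by rw [h1, h]; ring, by rw [h2, h]; ring⟩
  · obtain ⟨h1, h2⟩ := hκ.eq_curvatures
    rw [div_eq_iff hne] at h
    exact ⟨f, hf, κ₁, hne, by rw [h1, h]; ring, by rw [h2, h]; ring⟩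

theorem ratioRelation_notMem_nhds {a : ℝ} (ha : a ≠ 0) (w : ℝ × ℝ) :
    {v : ℝ × ℝ | (1 + a) ^ 2 * v.2 = 4 * a * v.1 ^ 2} ∉ 𝓝 w := by
  intro h
  have hc : Continuous fun s : ℝ => (((w.1 + s, w.2 + s), (w.1 - s, w.2 - s)) :
      (ℝ × ℝ) × (ℝ × ℝ)) := by fun_prop
  have h0 : Tendsto (fun s : ℝ => (((w.1 + s, w.2 + s), (w.1 - s, w.2 - s)) :
      (ℝ × ℝ) × (ℝ × ℝ))) (𝓝 0) (𝓝 (w, w)) := by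
    simpa using hc.tendsto 0
  have h1 := h0.eventually (prod_mem_nhds h h)
  obtain ⟨s, ⟨hs1, hs2⟩, hs3⟩ := ((h1.filter_mono nhdsWithin_le_nhds).and
    (self_mem_nhdsWithin : {(0 : ℝ)}ᶜ ∈ 𝓝[≠] 0)).exists
  have hw := mem_of_mem_nhds h
  simp only [Set.mem_ofPred_eq] at hs1 hs2 hw
  have : 8 * a * s ^ 2 = 0 := by linear_combination 2 * hw - hs1 - hs2
  simp [ha] at this
  exact hs3 this

/-! ### Graphs with constant curvatures -/

/-- The quadratic function whose Hessian has the eigenvalue `α + δ` in the direction of the unit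
vector `w` and the eigenvalue `α` in the perpendicular direction. -/
noncomputable def translationHeight (α δ : ℝ) (w m : ℝ × ℝ) (n : ℝ) (u : ℝ × ℝ) : ℝ :=
  (α * (u.1 ^ 2 + u.2 ^ 2) + δ * (w.1 * u.1 + w.2 * u.2) ^ 2) / 2 + (m.1 * u.1 + m.2 * u.2) + n

theorem hasFDerivAt_translationHeight (α δ : ℝ) (w m : ℝ × ℝ) (n : ℝ) (u : ℝ × ℝ) :
    HasFDerivAt (translationHeight α δ w m n)
      ((α * u.1 + δ * (w.1 * u.1 + w.2 * u.2) * w.1 + m.1) • ContinuousLinearMap.fst ℝ ℝ ℝ +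
        (α * u.2 + δ * (w.1 * u.1 + w.2 * u.2) * w.2 + m.2) • ContinuousLinearMap.snd ℝ ℝ ℝ)
      u := by
  have h1 : HasFDerivAt (fun v : ℝ × ℝ => v.1) (ContinuousLinearMap.fst ℝ ℝ ℝ) u := hasFDerivAt_fst
  have h2 : HasFDerivAt (fun v : ℝ × ℝ => v.2) (ContinuousLinearMap.snd ℝ ℝ ℝ) u := hasFDerivAt_snd
  convert! ((((((h1.pow 2).add (h2.pow 2)).const_mul α).add
    ((((h1.const_mul w.1).add (h2.const_mul w.2)).pow 2).const_mul δ)).mul_const (2⁻¹ : ℝ)).add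
    ((h1.const_mul m.1).add (h2.const_mul m.2))).add_const n using 1
  · ext <;> simp <;> ring

theorem analyticOnNhd_translationHeight (α δ : ℝ) (w m : ℝ × ℝ) (n : ℝ) (s : Set (ℝ × ℝ)) :
    AnalyticOnNhd ℝ (translationHeight α δ w m n) s := by
  intro u _
  have h1 : AnalyticAt ℝ (fun v : ℝ × ℝ => v.1) u := analyticAt_fst
  have h2 : AnalyticAt ℝ (fun v : ℝ × ℝ => v.2) u := analyticAt_snd
  unfold translationHeight
  fun_prop

theorem exists_unit_of_trace_det {α δ a b c : ℝ} (h1 : a + c = 2 * α + δ)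
    (h2 : (a - α) * (c - α) = b ^ 2) : ∃ w : ℝ × ℝ, w.1 ^ 2 + w.2 ^ 2 = 1 ∧
      a = α + δ * w.1 ^ 2 ∧ b = δ * w.1 * w.2 ∧ c = α + δ * w.2 ^ 2 := by
  obtain rfl : c = 2 * α + δ - a := by linarith
  have key : (a - α) * δ = (a - α) ^ 2 + b ^ 2 := by linear_combination h2
  by_cases ha : a = α
  · subst ha
    have hb : b = 0 := by simpa using h2.symm
    exact ⟨(0, 1), by simp, by simp, by simp [hb], by simp; ring⟩
  · have ha' : a - α ≠ 0 := sub_ne_zero.2 ha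
    have hpos : 0 < (a - α) * δ := by rw [key]; positivity
    have hδ : δ ≠ 0 := by rintro rfl; simp at hpos
    have hq : 0 < (a - α) / δ := by
      rw [show (a - α) / δ = (a - α) * δ / δ ^ 2 by field_simp]
      positivity
    have hw := Real.sq_sqrt hq.le
    have hw0 : √((a - α) / δ) ≠ 0 := (Real.sqrt_pos.2 hq).ne'
    set x := √((a - α) / δ)
    have hx : δ * x ^ 2 = a - α := by rw [hw]; field_simp
    have hy : δ * (b / (δ * x)) ^ 2 = α + δ - a := by
      rw [show δ * (b / (δ * x)) ^ 2 = b ^ 2 / (δ * x ^ 2) by field_simp, hx, div_eq_iff ha']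
      linear_combination -h2
    refine ⟨(x, b / (δ * x)), ?_, ?_, ?_, ?_⟩
    · have : δ * (x ^ 2 + (b / (δ * x)) ^ 2 - 1) = 0 := by linear_combination hx + hy
      have := (mul_eq_zero.1 this).resolve_left hδ
      simp only
      linarith
    · simp only
      linarith
    · simp only
      field_simp
    · simp only
      linarith

/-- An analytic function whose Hessian has constant eigenvalues is quadratic. The symmetry of the
third derivatives turns the derivatives of the two curvature equations into a homogeneous linear
system whose determinant is the squared difference of the eigenvalues. -/
theorem exists_eq_translationHeight {f : ℝ × ℝ → ℝ} {V : Set (ℝ × ℝ)} (hV : IsOpen V)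
    (hVc : IsPreconnected V) (hVne : V.Nonempty) (hf : AnalyticOnNhd ℝ f V) {α δ : ℝ}
    (hH : ∀ u ∈ V, 2 * isotropicMeanCurvature f u = 2 * α + δ)
    (hK : ∀ u ∈ V, isotropicGaussianCurvature f u = α * (α + δ)) :
    ∃ (w m : ℝ × ℝ) (n : ℝ), w.1 ^ 2 + w.2 ^ 2 = 1 ∧
      ∀ u ∈ V, f u = translationHeight α δ w m n u := by
  set g₁ : ℝ × ℝ → ℝ := fun v => fderiv ℝ f v (1, 0) with hg₁
  set g₂ : ℝ × ℝ → ℝ := fun v => fderiv ℝ f v (0, 1) with hg₂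
  have hg₁a : ∀ u ∈ V, AnalyticAt ℝ g₁ u := fun u hu =>
    ((ContinuousLinearMap.apply ℝ ℝ ((1, 0) : ℝ × ℝ)).analyticAt _).comp (hf u hu).fderiv
  have hg₂a : ∀ u ∈ V, AnalyticAt ℝ g₂ u := fun u hu =>
    ((ContinuousLinearMap.apply ℝ ℝ ((0, 1) : ℝ × ℝ)).analyticAt _).comp (hf u hu).fderiv
  have hd₁ : ∀ u ∈ V, ∀ d, fderiv ℝ (fderiv ℝ f) u d (1, 0) = fderiv ℝ g₁ u d := fun u hu d => by
    rw [(hasFDerivAt_fderiv_apply (hf u hu) (1, 0)).fderiv]; rfl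
  have hd₂ : ∀ u ∈ V, ∀ d, fderiv ℝ (fderiv ℝ f) u d (0, 1) = fderiv ℝ g₂ u d := fun u hu d => by
    rw [(hasFDerivAt_fderiv_apply (hf u hu) (0, 1)).fderiv]; rfl
  have hsym : ∀ u ∈ V, fderiv ℝ g₁ u (0, 1) = fderiv ℝ g₂ u (1, 0) := fun u hu => by
    rw [← hd₁ u hu, ← hd₂ u hu, hessian_symm (hf u hu)]
  have htr : ∀ u ∈ V, fderiv ℝ g₁ u (1, 0) + fderiv ℝ g₂ u (0, 1) = 2 * α + δ := fun u hu => by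
    rw [← hH u hu, two_mul_meanCurvature, hd₁ u hu, hd₂ u hu]
  have hdet : ∀ u ∈ V, (fderiv ℝ g₁ u (1, 0) - α) * (fderiv ℝ g₂ u (0, 1) - α) =
      fderiv ℝ g₂ u (1, 0) ^ 2 := fun u hu => by
    have h1 := hK u hu
    rw [gaussianCurvature_eq (hf u hu), hd₁ u hu, hd₂ u hu, hd₂ u hu] at h1
    linear_combination h1 - α * htr u hu
  -- the entries of the Hessian matrix are constant on `V`
  have hconst : ∃ a b c : ℝ, ∀ u ∈ V, fderiv ℝ g₁ u (1, 0) = a ∧ fderiv ℝ g₂ u (1, 0) = b ∧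
      fderiv ℝ g₂ u (0, 1) = c := by
    by_cases hδ : δ = 0
    · -- a symmetric matrix with a double eigenvalue is scalar
      refine ⟨α, 0, α, fun u hu => ?_⟩
      have h1 := htr u hu
      have h2 := hdet u hu
      set a := fderiv ℝ g₁ u (1, 0)
      obtain h3 : fderiv ℝ g₂ u (0, 1) = 2 * α - a := by rw [hδ] at h1; linarith
      rw [h3] at h2 ⊢
      have h4 : (a - α) ^ 2 + fderiv ℝ g₂ u (1, 0) ^ 2 = 0 := by linear_combination -h2
      have h5 : a - α = 0 := by nlinarith [sq_nonneg (a - α), sq_nonneg (fderiv ℝ g₂ u (1, 0))]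
      rw [h5] at h4
      refine ⟨by linarith, by simpa using h4, by linarith⟩
    · have hda := fun u hu => hasFDerivAt_fderiv_apply (hg₁a u hu) (1, 0)
      have hdb' := fun u hu => hasFDerivAt_fderiv_apply (hg₁a u hu) (0, 1)
      have hdb := fun u hu => hasFDerivAt_fderiv_apply (hg₂a u hu) (1, 0)
      have hdc := fun u hu => hasFDerivAt_fderiv_apply (hg₂a u hu) (0, 1)
      have hzero : ∀ u ∈ V, fderiv ℝ (fun v => fderiv ℝ g₁ v (1, 0)) u = 0 ∧
          fderiv ℝ (fun v => fderiv ℝ g₂ v (1, 0)) u = 0 ∧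
          fderiv ℝ (fun v => fderiv ℝ g₂ v (0, 1)) u = 0 := by
        intro u hu
        have hnV := hV.mem_nhds hu
        have e1 := DFunLike.congr_fun ((hda u hu).add (hdc u hu)).fderiv
        have e1' : fderiv ℝ ((fun v => fderiv ℝ g₁ v (1, 0)) + fun v => fderiv ℝ g₂ v (0, 1)) u
            = 0 := by
          rw [Filter.EventuallyEq.fderiv_eq (f₁ := _) (f := fun _ => 2 * α + δ)
            (by filter_upwards [hnV] with v hv using htr v hv)]
          simp
        have e2 := (((hda u hu).sub_const α).mul ((hdc u hu).sub_const α)).sub ((hdb u hu).pow 2)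
        have e2' := e2.fderiv
        rw [Filter.EventuallyEq.fderiv_eq (f := fun _ => (0 : ℝ)) (by
          filter_upwards [hnV] with v hv
          have := hdet v hv
          simp only [Pi.sub_apply, Pi.mul_apply]
          linarith)] at e2'
        have e3 : ∀ d, fderiv ℝ (fderiv ℝ g₁) u d (0, 1) = fderiv ℝ (fderiv ℝ g₂) u d (1, 0) := by
          intro d
          have h1 := (hdb' u hu).fderiv
          have h2 := (hdb u hu).fderiv
          have h3 : fderiv ℝ (fun v => fderiv ℝ g₁ v (0, 1)) u =
              fderiv ℝ (fun v => fderiv ℝ g₂ v (1, 0)) u :=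
            Filter.EventuallyEq.fderiv_eq (by filter_upwards [hnV] with v hv using hsym v hv)
          exact DFunLike.congr_fun (h1.symm.trans (h3.trans h2)) d
        rw [e1'] at e1
        have e4 := hessian_symm (hg₁a u hu)
        have e5 := hessian_symm (hg₂a u hu)
        have hx := e1 (1, 0)
        have hy := e1 (0, 1)
        have hx' := DFunLike.congr_fun e2' (1, 0)
        have hy' := DFunLike.congr_fun e2' (0, 1)
        have t1 := htr u hu
        have t2 := hdet u hu
        have b1 := e3 (1, 0)
        simp at hx hy hx' hy'
        set p := fderiv ℝ (fderiv ℝ g₁) u (1, 0) (1, 0)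
        set q := fderiv ℝ (fderiv ℝ g₁) u (0, 1) (1, 0)
        set r := fderiv ℝ (fderiv ℝ g₂) u (1, 0) (0, 1)
        set s := fderiv ℝ (fderiv ℝ g₂) u (0, 1) (0, 1)
        rw [← b1, ← e4] at hx'
        rw [e5] at hy'
        set a := fderiv ℝ g₁ u (1, 0)
        set b := fderiv ℝ g₂ u (1, 0)
        set c := fderiv ℝ g₂ u (0, 1)
        have hr : r = -p := by linarith
        have hs : s = -q := by linarith
        rw [hr] at hx' hy'
        rw [hs] at hy'
        have hdisc : (c - a) ^ 2 + 4 * b ^ 2 = δ ^ 2 := by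
          linear_combination -4 * t2 + (a + c - 2 * α + δ) * t1
        have hp : p = 0 := by
          refine (mul_eq_zero.1 (?_ : δ ^ 2 * p = 0)).resolve_left (pow_ne_zero 2 hδ)
          rw [← hdisc]
          linear_combination -(c - a) * hx' - 2 * b * hy'
        have hq : q = 0 := by
          refine (mul_eq_zero.1 (?_ : δ ^ 2 * q = 0)).resolve_left (pow_ne_zero 2 hδ)
          rw [← hdisc]
          linear_combination 2 * b * hx' - (c - a) * hy'
        have hb2 : fderiv ℝ (fderiv ℝ g₂) u (0, 1) (1, 0) = 0 := by rw [e5]; simp [r, hr, hp]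
        have hb1 : fderiv ℝ (fderiv ℝ g₂) u (1, 0) (1, 0) = 0 := by rw [← b1, ← e4]; exact hq
        refine ⟨?_, ?_, ?_⟩
        · rw [(hda u hu).fderiv]
          exact clm_ext_basis (by simpa using hp) (by simpa using hq)
        · rw [(hdb u hu).fderiv]
          exact clm_ext_basis (by simpa using hb1) (by simpa using hb2)
        · rw [(hdc u hu).fderiv]
          exact clm_ext_basis (by simpa [hp] using hr) (by simpa [hq] using hs)
      obtain ⟨u₀, hu₀⟩ := hVne
      refine ⟨fderiv ℝ g₁ u₀ (1, 0), fderiv ℝ g₂ u₀ (1, 0), fderiv ℝ g₂ u₀ (0, 1),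
        fun u hu => ⟨?_, ?_, ?_⟩⟩
      · exact hV.is_const_of_fderiv_eq_zero hVc (fun v hv =>
          (hda v hv).differentiableAt.differentiableWithinAt) (fun v hv => (hzero v hv).1) hu hu₀
      · exact hV.is_const_of_fderiv_eq_zero hVc (fun v hv =>
          (hdb v hv).differentiableAt.differentiableWithinAt) (fun v hv => (hzero v hv).2.1) hu hu₀
      · exact hV.is_const_of_fderiv_eq_zero hVc (fun v hv =>
          (hdc v hv).differentiableAt.differentiableWithinAt) (fun v hv => (hzero v hv).2.2) hu hu₀
  obtain ⟨a, b, c, habc⟩ := hconst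
  obtain ⟨u₀, hu₀⟩ := hVne
  obtain ⟨w, hw, rfl, rfl, rfl⟩ : ∃ w : ℝ × ℝ, w.1 ^ 2 + w.2 ^ 2 = 1 ∧
      a = α + δ * w.1 ^ 2 ∧ b = δ * w.1 * w.2 ∧ c = α + δ * w.2 ^ 2 := by
    obtain ⟨h1, h2, h3⟩ := habc u₀ hu₀
    apply exists_unit_of_trace_det
    · rw [← h1, ← h3]; exact htr u₀ hu₀
    · rw [← h1, ← h2, ← h3]; exact hdet u₀ hu₀
  have hfst := fun u : ℝ × ℝ => hasFDerivAt_fst (𝕜 := ℝ) (p := u)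
  have hsnd := fun u : ℝ × ℝ => hasFDerivAt_snd (𝕜 := ℝ) (p := u)
  -- integrate the Hessian, and then the gradient
  have i1 : ∀ u ∈ V, HasFDerivAt (fun v : ℝ × ℝ => g₁ v - ((α + δ * w.1 ^ 2) * v.1 +
      δ * w.1 * w.2 * v.2)) 0 u := fun u hu => by
    obtain ⟨h1, h2, h3⟩ := habc u hu
    refine ((hg₁a u hu).differentiableAt.hasFDerivAt.sub (((hfst u).const_mul
      (α + δ * w.1 ^ 2)).add ((hsnd u).const_mul (δ * w.1 * w.2)))).congr_fderiv ?_
    exact clm_ext_basis (by simp [h1]) (by simp [hsym u hu, h2])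
  have i2 : ∀ u ∈ V, HasFDerivAt (fun v : ℝ × ℝ => g₂ v - (δ * w.1 * w.2 * v.1 +
      (α + δ * w.2 ^ 2) * v.2)) 0 u := fun u hu => by
    obtain ⟨h1, h2, h3⟩ := habc u hu
    refine ((hg₂a u hu).differentiableAt.hasFDerivAt.sub (((hfst u).const_mul
      (δ * w.1 * w.2)).add ((hsnd u).const_mul (α + δ * w.2 ^ 2)))).congr_fderiv ?_
    exact clm_ext_basis (by simp [h2]) (by simp [h3])
  have c1 : ∀ u ∈ V, g₁ u - ((α + δ * w.1 ^ 2) * u.1 + δ * w.1 * w.2 * u.2) =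
      g₁ u₀ - ((α + δ * w.1 ^ 2) * u₀.1 + δ * w.1 * w.2 * u₀.2) := fun u hu =>
    hV.is_const_of_fderiv_eq_zero hVc (fun v hv =>
      (i1 v hv).differentiableAt.differentiableWithinAt) (fun v hv => (i1 v hv).fderiv) hu hu₀
  have c2 : ∀ u ∈ V, g₂ u - (δ * w.1 * w.2 * u.1 + (α + δ * w.2 ^ 2) * u.2) =
      g₂ u₀ - (δ * w.1 * w.2 * u₀.1 + (α + δ * w.2 ^ 2) * u₀.2) := fun u hu =>
    hV.is_const_of_fderiv_eq_zero hVc (fun v hv =>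
      (i2 v hv).differentiableAt.differentiableWithinAt) (fun v hv => (i2 v hv).fderiv) hu hu₀
  set m₁ := g₁ u₀ - ((α + δ * w.1 ^ 2) * u₀.1 + δ * w.1 * w.2 * u₀.2)
  set m₂ := g₂ u₀ - (δ * w.1 * w.2 * u₀.1 + (α + δ * w.2 ^ 2) * u₀.2)
  have i3 : ∀ u ∈ V, HasFDerivAt (fun v : ℝ × ℝ => f v -
      translationHeight α δ w (m₁, m₂) 0 v) (0 : ℝ × ℝ →L[ℝ] ℝ) u := by
    intro u hu
    refine ((hf u hu).differentiableAt.hasFDerivAt.sub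
      (hasFDerivAt_translationHeight α δ w (m₁, m₂) 0 u)).congr_fderiv ?_
    have h1 := c1 u hu
    have h2 := c2 u hu
    simp only [hg₁, hg₂] at h1 h2
    refine clm_ext_basis ?_ ?_
    · simp
      linear_combination h1
    · simp
      linear_combination h2
  refine ⟨w, (m₁, m₂), f u₀ - translationHeight α δ w (m₁, m₂) 0 u₀, hw, fun u hu => ?_⟩
  have c3 : f u - translationHeight α δ w (m₁, m₂) 0 u =
      f u₀ - translationHeight α δ w (m₁, m₂) 0 u₀ :=
    hV.is_const_of_fderiv_eq_zero hVc (fun v hv =>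
      (i3 v hv).differentiableAt.differentiableWithinAt) (fun v hv => (i3 v hv).fderiv) hu hu₀
  rw [← c3]
  unfold translationHeight
  ring

/-! ### Pipe surfaces with a constant ratio of principal curvatures -/

/-- Every member of the family of paraboloids of curvature `α` with the coefficients `B`, `C`, `D`
touches the graph of `translationHeight α δ w m n` along some line `w.1 * x + w.2 * y = s`. -/
def TouchesAlongLines (J : Set ℝ) (B C D : ℝ → ℝ) (δ : ℝ) (w m : ℝ × ℝ) (n : ℝ) : Prop :=
  ∀ t ∈ J, ∃ s : ℝ, B t / 2 = m.1 + δ * s * w.1 ∧ C t / 2 = m.2 + δ * s * w.2 ∧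
    D t / 2 = n - δ * s ^ 2 / 2

theorem line_of_isContact {f : ℝ × ℝ → ℝ} {V : Set (ℝ × ℝ)} (hV : IsOpen V) {α δ : ℝ}
    {w m : ℝ × ℝ} {n : ℝ} (hf : ∀ u ∈ V, f u = translationHeight α δ w m n u) {u : ℝ × ℝ}
    (hu : u ∈ V) {B C D : ℝ} (h : IsContact f α B C D u) :
    B / 2 = m.1 + δ * (w.1 * u.1 + w.2 * u.2) * w.1 ∧
      C / 2 = m.2 + δ * (w.1 * u.1 + w.2 * u.2) * w.2 ∧
      D / 2 = n - δ * (w.1 * u.1 + w.2 * u.2) ^ 2 / 2 := by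
  have he : f =ᶠ[𝓝 u] translationHeight α δ w m n := by
    filter_upwards [hV.mem_nhds hu] with v hv using hf v hv
  obtain ⟨h0, h1, h2⟩ := h
  rw [he.fderiv_eq, (hasFDerivAt_translationHeight α δ w m n u).fderiv] at h1 h2
  rw [hf u hu] at h0
  simp at h1 h2
  simp only [sphereHeight, translationHeight] at h0
  have e1 : B / 2 = m.1 + δ * (w.1 * u.1 + w.2 * u.2) * w.1 := by linarith
  have e2 : C / 2 = m.2 + δ * (w.1 * u.1 + w.2 * u.2) * w.2 := by linarith
  exact ⟨e1, e2, by linear_combination -h0 - u.1 * e1 - u.2 * e2⟩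

theorem isContact_of_eq_translationHeight_zero {f : ℝ × ℝ → ℝ} {V : Set (ℝ × ℝ)} (hV : IsOpen V)
    {α : ℝ} {w m : ℝ × ℝ} {n : ℝ} (hf : ∀ u ∈ V, f u = translationHeight α 0 w m n u)
    {u : ℝ × ℝ} (hu : u ∈ V) : IsContact f α (2 * m.1) (2 * m.2) (2 * n) u := by
  have he : f =ᶠ[𝓝 u] translationHeight α 0 w m n := by
    filter_upwards [hV.mem_nhds hu] with v hv using hf v hv
  refine ⟨?_, ?_, ?_⟩
  · rw [hf u hu]
    unfold sphereHeight translationHeight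
    ring
  · rw [he.fderiv_eq, (hasFDerivAt_translationHeight α 0 w m n u).fderiv]
    simp
  · rw [he.fderiv_eq, (hasFDerivAt_translationHeight α 0 w m n u).fderiv]
    simp

theorem not_countable_of_mem_nhds {s : Set ℝ} {x : ℝ} (h : s ∈ 𝓝 x) : ¬ s.Countable := by
  obtain ⟨a, b, hx, hs⟩ := mem_nhds_iff_exists_Ioo_subset.1 h
  intro hc
  have := Cardinal.Real.Ioo_countable_iff.1 (hc.mono hs)
  exact absurd (hx.1.trans hx.2) (not_lt.2 this)

/-- Three members of a family that touch a graph along equidistant lines determine the graph. -/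
theorem translationHeight_eq_of_three {α δ δ' : ℝ} {w m w' m' : ℝ × ℝ} {n n' : ℝ}
    (hδ : δ ≠ 0) (hδ' : δ' ≠ 0) (hw : w.1 ^ 2 + w.2 ^ 2 = 1) (hw' : w'.1 ^ 2 + w'.2 ^ 2 = 1)
    {B C D : Fin 3 → ℝ} {s η : ℝ} (hη : η ≠ 0)
    (h : ∀ i : Fin 3, B i = m.1 + δ * (s + (i - 1 : ℝ) * η) * w.1 ∧
      C i = m.2 + δ * (s + (i - 1 : ℝ) * η) * w.2 ∧
      D i = n - δ * (s + (i - 1 : ℝ) * η) ^ 2 / 2)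
    (h' : ∀ i : Fin 3, ∃ s' : ℝ, B i = m'.1 + δ' * s' * w'.1 ∧ C i = m'.2 + δ' * s' * w'.2 ∧
      D i = n' - δ' * s' ^ 2 / 2) :
    translationHeight α δ w m n = translationHeight α δ' w' m' n' := by
  choose s' hB' hC' hD' using h'
  have hh0 := h 0
  have hh1 := h 1
  have hh2 := h 2
  obtain ⟨b0, c0, d0⟩ := hh0
  obtain ⟨b1, c1, d1⟩ := hh1
  obtain ⟨b2, c2, d2⟩ := hh2
  rw [hB'] at b0 b1 b2
  rw [hC'] at c0 c1 c2
  rw [hD'] at d0 d1 d2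
  generalize s' 0 = x at *
  generalize s' 1 = y at *
  generalize s' 2 = z at *
  norm_num at b0 b1 b2 c0 c1 c2 d0 d1 d2
  -- the directions of the lines agree up to the sign `ε`, and `x`, `y`, `z` are equidistant
  have k1 : δ * η * w.1 = δ' * (y - x) * w'.1 := by linear_combination b0 - b1
  have k2 : δ * η * w.2 = δ' * (y - x) * w'.2 := by linear_combination c0 - c1
  have k3 : δ * η * w.1 = δ' * (z - y) * w'.1 := by linear_combination b1 - b2
  have k4 : δ * η * w.2 = δ' * (z - y) * w'.2 := by linear_combination c1 - c2
  have hz : z = 2 * y - x := by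
    have : δ' * (z - 2 * y + x) = 0 := by
      linear_combination w'.1 * (k1 - k3) + w'.2 * (k2 - k4) - δ' * (z - 2 * y + x) * hw'
    have := (mul_eq_zero.1 this).resolve_left hδ'
    linarith
  obtain ⟨ε, hε⟩ : ∃ ε, δ' * (y - x) = ε * (δ * η) := ⟨δ' * (y - x) / (δ * η), by field_simp⟩
  have hδη : δ * η ≠ 0 := mul_ne_zero hδ hη
  have w1 : w.1 = ε * w'.1 := mul_left_cancel₀ hδη (by rw [k1, hε]; ring)
  have w2 : w.2 = ε * w'.2 := mul_left_cancel₀ hδη (by rw [k2, hε]; ring)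
  have hε1 : ε ^ 2 = 1 := by rw [w1, w2] at hw; linear_combination hw - ε ^ 2 * hw'
  have hdd : δ' * (y - x) ^ 2 = δ * η ^ 2 := by
    rw [hz] at d2
    linear_combination 2 * d1 - d0 - d2
  have hδδ : δ' = δ := by
    refine mul_right_cancel₀ (mul_ne_zero hδη hη) ?_
    linear_combination (-δ') * hdd + (δ' * (y - x) + ε * (δ * η)) * hε + δ ^ 2 * η ^ 2 * hε1
  subst hδδ
  have hk : y - x = ε * η := mul_left_cancel₀ hδ (by rw [hε]; ring)
  have hy : y = ε * s := by
    have : 2 * δ' * η * (ε * y - s) = 0 := by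
      rw [hz, show x = y - ε * η by linarith] at d2
      rw [show x = y - ε * η by linarith] at d0
      linear_combination d0 - d2
    have h3 : ε * y - s = 0 := (mul_eq_zero.1 this).resolve_left
      (mul_ne_zero (mul_ne_zero two_ne_zero hδ) hη)
    linear_combination ε * h3 - y * hε1
  subst hy
  have m1 : m.1 = m'.1 := by rw [w1] at b1; linear_combination -b1
  have m2 : m.2 = m'.2 := by rw [w2] at c1; linear_combination -c1
  have hn : n = n' := by linear_combination -d1 - δ' * s ^ 2 / 2 * hε1
  funext v
  unfold translationHeight
  rw [w1, w2, m1, m2, hn]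
  linear_combination (δ' / 2 * (w'.1 * v.1 + w'.2 * v.2) ^ 2) * hε1

section Pipe

variable {M : Set Space} {J : Set ℝ} {A B C D : ℝ → ℝ} {α : ℝ}

theorem IsAnalyticEnvelope.exists_eq_translationHeight (hE : IsAnalyticEnvelope M J A B C D)
    (hA : ∀ t ∈ J, A t = α) {a : ℝ} (ha : a ≠ 0) (hM : HasConstantCurvatureRatio M a)
    {f : ℝ × ℝ → ℝ} {V : Set (ℝ × ℝ)} (hf : IsGraphPatch M f V) (hV : IsPreconnected V)
    (hVne : V.Nonempty) : ∃ (δ : ℝ) (w m : ℝ × ℝ) (n : ℝ), δ ≠ 0 ∧ α + δ ≠ 0 ∧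
      w.1 ^ 2 + w.2 ^ 2 = 1 ∧ ∀ u ∈ V, f u = translationHeight α δ w m n u := by
  have hcurv : ∀ u ∈ V, ∃ κ : ℝ, κ ≠ 0 ∧ 2 * isotropicMeanCurvature f u = (1 + a) * κ ∧
      isotropicGaussianCurvature f u = a * κ ^ 2 := by
    intro u hu
    obtain ⟨g, hg, κ, hκ, h1, h2⟩ := hM.exists_curvature (hf.mem hu)
    have hH := hf.hessianMatrix_eq hu hg
    refine ⟨κ, hκ, ?_, ?_⟩
    · rw [← h1, isotropicMeanCurvature, ← hH]
      rfl
    · rw [← h2, isotropicGaussianCurvature, ← hH]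
      rfl
  have hprin : ∀ u ∈ V, α ^ 2 - 2 * isotropicMeanCurvature f u * α +
      isotropicGaussianCurvature f u = 0 := by
    intro u hu
    obtain ⟨t, ht, hc⟩ := hE.exists_contact hf hu
    have := hf.curvature_eq hu (hE.isCurve ht) hc
    rwa [hA t ht] at this
  -- one principal curvature is `α` and the other one is `a * α` or `α / a`, so `H` is constant
  have hmaps : Set.MapsTo (isotropicMeanCurvature f) V
      {(1 + a) * α / 2, (1 + a) * (α / a) / 2} := by
    intro u hu
    obtain ⟨κ, hκ, h1, h2⟩ := hcurv u hu
    have h3 := hprin u hu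
    rw [h1, h2] at h3
    have h4 : (α - κ) * (α - a * κ) = 0 := by linear_combination h3
    rcases mul_eq_zero.1 h4 with h | h
    · left
      rw [sub_eq_zero.1 h]
      linarith
    · right
      rw [Set.mem_singleton_iff, sub_eq_zero.1 h, mul_div_cancel_left₀ _ ha]
      linarith
  have hcont : ContinuousOn (isotropicMeanCurvature f) V := fun u hu =>
    (analyticAt_meanCurvature (hf.analytic u hu)).continuousAt.continuousWithinAt
  obtain ⟨u₀, hu₀⟩ := id hVne
  have hconst : ∀ u ∈ V, isotropicMeanCurvature f u = isotropicMeanCurvature f u₀ := fun u hu =>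
    hV.constant_of_mapsTo (Set.toFinite _).isDiscrete hcont hmaps hu hu₀
  set δ := 2 * isotropicMeanCurvature f u₀ - 2 * α with hδ
  obtain ⟨w, m, n, hw, hfw⟩ := _root_.exists_eq_translationHeight (α := α) (δ := δ) hf.isOpen hV
    hVne hf.analytic (fun u hu => by rw [hconst u hu, hδ]; ring) fun u hu => by
      have := hprin u hu
      rw [hconst u hu] at this
      rw [hδ]
      linear_combination this
  refine ⟨δ, w, m, n, ?_, ?_, hw, hfw⟩
  · -- an umbilical surface lies on a single paraboloid of the family
    intro h0
    rw [h0] at hfw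
    obtain ⟨t, ht, hc⟩ := hE.exists_contact hf hu₀
    rw [hA t ht] at hc
    obtain ⟨h1, h2, h3⟩ := line_of_isContact hf.isOpen hfw hu₀ hc
    refine hE.not_contact_on_open hf hf.isOpen subset_rfl hVne ht fun u hu => ?_
    have := isContact_of_eq_translationHeight_zero hf.isOpen hfw hu
    rw [hA t ht, show B t = 2 * m.1 by linarith, show C t = 2 * m.2 by linarith,
      show D t = 2 * n by linarith]
    exact this
  · intro h0
    obtain ⟨κ, hκ, h1, h2⟩ := hcurv u₀ hu₀
    have h3 := hprin u₀ hu₀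
    have h4 : a * κ ^ 2 = 0 := by
      rw [← h2]
      linear_combination h3 + α * h0
    simp [ha, hκ] at h4

/-- The contact conditions over an open set determine the coefficients for uncountably many
parameters, hence for all of them by analyticity. -/
theorem IsAnalyticEnvelope.touchesAlongLines (hE : IsAnalyticEnvelope M J A B C D)
    (hA : ∀ t ∈ J, A t = α) {f : ℝ × ℝ → ℝ} {V : Set (ℝ × ℝ)} (hf : IsGraphPatch M f V)
    (hVne : V.Nonempty) {δ : ℝ} {w m : ℝ × ℝ} {n : ℝ} (hδ : δ ≠ 0) (hw : w.1 ^ 2 + w.2 ^ 2 = 1)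
    (hfw : ∀ u ∈ V, f u = translationHeight α δ w m n u) : TouchesAlongLines J B C D δ w m n := by
  obtain ⟨-, hJ, -, hB, hC, hD, -, -, -⟩ := id hE
  obtain ⟨u₀, hu₀⟩ := hVne
  set s : ℝ → ℝ := fun t => (w.1 * (B t / 2 - m.1) + w.2 * (C t / 2 - m.2)) / δ with hs
  have hsa : AnalyticOnNhd ℝ s J := fun t ht => by
    have := hB t ht
    have := hC t ht
    simp only [hs]
    fun_prop (disch := assumption)
  set T : Set ℝ := {t ∈ J | B t / 2 = m.1 + δ * s t * w.1 ∧ C t / 2 = m.2 + δ * s t * w.2 ∧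
    D t / 2 = n - δ * s t ^ 2 / 2} with hT
  -- the contact lines through the points `u₀ + x * w` are pairwise different
  have hTc : ¬ T.Countable := by
    intro hc
    have hcont : Continuous fun x : ℝ => u₀ + x • w := by fun_prop
    have hnhds : {x : ℝ | u₀ + x • w ∈ V} ∈ 𝓝 (0 : ℝ) :=
      hcont.continuousAt.preimage_mem_nhds (hf.isOpen.mem_nhds (by simpa using hu₀))
    refine not_countable_of_mem_nhds hnhds
      ((hc.image fun t => s t - (w.1 * u₀.1 + w.2 * u₀.2)).mono fun x hx => ?_)
    obtain ⟨t, ht, hct⟩ := hE.exists_contact hf hx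
    rw [hA t ht] at hct
    obtain ⟨h1, h2, h3⟩ := line_of_isContact hf.isOpen hfw hx hct
    have hst : s t = w.1 * (u₀ + x • w).1 + w.2 * (u₀ + x • w).2 := by
      simp only [hs]
      rw [h1, h2, div_eq_iff hδ]
      linear_combination (w.1 * (u₀ + x • w).1 + w.2 * (u₀ + x • w).2) * δ * hw
    refine ⟨t, ⟨ht, ?_⟩, ?_⟩
    · rw [hst]
      exact ⟨h1, h2, h3⟩
    · simp only [hst, Prod.fst_add, Prod.snd_add, Prod.smul_fst, Prod.smul_snd, smul_eq_mul]
      linear_combination x * hw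
  have hall : ∀ g : ℝ → ℝ, AnalyticOnNhd ℝ g J → (∀ t ∈ T, g t = 0) → ∀ t ∈ J, g t = 0 :=
    fun g hg hgT => hg.eqOn_zero_of_not_countable hJ fun hc =>
      hTc (hc.mono fun t (ht : t ∈ T) => (⟨ht.1, hgT t ht⟩ : t ∈ {t ∈ J | g t = 0}))
  intro t ht
  refine ⟨s t, ?_, ?_, ?_⟩
  · refine sub_eq_zero.1 (hall (fun t => B t / 2 - (m.1 + δ * s t * w.1)) (fun t ht => ?_)
      (fun t ht => sub_eq_zero.2 ht.2.1) t ht)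
    have := hB t ht
    have := hsa t ht
    fun_prop (disch := simp)
  · refine sub_eq_zero.1 (hall (fun t => C t / 2 - (m.2 + δ * s t * w.2)) (fun t ht => ?_)
      (fun t ht => sub_eq_zero.2 ht.2.2.1) t ht)
    have := hC t ht
    have := hsa t ht
    fun_prop (disch := simp)
  · refine sub_eq_zero.1 (hall (fun t => D t / 2 - (n - δ * s t ^ 2 / 2)) (fun t ht => ?_)
      (fun t ht => sub_eq_zero.2 ht.2.2.2) t ht)
    have := hD t ht
    have := hsa t ht
    fun_prop (disch := simp)

/-- All patches of the surface belong to the same quadric. -/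
theorem IsAnalyticEnvelope.translationHeight_eq (hE : IsAnalyticEnvelope M J A B C D)
    (hA : ∀ t ∈ J, A t = α) {f : ℝ × ℝ → ℝ} {V : Set (ℝ × ℝ)} (hf : IsGraphPatch M f V)
    (hVne : V.Nonempty) {δ : ℝ} {w m : ℝ × ℝ} {n : ℝ} (hδ : δ ≠ 0) (hw : w.1 ^ 2 + w.2 ^ 2 = 1)
    (hfw : ∀ u ∈ V, f u = translationHeight α δ w m n u) {δ' : ℝ} {w' m' : ℝ × ℝ} {n' : ℝ}
    (hδ' : δ' ≠ 0) (hw' : w'.1 ^ 2 + w'.2 ^ 2 = 1) (h' : TouchesAlongLines J B C D δ' w' m' n') :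
    translationHeight α δ w m n = translationHeight α δ' w' m' n' := by
  obtain ⟨u₀, hu₀⟩ := hVne
  obtain ⟨η, hη, hηV⟩ : ∃ η : ℝ, η ≠ 0 ∧ ∀ i : Fin 3, u₀ + ((i - 1 : ℝ) * η) • w ∈ V := by
    have h : ∀ᶠ η : ℝ in 𝓝 0, ∀ i : Fin 3, u₀ + ((i - 1 : ℝ) * η) • w ∈ V := by
      refine eventually_all.2 fun i => ?_
      have hcont : Continuous fun x : ℝ => u₀ + ((i - 1 : ℝ) * x) • w := by fun_prop
      exact hcont.continuousAt.preimage_mem_nhds (hf.isOpen.mem_nhds (by simpa using hu₀))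
    obtain ⟨η, h1, h2⟩ := ((h.filter_mono nhdsWithin_le_nhds).and
      (self_mem_nhdsWithin : {(0 : ℝ)}ᶜ ∈ 𝓝[≠] 0)).exists
    exact ⟨η, h2, h1⟩
  choose t ht hct using fun i => hE.exists_contact hf (hηV i)
  refine translationHeight_eq_of_three (B := fun i => B (t i) / 2) (C := fun i => C (t i) / 2)
    (D := fun i => D (t i) / 2) (s := w.1 * u₀.1 + w.2 * u₀.2) hδ hδ' hw hw' hη (fun i => ?_)
    fun i => h' (t i) (ht i)
  have hc := hct i
  rw [hA _ (ht i)] at hc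
  have hl := line_of_isContact hf.isOpen hfw (hηV i) hc
  have hs : w.1 * (u₀ + ((i - 1 : ℝ) * η) • w).1 + w.2 * (u₀ + ((i - 1 : ℝ) * η) • w).2 =
      w.1 * u₀.1 + w.2 * u₀.2 + (i - 1 : ℝ) * η := by
    simp only [Prod.fst_add, Prod.snd_add, Prod.smul_fst, Prod.smul_snd, smul_eq_mul]
    linear_combination (i - 1 : ℝ) * η * hw
  rwa [hs] at hl

theorem exists_isPreconnected_patch (hM : IsAnalyticSurface M) {p : Space} (hp : p ∈ M)
    {f : ℝ × ℝ → ℝ} (hf : IsLocalGraph M p f) {N : Set (ℝ × ℝ)} (hN : N ∈ 𝓝 (topView p)) :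
    ∃ V ⊆ N, V.Nonempty ∧ IsPreconnected V ∧ IsGraphPatch M f V := by
  obtain ⟨U, hUN, ⟨u, hu⟩, hU⟩ := exists_isGraphPatch hM hp hf hN
  obtain ⟨r, hr, hrU⟩ := Metric.isOpen_iff.1 hU.isOpen u hu
  exact ⟨Metric.ball u r, hrU.trans hUN, ⟨u, Metric.mem_ball_self hr⟩,
    (convex_ball u r).isPreconnected, hU.mono Metric.isOpen_ball hrU⟩

theorem IsAnalyticEnvelope.subset_graph_translationHeight (hE : IsAnalyticEnvelope M J A B C D)
    (hA : ∀ t ∈ J, A t = α) {a : ℝ} (ha : a ≠ 0) (hM : HasConstantCurvatureRatio M a)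
    (hne : M.Nonempty) : ∃ (δ : ℝ) (w m : ℝ × ℝ) (n : ℝ), α + δ ≠ 0 ∧ w.1 ^ 2 + w.2 ^ 2 = 1 ∧
      M ⊆ {p | p.2.2 = translationHeight α δ w m n (topView p)} := by
  obtain ⟨p₀, hp₀⟩ := hne
  obtain ⟨f₀, hf₀, -⟩ := hM p₀ hp₀
  obtain ⟨V₀, -, hV₀ne, hV₀c, hV₀⟩ := exists_isPreconnected_patch hE.1 hp₀ hf₀ univ_mem
  obtain ⟨δ, w, m, n, hδ, hβ, hw, hfw⟩ := hE.exists_eq_translationHeight hA ha hM hV₀ hV₀c hV₀ne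
  have hlines := hE.touchesAlongLines hA hV₀ hV₀ne hδ hw hfw
  refine ⟨δ, w, m, n, hβ, hw, fun p hp => ?_⟩
  obtain ⟨f, hf, -⟩ := hM p hp
  obtain ⟨r, hr, hfr⟩ := Metric.eventually_nhds_iff_ball.1 hf.1.eventually_analyticAt
  obtain ⟨V, hVr, ⟨u, hu⟩, hVc, hV⟩ := exists_isPreconnected_patch hE.1 hp hf
    (Metric.ball_mem_nhds _ hr)
  obtain ⟨δ', w', m', n', hδ', -, hw', hfw'⟩ := hE.exists_eq_translationHeight hA ha hM hV hVc
    ⟨u, hu⟩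
  rw [hE.translationHeight_eq hA hV ⟨u, hu⟩ hδ' hw' hfw' hδ hw hlines] at hfw'
  have heq := AnalyticOnNhd.eqOn_of_preconnected_of_eventuallyEq (f := f) hfr
    (analyticOnNhd_translationHeight α δ w m n _) (convex_ball _ _).isPreconnected (hVr hu)
    (by filter_upwards [hV.isOpen.mem_nhds hu] with v hv using hfw' v hv)
  have hz : p.2.2 = f (topView p) := hf.2.self_of_nhdsWithin hp
  exact hz.trans (heq (Metric.mem_ball_self hr))

end Pipe

/-! ### Parabolic rotational surfaces -/

theorem isAnalyticSurface_graph {f : ℝ × ℝ → ℝ} (hf : AnalyticOnNhd ℝ f Set.univ) :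
    IsAnalyticSurface {p | p.2.2 = f (topView p)} := by
  let tv : Space →L[ℝ] ℝ × ℝ := (ContinuousLinearMap.fst ℝ ℝ (ℝ × ℝ)).prod
    ((ContinuousLinearMap.fst ℝ ℝ ℝ).comp (ContinuousLinearMap.snd ℝ ℝ (ℝ × ℝ)))
  let zc : Space →L[ℝ] ℝ := (ContinuousLinearMap.snd ℝ ℝ ℝ).comp
    (ContinuousLinearMap.snd ℝ ℝ (ℝ × ℝ))
  intro p _
  have hfp := hf (topView p) trivial
  refine ⟨fun q => q.2.2 - f (topView q), (zc.analyticAt p).sub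
    (AnalyticAt.comp (g := f) (f := tv) hfp (tv.analyticAt p)), fun h0 => ?_,
    Or.inl (Eventually.of_forall fun q => sub_eq_zero.symm)⟩
  have h1 : HasFDerivAt f (fderiv ℝ f (topView p)) (tv p) := hfp.differentiableAt.hasFDerivAt
  have h2 : fderiv ℝ (fun q : Space => q.2.2 - f (topView q)) p =
      zc - (fderiv ℝ f (topView p)).comp tv :=
    (zc.hasFDerivAt.sub (h1.comp p tv.hasFDerivAt)).fderiv
  have h3 := DFunLike.congr_fun (h2.symm.trans h0) (0, 0, 1)
  have e1 : tv (0, 0, 1) = 0 := rfl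
  have e2 : zc (0, 0, 1) = 1 := rfl
  simp [e1, e2] at h3

/-- With `x = w.1 * X + w.2 * Y` as new first coordinate, the graph becomes the image of the
paraboloid `z = x² / 2 + α / (2 * (α + δ)) * y²`, which is invariant under the parabolic rotations
with the parameter `b = 0`. -/
theorem isParabolicRotational_graph_translationHeight {α δ : ℝ} {w m : ℝ × ℝ} {n : ℝ}
    (hβ : α + δ ≠ 0) (hw : w.1 ^ 2 + w.2 ^ 2 = 1) :
    IsParabolicRotational {p | p.2.2 = translationHeight α δ w m n (topView p)} := by
  refine ⟨isAnalyticSurface_graph (analyticOnNhd_translationHeight α δ w m n _),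
    fun p => (w.1 * p.1 - w.2 * p.2.1 + 0, w.2 * p.1 + w.1 * p.2.1 + 0,
      (m.1 * w.1 + m.2 * w.2) * p.1 + (m.2 * w.1 - m.1 * w.2) * p.2.1 + (α + δ) * p.2.2 + n),
    {p | p.2.2 = p.1 ^ 2 / 2 + α / (2 * (α + δ)) * p.2.1 ^ 2}, 0,
    ⟨w.1, w.2, _, _, _, 0, 0, n, ?_, hβ, fun x y z => rfl⟩, fun t => ?_, ?_⟩
  · by_contra! h
    rw [h.1, h.2] at hw
    simp at hw
  · have hsub : ∀ t : ℝ, parabolicRotation 0 t '' {p | p.2.2 = p.1 ^ 2 / 2 +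
        α / (2 * (α + δ)) * p.2.1 ^ 2} ⊆
        {p | p.2.2 = p.1 ^ 2 / 2 + α / (2 * (α + δ)) * p.2.1 ^ 2} := by
      rintro t _ ⟨p, hp, rfl⟩
      simp only [parabolicRotation, Set.mem_ofPred_eq] at hp ⊢
      rw [hp]
      ring
    refine (hsub t).antisymm fun p hp => ⟨parabolicRotation 0 (-t) p, hsub (-t) ⟨p, hp, rfl⟩, ?_⟩
    ext <;> simp only [parabolicRotation] <;> ring
  · have hc : (α + δ) * (α / (2 * (α + δ))) = α / 2 := by field_simp
    ext ⟨x, y, z⟩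
    simp only [Set.mem_ofPred_eq, Set.mem_image, topView, translationHeight, Prod.mk.injEq]
    constructor
    · intro h
      refine ⟨(w.1 * x + w.2 * y, -w.2 * x + w.1 * y, (z - (m.1 * x + m.2 * y) - n) / (α + δ)),
        ?_, ?_, ?_, ?_⟩
      · simp only
        rw [div_eq_iff hβ, h]
        linear_combination -(-w.2 * x + w.1 * y) ^ 2 * hc - α / 2 * (x ^ 2 + y ^ 2) * hw
      · linear_combination x * hw
      · linear_combination y * hw
      · simp only
        rw [mul_div_cancel₀ _ hβ]
        linear_combination (m.1 * x + m.2 * y) * hw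
    · rintro ⟨q, hq, rfl, rfl, rfl⟩
      have hx : w.1 * (w.1 * q.1 - w.2 * q.2.1 + 0) + w.2 * (w.2 * q.1 + w.1 * q.2.1 + 0) =
          q.1 := by linear_combination q.1 * hw
      rw [hq, hx]
      linear_combination q.2.1 ^ 2 * hc - α / 2 * (q.1 ^ 2 + q.2.1 ^ 2) * hw

/-! ### Channel Weingarten surfaces -/

theorem mainTheorem4 :
    (∀ M : Set Space, IsAnalyticIsotropicChannel M → IsIsotropicWeingarten M →
      IsIsotropicRotational M ∨ IsAnalyticIsotropicPipe M) ∧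
    (∀ (M : Set Space) (a : ℝ), IsAnalyticIsotropicChannel M → a ≠ 0 →
      HasConstantCurvatureRatio M a →
      ∃ R : Set Space, M ⊆ R ∧ (IsIsotropicRotational R ∨ IsParabolicRotational R)) := by
  refine ⟨fun M hM hW => ?_, fun M a hM ha hR => ?_⟩
  · obtain ⟨J, A, B, C, D, hE⟩ := hM
    by_cases hne : ∃ s ∈ J, ∃ t ∈ J, A s ≠ A t
    · obtain ⟨F, hF, hFM⟩ := hW
      exact Or.inl (hE.isIsotropicRotational_of_curvatures hne hF.notMem_nhds hFM)
    · push Not at hne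
      refine Or.inr ⟨J, A, B, C, D, hE, ?_⟩
      rcases J.eq_empty_or_nonempty with rfl | ⟨s, hs⟩
      · exact ⟨0, fun t ht => ht.elim⟩
      · exact ⟨1 / A s, fun t ht => by rw [hne t ht s hs]⟩
  · obtain ⟨J, A, B, C, D, hE⟩ := hM
    by_cases hne : ∃ s ∈ J, ∃ t ∈ J, A s ≠ A t
    · refine ⟨M, subset_rfl, Or.inl (hE.isIsotropicRotational_of_curvatures hne
        (ratioRelation_notMem_nhds ha) fun p hp => ?_)⟩
      obtain ⟨f, hf, κ, -, h1, h2⟩ := hR.exists_curvature hp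
      refine ⟨f, hf, ?_⟩
      rw [Set.mem_ofPred_eq, h2]
      linear_combination (-a) * (2 * isotropicMeanCurvature f (topView p) + (1 + a) * κ) * h1
    · push Not at hne
      rcases M.eq_empty_or_nonempty with rfl | ⟨p, hp⟩
      · exact ⟨_, Set.empty_subset _, Or.inr (isParabolicRotational_graph_translationHeight
          (α := 0) (δ := 1) (w := (1, 0)) (m := (0, 0)) (n := 0) (by norm_num) (by norm_num))⟩
      · obtain ⟨s, hs, -⟩ := hE.2.2.2.2.2.2.2.2 p hp
        obtain ⟨δ, w, m, n, hβ, hw, hsub⟩ := hE.subset_graph_translationHeight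
          (fun t ht => hne t ht s hs) ha hR ⟨p, hp⟩
        exact ⟨_, hsub, Or.inr (isParabolicRotational_graph_translationHeight hβ hw)⟩
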